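/- **Setting.** An instance of Directed Latency with Target consists of a set $V$ of $n$ clients, two further points $s,s'$, and an asymmetric metric $c$ on $V\cup\{s,s'\}$ ($c(u,u)=0$ and $c(u,w)\le c(u,v)+c(v,w)$, symmetry not required). A solution is an $s$-$s'$-path $P$ visiting every client exactly once; its total latency is $\ell(P)=\sum_{v\in V}c_P(v)$, where $c_P(v)$ is the length of the part of $P$ from $s$ to $v$. For $\epsilon>0$ the instance is *$\epsilon$-nice* if $n=2^k-1$ for an integer $k$ and, for all distinct $u,v\in V\cup\{s,s'\}$, $c(u,v)$ is a positive integer with $c(u,v)\le 2n^5/\epsilon^2$. **Triples.** A triple $(\mathcal T,A_{\rm tour},R)$ consists of integer bucket thresholds $\mathcal T=(t_0,\dots,t_q)$ with $t_0=0$, $q\le\log_2(n+1)$, $t_{i-1}<t_i$ and $t_i\ge\frac43t_{i-1}$ for $i\in[q]=\{1,\dots,q\}$, a set $A_{\rm tour}\subseteq[q]$, and roots $R=(r_i)_{i\in A_{\rm tour}}$, where every client has one colocated copy outside $V$ and each $r_i$ is such a copy. Put $I_i=[t_{i-1},t_i)$, $I_{\rm tour}=\bigcup_{i\in A_{\rm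 tour}}I_i$ and $T=t_q+n^2\max_{u,v\in V\cup\{s,s'\}}c(u,v)$. **Strengthened time-indexed LP of a triple.** The graph $G_T$ has vertex set $((V\cup R)\times[T])\cup\{(s,0),(s',T+1)\}$ and an edge from $(u,t)$ to a different vertex $(v,t')$ iff $c(u,v)\le t'-t$. Let $F_R$ be the set of edges $((u,t),(v,t'))$ for which some $i\in A_{\rm tour}$ satisfies $t<t_{i-1}\le t'$ and $v\ne r_i$, or $t<t_i\le t'$ and $u\neq r_i$. Write $\delta^+(p)$, $\delta^-(p)$ for the edges leaving and entering the vertex $p$, and $\delta^-(S,t)$ for the edges $((u,t'),(v,t))$ with $u\notin S$, $v\in S$. A feasible solution consists of $x\in[0,1]^{V[G_T]}$ and $z\in[0,1]^{E[G_T]}$ with 1. $\sum_{t\in[T]}x_{v,t}=1$ for all $v\in V$, and $x_{v,t}=0$ for all $v\in V$ and $t\in[T]$ with $t\ge t_q$ (clients are visited within $I_1\cup\dots\cup I_q$); 2. $z(\delta^+(v,t))=z(\delta^-(v,t))=x_{v,t}$ for all $v\in V$, $t\in[T]$; 3. $z(\delta^+(s,0))=z(\delta^-(s',T+1))=1$;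 4. $\sum_{t'\in[t]}z(\delta^-(S,t'))\ge\sum_{t'\in[t]}x_{v,t'}$ for all $S\subseteq V\cup R$, $v\in S\cap V$, $t\in[T]$; 5. $z(\delta^-(r,t))=z(\delta^+(r,t))$ for all $r\in R$ and $t\in[T]\cup\{0\}$; 6. $z_e=0$ for all $e\in F_R$; 7. $\sum_{t\in[t_i-1]}(x_{u,t}-x_{v,t})\le\sum_{t\in I_{\rm tour}\cap[T]}(x_{u,t}+x_{v,t})$ for all $u,v\in V$ and $i\in[q-1]$ such that $(u,v)$ is not $t_{i+1}$-short, i.e. such that $c(u,v)>\max\{c(v,u),t_{i+1}\}$. Its cost is $\sum_{v\in V}\sum_{i\in[q]}\sum_{t\in I_i\cap[T]}t_i\,x_{v,t}$. **Theorem.** There are a deterministic algorithm (a fixed program of a random access machine with unit-cost comparison, memory access, addition, truncated subtraction and halving of natural numbers) and constants $C,d\in\mathbb N$ such that for every $\epsilon>0$ and every $\epsilon$-nice instance with $n$ clients the following holds. Given $n$ and the matrix of distances, the algorithm halts after at most $C(n+\frac1\epsilon+1)^d$ steps and outputs a list of at most $C(n+\frac1\epsilon+1)^d$ triples such that, for every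 optimum solution $\mathrm{OPT}$ of the instance, the strengthened time-indexed LP of one of these triples has a feasible solution of cost at most $532\cdot\ell(\mathrm{OPT})$. -/

import Mathlib

/-! ## A random access machine with a step count

A small imperative language over natural-number variables and arrays, with a big-step semantics
that counts elementary operations at unit cost. The only arithmetic is addition, truncated
subtraction and halving, so the bit length of a stored number grows by at most one per elementary
operation; the unit-cost measure is therefore polynomially related to Turing machine time. -/

namespace RAM

/-- Memory contents: variables `reg x`, and arrays `arr a` with cells `arr a i`. -/
structure State where
  reg : ℕ → ℕ
  arr : ℕ → ℕ → ℕ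

/-- Expressions. `load a e` is the cell of array `a` whose index is the value of `e`. -/
inductive Expr where
  | lit (c : ℕ)
  | var (x : ℕ)
  | add (e₁ e₂ : Expr)
  | sub (e₁ e₂ : Expr)
  | half (e : Expr)
  | load (a : ℕ) (e : Expr)

/-- The value of an expression. -/
def Expr.eval (σ : State) : Expr → ℕ
  | .lit c => c
  | .var x => σ.reg x
  | .add e₁ e₂ => e₁.eval σ + e₂.eval σ
  | .sub e₁ e₂ => e₁.eval σ - e₂.eval σ
  | .half e => e.eval σ / 2
  | .load a e => σ.arr a (e.eval σ)

/-- The number of elementary operations in the evaluation of an expression. -/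
def Expr.cost : Expr → ℕ
  | .lit _ => 1
  | .var _ => 1
  | .add e₁ e₂ => e₁.cost + e₂.cost + 1
  | .sub e₁ e₂ => e₁.cost + e₂.cost + 1
  | .half e => e.cost + 1
  | .load _ e => e.cost + 1

/-- Programs. The tests of `ite` and `loop` are comparisons `e₁ < e₂`;
`loop e₁ e₂ p` repeats `p` while `e₁ < e₂`. -/
inductive Prog where
  | skip
  | assign (x : ℕ) (e : Expr)
  | store (a : ℕ) (i e : Expr)
  | seq (p₁ p₂ : Prog)
  | ite (e₁ e₂ : Expr) (p₁ p₂ : Prog)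
  | loop (e₁ e₂ : Expr) (p : Prog)

/-- The state after `x := e`. -/
def State.assign (σ : State) (x : ℕ) (e : Expr) : State :=
  { σ with reg := Function.update σ.reg x (e.eval σ) }

/-- The state after `a[i] := e`. -/
def State.store (σ : State) (a : ℕ) (i e : Expr) : State :=
  { σ with arr := Function.update σ.arr a (Function.update (σ.arr a) (i.eval σ) (e.eval σ)) }

/-- `Exec p σ k τ`: started in `σ`, the program `p` halts in `τ` after exactly `k` steps. -/
inductive Exec : Prog → State → ℕ → State → Prop where
  | skip (σ : State) : Exec .skip σ 1 σ
  | assign (σ : State) (x : ℕ) (e : Expr) :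
      Exec (.assign x e) σ (e.cost + 1) (σ.assign x e)
  | store (σ : State) (a : ℕ) (i e : Expr) :
      Exec (.store a i e) σ (i.cost + e.cost + 1) (σ.store a i e)
  | seq {p₁ p₂ : Prog} {σ τ υ : State} {k₁ k₂ : ℕ} (h₁ : Exec p₁ σ k₁ τ) (h₂ : Exec p₂ τ k₂ υ) :
      Exec (.seq p₁ p₂) σ (k₁ + k₂) υ
  | iteTrue {e₁ e₂ : Expr} {p₁ p₂ : Prog} {σ τ : State} {k : ℕ} (h : e₁.eval σ < e₂.eval σ)
      (h₁ : Exec p₁ σ k τ) : Exec (.ite e₁ e₂ p₁ p₂) σ (e₁.cost + e₂.cost + 1 + k) τ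
  | iteFalse {e₁ e₂ : Expr} {p₁ p₂ : Prog} {σ τ : State} {k : ℕ} (h : ¬ e₁.eval σ < e₂.eval σ)
      (h₂ : Exec p₂ σ k τ) : Exec (.ite e₁ e₂ p₁ p₂) σ (e₁.cost + e₂.cost + 1 + k) τ
  | loopDone {e₁ e₂ : Expr} {p : Prog} {σ : State} (h : ¬ e₁.eval σ < e₂.eval σ) :
      Exec (.loop e₁ e₂ p) σ (e₁.cost + e₂.cost + 1) σ
  | loopStep {e₁ e₂ : Expr} {p : Prog} {σ τ υ : State} {k₁ k₂ : ℕ} (h : e₁.eval σ < e₂.eval σ)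
      (h₁ : Exec p σ k₁ τ) (h₂ : Exec (.loop e₁ e₂ p) τ k₂ υ) :
      Exec (.loop e₁ e₂ p) σ (e₁.cost + e₂.cost + 1 + k₁ + k₂) υ

/-- The output of a halted computation is the word of length `reg 1` in array `1`. -/
def State.HasOutput (σ : State) (w : List ℕ) : Prop :=
  σ.reg 1 = w.length ∧ ∀ (i : ℕ) (h : i < w.length), σ.arr 1 i = w[i]

end RAM

namespace DirLat

/-! ## Directed Latency with Target -/

/-- The points `V ∪ {s, s'}` of an instance with `n` clients. -/
inductive Loc (n : ℕ) where
  | client (v : Fin n)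
  | source
  | target
  deriving DecidableEq, Fintype

/-- An instance with `n` clients: an asymmetric metric on `V ∪ {s, s'}`.
Distances are integral, as in every nice instance. -/
structure Instance (n : ℕ) where
  c : Loc n → Loc n → ℕ
  c_self : ∀ u, c u u = 0
  triangle : ∀ u v w, c u w ≤ c u v + c v w

/-- `ε`-nice instances: `n = 2 ^ k - 1`, and the distances between distinct points are positive
(integers) bounded by `2 n ^ 5 / ε ^ 2`. -/
def Instance.IsNice {n : ℕ} (I : Instance n) (ε : ℝ) : Prop :=
  (∃ k : ℕ, n + 1 = 2 ^ k) ∧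
    ∀ u v, u ≠ v → 0 < I.c u v ∧ (I.c u v : ℝ) ≤ 2 * (n : ℝ) ^ 5 / ε ^ 2

/-- The largest distance. -/
def Instance.maxCost {n : ℕ} (I : Instance n) : ℕ :=
  Finset.univ.sup fun u => Finset.univ.sup fun v => I.c u v

/-- The points of the `s`-`s'`-path that visits the clients in the order `π 0, π 1, …`:
number `0` is `s`, number `j + 1` is `π j`, and number `n + 1` is `s'`. -/
def waypoint {n : ℕ} (π : Equiv.Perm (Fin n)) : ℕ → Loc n
  | 0 => .source
  | j + 1 => if h : j < n then .client (π ⟨j, h⟩) else .target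

/-- The length of the path from `s` to its point number `m`. -/
def Instance.arrival {n : ℕ} (I : Instance n) (π : Equiv.Perm (Fin n)) (m : ℕ) : ℕ :=
  ∑ j ∈ Finset.range m, I.c (waypoint π j) (waypoint π (j + 1))

/-- The total latency: the sum, over all clients, of the length of the path from `s` to the
client. -/
def Instance.latency {n : ℕ} (I : Instance n) (π : Equiv.Perm (Fin n)) : ℕ :=
  ∑ v : Fin n, I.arrival π ((π.symm v : ℕ) + 1)

/-- Optimum solutions. -/
def Instance.IsOptimal {n : ℕ} (I : Instance n) (π : Equiv.Perm (Fin n)) : Prop :=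
  ∀ π' : Equiv.Perm (Fin n), I.latency π ≤ I.latency π'

/-! ## Triples of bucket thresholds, tour-intervals and roots -/

/-- Bucket thresholds `t 0, …, t q`, a set of tour-intervals, and a root for each tour-interval.
The index `i : Fin q` stands for the interval `[t i, t (i + 1))`, and a root is given by the client
at which it is colocated. -/
structure Triple (n : ℕ) where
  q : ℕ
  t : Fin (q + 1) → ℕ
  tour : Finset (Fin q)
  root : {i : Fin q // i ∈ tour} → Fin n

namespace Triple

variable {n : ℕ} (G : Triple n)

/-- The time points of the interval with index `i`. -/
def interval (i : Fin G.q) : Finset ℕ := Finset.Ico (G.t i.castSucc) (G.t i.succ)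

/-- The time points in tour-intervals. -/
def tourTimes : Finset ℕ := G.tour.biUnion G.interval

/-- The set of roots. -/
def roots : Finset (Fin n) := Finset.univ.image G.root

/-- The conditions on bucket thresholds: `t 0 = 0`, the thresholds increase, by a factor of at
least `4 / 3` each time, and `q ≤ log₂ (n + 1)`. -/
def IsValid : Prop :=
  G.t 0 = 0 ∧ 2 ^ G.q ≤ n + 1 ∧
    ∀ i : Fin G.q, G.t i.castSucc < G.t i.succ ∧ 4 * G.t i.castSucc ≤ 3 * G.t i.succ

/-- A triple as a word: `q`, then the thresholds, then for each interval `0` if it is no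
tour-interval, and `v + 1` if it is a tour-interval with root at `v`. -/
def encode : List ℕ :=
  G.q :: (List.ofFn G.t ++
    List.ofFn fun i : Fin G.q => if h : i ∈ G.tour then (G.root ⟨i, h⟩ : ℕ) + 1 else 0)

end Triple

/-- A list of triples as a word: its length, then the words of its members. -/
def encodeTriples {n : ℕ} (L : List (Triple n)) : List ℕ :=
  L.length :: L.flatMap Triple.encode

/-- The points in the order client `0`, …, client `n - 1`, `s`, `s'`. -/
def locOf (n : ℕ) (i : ℕ) : Loc n :=
  if h : i < n then .client ⟨i, h⟩ else if i = n then .source else .target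

/-- The memory at the start of the computation: variable `0` holds `n`, array `0` holds the
distance matrix row by row, and all other cells are `0`. -/
def Instance.input {n : ℕ} (I : Instance n) : RAM.State where
  reg := fun x => if x = 0 then n else 0
  arr := fun a m =>
    if a = 0 ∧ m < (n + 2) * (n + 2) then I.c (locOf n (m / (n + 2))) (locOf n (m % (n + 2)))
    else 0

/-! ## The strengthened time-indexed linear program -/

/-- The points `V ∪ V_copy ∪ {s, s'}`: besides the points of the instance there is a copy
`root v`, colocated at `v`, of every client `v`. -/
inductive Site (n : ℕ) where
  | client (v : Fin n)
  | root (v : Fin n)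
  | source
  | target
  deriving DecidableEq, Fintype

/-- The position of a point in the metric space. -/
def Site.loc {n : ℕ} : Site n → Loc n
  | .client v => .client v
  | .root v => .client v
  | .source => .source
  | .target => .target

/-- The vertices of the time-indexed graph for the points `V ∪ R ∪ {s, s'}` and the horizon `T`:
`(V ∪ R) × {1, …, T}` together with `(s, 0)` and `(s', T + 1)`. -/
def timeVertices {n : ℕ} (R : Finset (Fin n)) (T : ℕ) : Finset (Site n × ℕ) :=
  ((Finset.univ.image .client ∪ R.image .root) ×ˢ Finset.Icc 1 T) ∪
    {(.source, 0), (.target, T + 1)}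

/-- An edge of the time-indexed graph, as a pair of vertices. -/
abbrev TimeEdge (n : ℕ) := (Site n × ℕ) × (Site n × ℕ)

namespace Instance

variable {n : ℕ} (I : Instance n)

/-- The edges of the time-indexed graph: from `(u, t)` to `(v, t')` whenever
`c(u, v) ≤ t' - t`. -/
def timeEdges (R : Finset (Fin n)) (T : ℕ) : Finset (TimeEdge n) :=
  (timeVertices R T ×ˢ timeVertices R T).filter fun e =>
    e.1 ≠ e.2 ∧ e.1.2 + I.c e.1.1.loc e.2.1.loc ≤ e.2.2

/-- `δ⁺(p)`. -/
def outEdges (R : Finset (Fin n)) (T : ℕ) (p : Site n × ℕ) : Finset (TimeEdge n) :=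
  (I.timeEdges R T).filter fun e => e.1 = p

/-- `δ⁻(p)`. -/
def inEdges (R : Finset (Fin n)) (T : ℕ) (p : Site n × ℕ) : Finset (TimeEdge n) :=
  (I.timeEdges R T).filter fun e => e.2 = p

/-- `δ⁻(S, t)`: the edges that enter the point set `S` at time `t`. -/
def entering (R : Finset (Fin n)) (T : ℕ) (S : Finset (Site n)) (t : ℕ) : Finset (TimeEdge n) :=
  (I.timeEdges R T).filter fun e => e.1.1 ∉ S ∧ e.2.1 ∈ S ∧ e.2.2 = t

/-- The polytope `Q` of the time-indexed graph for `V ∪ R ∪ {s, s'}` with horizon `T`. Clients have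
to be visited, while roots may be used by the flow. -/
structure InPolytope (R : Finset (Fin n)) (T : ℕ) (x : Site n × ℕ → ℝ) (z : TimeEdge n → ℝ) :
    Prop where
  x_mem : ∀ p ∈ timeVertices R T, 0 ≤ x p ∧ x p ≤ 1
  z_mem : ∀ e ∈ I.timeEdges R T, 0 ≤ z e ∧ z e ≤ 1
  visit : ∀ v : Fin n, ∑ t ∈ Finset.Icc 1 T, x (.client v, t) = 1
  flow_out : ∀ v : Fin n, ∀ t ∈ Finset.Icc 1 T,
    ∑ e ∈ I.outEdges R T (.client v, t), z e = x (.client v, t)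
  flow_in : ∀ v : Fin n, ∀ t ∈ Finset.Icc 1 T,
    ∑ e ∈ I.inEdges R T (.client v, t), z e = x (.client v, t)
  flow_source : ∑ e ∈ I.outEdges R T (.source, 0), z e = 1
  flow_target : ∑ e ∈ I.inEdges R T (.target, T + 1), z e = 1
  cut : ∀ S : Finset (Site n), (∀ a ∈ S, (∃ v, a = .client v) ∨ ∃ r ∈ R, a = .root r) →
    ∀ v : Fin n, .client v ∈ S → ∀ t ∈ Finset.Icc 1 T,
      ∑ t' ∈ Finset.Icc 1 t, x (.client v, t') ≤
        ∑ t' ∈ Finset.Icc 1 t, ∑ e ∈ I.entering R T S t', z e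

/-- The edge `(u, v)` is `τ`-short. -/
def IsShort (u v : Fin n) (τ : ℕ) : Prop :=
  I.c (.client u) (.client v) ≤ max (I.c (.client v) (.client u)) τ

/-- The time horizon `T = t_q + n² · max c`. -/
def horizon (G : Triple n) : ℕ := G.t (Fin.last G.q) + n ^ 2 * I.maxCost

end Instance

/-- The set `F_R` of forbidden edges: those that enter a tour-interval elsewhere than at its root,
those that leave a tour-interval elsewhere than at its root, and those that skip a
tour-interval. -/
def Triple.Forbidden {n : ℕ} (G : Triple n) (e : TimeEdge n) : Prop :=
  ∃ i : {i : Fin G.q // i ∈ G.tour},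
    (e.1.2 < G.t i.1.castSucc ∧ G.t i.1.castSucc ≤ e.2.2 ∧ e.2.1 ≠ .root (G.root i)) ∨
    (e.1.2 < G.t i.1.succ ∧ G.t i.1.succ ≤ e.2.2 ∧ e.1.1 ≠ .root (G.root i))

namespace Instance

variable {n : ℕ} (I : Instance n)

/-- Feasible solutions of the strengthened time-indexed linear program of a triple. -/
structure IsFeasible (G : Triple n) (x : Site n × ℕ → ℝ) (z : TimeEdge n → ℝ) : Prop where
  mem_polytope : I.InPolytope G.roots (I.horizon G) x z
  /-- Clients are visited within the intervals of the triple. -/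
  within : ∀ v : Fin n, ∀ t ∈ Finset.Icc 1 (I.horizon G), G.t (Fin.last G.q) ≤ t →
    x (.client v, t) = 0
  root_flow : ∀ r ∈ G.roots, ∀ t ∈ Finset.Icc 0 (I.horizon G),
    ∑ e ∈ I.inEdges G.roots (I.horizon G) (.root r, t), z e =
      ∑ e ∈ I.outEdges G.roots (I.horizon G) (.root r, t), z e
  forbidden : ∀ e ∈ I.timeEdges G.roots (I.horizon G), G.Forbidden e → z e = 0
  /-- The index `j` is the successor of `i`; thus `G.t i.succ` and `G.t j.succ` are consecutive
  thresholds, the ends of the intervals `i` and `j`. -/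
  ordering : ∀ (u v : Fin n) (i j : Fin G.q), (j : ℕ) = i + 1 → ¬ I.IsShort u v (G.t j.succ) →
    ∑ t ∈ Finset.Ico 1 (G.t i.succ), (x (.client u, t) - x (.client v, t)) ≤
      ∑ t ∈ Finset.Icc 1 (I.horizon G) ∩ G.tourTimes, (x (.client u, t) + x (.client v, t))

/-- The objective: a visit within an interval is charged the end of the interval. -/
def lpCost (G : Triple n) (x : Site n × ℕ → ℝ) : ℝ :=
  ∑ v : Fin n, ∑ i : Fin G.q, ∑ t ∈ Finset.Icc 1 (I.horizon G) ∩ G.interval i,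
    (G.t i.succ : ℝ) * x (.client v, t)

end Instance

end DirLat

/-! ## Verification of random access machine programs -/

namespace RAM

/-! Fix a path and cut its `n = 2 ^ k - 1` clients into `k` blocks of sizes `2 ^ (k - 1), …, 2, 1`;
let `a j` be the length of the path up to the end of block `j`. Take thresholds with `t j ≥ 32 * a
j` that grow by a factor of about `3 / 2` or more and satisfy `2 * t j ≤ 3 * t (j - 1) + 66 * a j`.
They are cheap: block sizes halve, so the growth factor `3 / 2` becomes `3 / 4` in the weighted sum,
the series converges, and the weighted sum of the `a j` is at most twice the latency
(`sum_threshold_le`).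

The solution of the linear program is integral: a single walk through the time-indexed graph that
replays the path with delays. The obstacle is the ordering constraint. It can fail for `u` before
`v` only if `v` comes at least two stages after `u` and `c(u, v)` exceeds both `c(v, u)` and a
threshold; such a `v` is `Bad`. A stage with bad points becomes a tour-interval and ends at the last
of them. The rest of its block is postponed, by at most one stage (`IsStaged.lt_p`). No violating
pair remains outside the tours (`IsPlan.exists_feasible`).

Tour-intervals must be entered and left at a root. A bad point has a cheap way back to an early
client, so the path from that client on closes up to a short cycle. Guessing one root per tour would
give too many triples, hence roots are computed: with `h` the size of the block before the tour,
take any client that is close from all but fewer than `h` clients and close to at least `h`. The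
last client of that block qualifies (`IsStaged.exists_central`), and by counting, every such client
is close from a client of that block and close to a client up to the end of it
(`IsPlan.exists_first`). Consecutive tours share a root. All detours fit into the slack that the
factor `32` provides (`IsPlan.gap`).

Only thresholds and tour bits are left to guess. Thresholds arise from a scale that grows in steps
of about `33 / 32`, and the total number of steps is logarithmic in the largest target
(`sum_targetSkips_le`). Spending one bit per step and two per stage, a guess is a number below a
polynomial bound (`two_pow_skipCount_le`), and the program decodes all numbers below it
(`runs_mainProg`). -/

@[simp] theorem State.assign_reg (σ : State) (x : ℕ) (e : Expr) (y : ℕ) :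
    (σ.assign x e).reg y = if y = x then e.eval σ else σ.reg y := by
  simp [State.assign, Function.update_apply]

@[simp] theorem State.assign_arr (σ : State) (x : ℕ) (e : Expr) : (σ.assign x e).arr = σ.arr := rfl

@[simp] theorem State.store_reg (σ : State) (a : ℕ) (i e : Expr) : (σ.store a i e).reg = σ.reg := rfl

@[simp] theorem State.store_arr (σ : State) (a : ℕ) (i e : Expr) (b m : ℕ) :
    (σ.store a i e).arr b m = if b = a ∧ m = i.eval σ then e.eval σ else σ.arr b m := by
  simp only [State.store, Function.update_apply]
  split_ifs <;> simp_all

/-- Started in `σ`, the program `p` halts after at most `B` steps in a state that satisfies `Q`. -/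
def Runs (p : Prog) (σ : State) (B : ℕ) (Q : State → Prop) : Prop :=
  ∃ k τ, Exec p σ k τ ∧ k ≤ B ∧ Q τ

theorem Runs.mono {p : Prog} {σ : State} {B B' : ℕ} {Q Q' : State → Prop} (h : Runs p σ B Q)
    (hB : B ≤ B') (hQ : ∀ τ, Q τ → Q' τ) : Runs p σ B' Q' := by
  obtain ⟨k, τ, h₁, h₂, h₃⟩ := h
  exact ⟨k, τ, h₁, h₂.trans hB, hQ τ h₃⟩

theorem Runs.skip {σ : State} {Q : State → Prop} (h : Q σ) : Runs .skip σ 1 Q :=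
  ⟨1, σ, .skip σ, le_rfl, h⟩

theorem Runs.assign {σ : State} {x : ℕ} {e : Expr} {Q : State → Prop} (h : Q (σ.assign x e)) :
    Runs (.assign x e) σ (e.cost + 1) Q :=
  ⟨_, _, .assign σ x e, le_rfl, h⟩

theorem Runs.store {σ : State} {a : ℕ} {i e : Expr} {Q : State → Prop} (h : Q (σ.store a i e)) :
    Runs (.store a i e) σ (i.cost + e.cost + 1) Q :=
  ⟨_, _, .store σ a i e, le_rfl, h⟩

theorem Runs.seq {p₁ p₂ : Prog} {σ : State} {B₁ B₂ : ℕ} {Q : State → Prop}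
    (h : Runs p₁ σ B₁ fun τ => Runs p₂ τ B₂ Q) : Runs (.seq p₁ p₂) σ (B₁ + B₂) Q := by
  obtain ⟨k, τ, h₁, h₂, k', υ, h₃, h₄, h₅⟩ := h
  exact ⟨k + k', υ, .seq h₁ h₃, by omega, h₅⟩

theorem Runs.assign_seq {p : Prog} {σ : State} {x : ℕ} {e : Expr} {B : ℕ} {Q : State → Prop}
    (h : Runs p (σ.assign x e) B Q) : Runs (.seq (.assign x e) p) σ (e.cost + 1 + B) Q :=
  .seq (.assign h)

theorem Runs.store_seq {p : Prog} {σ : State} {a : ℕ} {i e : Expr} {B : ℕ} {Q : State → Prop}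
    (h : Runs p (σ.store a i e) B Q) :
    Runs (.seq (.store a i e) p) σ (i.cost + e.cost + 1 + B) Q :=
  .seq (.store h)

theorem Runs.ite {e₁ e₂ : Expr} {p₁ p₂ : Prog} {σ : State} {B : ℕ} {Q : State → Prop}
    (h₁ : e₁.eval σ < e₂.eval σ → Runs p₁ σ B Q) (h₂ : ¬ e₁.eval σ < e₂.eval σ → Runs p₂ σ B Q) :
    Runs (.ite e₁ e₂ p₁ p₂) σ (e₁.cost + e₂.cost + 1 + B) Q := by
  by_cases h : e₁.eval σ < e₂.eval σ
  · obtain ⟨k, τ, h₃, h₄, h₅⟩ := h₁ h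
    exact ⟨_, τ, .iteTrue h h₃, by omega, h₅⟩
  · obtain ⟨k, τ, h₃, h₄, h₅⟩ := h₂ h
    exact ⟨_, τ, .iteFalse h h₃, by omega, h₅⟩

theorem Runs.ite_seq {e₁ e₂ : Expr} {p₁ p₂ p : Prog} {σ : State} {B₁ B₂ B : ℕ}
    {Q : State → Prop} (R : State → Prop)
    (h₁ : e₁.eval σ < e₂.eval σ → Runs p₁ σ B₁ R) (h₂ : ¬ e₁.eval σ < e₂.eval σ → Runs p₂ σ B₁ R)
    (h : ∀ τ, R τ → Runs p τ B₂ Q) (hB : e₁.cost + e₂.cost + 1 + B₁ + B₂ ≤ B) :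
    Runs (.seq (.ite e₁ e₂ p₁ p₂) p) σ B Q :=
  (Runs.seq ((Runs.ite h₁ h₂).mono le_rfl h)).mono hB fun _ h => h

theorem Runs.then {p₁ p₂ : Prog} {σ : State} {B₁ B₂ B : ℕ} {R Q : State → Prop}
    (h₁ : Runs p₁ σ B₁ R) (h₂ : ∀ τ, R τ → Runs p₂ τ B₂ Q) (hB : B₁ + B₂ ≤ B) :
    Runs (.seq p₁ p₂) σ B Q :=
  (Runs.seq (h₁.mono le_rfl h₂)).mono hB fun _ h => h

/-- A loop with `N` iterations and the invariant `P`. -/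
theorem Runs.loop {e₁ e₂ : Expr} {p : Prog} {B : ℕ} (N : ℕ) (P : ℕ → State → Prop) {σ : State}
    (h0 : P 0 σ)
    (hstep : ∀ i < N, ∀ τ, P i τ → e₁.eval τ < e₂.eval τ ∧ Runs p τ B (P (i + 1)))
    (hend : ∀ τ, P N τ → ¬ e₁.eval τ < e₂.eval τ) :
    Runs (.loop e₁ e₂ p) σ ((N + 1) * (e₁.cost + e₂.cost + 1 + B)) (P N) := by
  have key : ∀ j, ∀ i, i + j = N → ∀ τ, P i τ →
      Runs (.loop e₁ e₂ p) τ ((j + 1) * (e₁.cost + e₂.cost + 1 + B)) (P N) := by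
    intro j
    induction j with
    | zero =>
      intro i hi τ hτ
      obtain rfl : i = N := by omega
      exact ⟨_, τ, .loopDone (hend τ hτ), by rw [zero_add, one_mul]; omega, hτ⟩
    | succ j ih =>
      intro i hi τ hτ
      obtain ⟨hlt, k, υ, h₁, h₂, h₃⟩ := hstep i (by omega) τ hτ
      obtain ⟨k', υ', h₄, h₅, h₆⟩ := ih (i + 1) (by omega) υ h₃
      refine ⟨_, υ', .loopStep hlt h₁ h₄, ?_, h₆⟩
      rw [Nat.succ_mul]
      omega
  exact key N 0 (by omega) σ h0

end RAM

/-! ## The choice of a root -/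

namespace DirLat

open Finset in
/-- The number of clients from which `r` is within distance `d`. -/
def ballIn (c : ℕ → ℕ → ℕ) (n d r : ℕ) : ℕ := #{w ∈ range n | c w r ≤ d}

open Finset in
/-- The number of clients within distance `d` from `r`. -/
def ballOut (c : ℕ → ℕ → ℕ) (n d r : ℕ) : ℕ := #{w ∈ range n | c r w ≤ d}

/-- The client `r` is within distance `d` from all but fewer than `h` clients, and at least
`h` clients are within distance `2 d` from `r`. -/
def IsCentral (c : ℕ → ℕ → ℕ) (n d h r : ℕ) : Prop :=
  n < ballIn c n d r + h ∧ h ≤ ballOut c n (2 * d) r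

open Classical in
/-- The last central client among the first `m`, plus one; `1` if there is none. -/
noncomputable def pickRoot (c : ℕ → ℕ → ℕ) (n d h : ℕ) : ℕ → ℕ
  | 0 => 1
  | m + 1 => if IsCentral c n d h m then m + 1 else pickRoot c n d h m

theorem pickRoot_pos (c : ℕ → ℕ → ℕ) (n d h m : ℕ) : 0 < pickRoot c n d h m := by
  induction m with
  | zero => simp [pickRoot]
  | succ m ih => unfold pickRoot; split_ifs <;> omega

/-- The fallback value `1` names client `0`, so the word stays in range even when no client is
central. -/
theorem pickRoot_le (c : ℕ → ℕ → ℕ) (n d h m : ℕ) : pickRoot c n d h m ≤ m + 1 ∧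
    (0 < m → pickRoot c n d h m ≤ m) := by
  induction m with
  | zero => simp [pickRoot]
  | succ m ih =>
    unfold pickRoot
    split_ifs
    · omega
    · rcases Nat.eq_zero_or_pos m with rfl | hm
      · simp [pickRoot]
      · have := ih.2 hm; omega

theorem isCentral_pickRoot {c : ℕ → ℕ → ℕ} {n d h m : ℕ} (hm : ∃ r < m, IsCentral c n d h r) :
    IsCentral c n d h (pickRoot c n d h m - 1) := by
  induction m with
  | zero => simp at hm
  | succ m ih =>
    unfold pickRoot
    split_ifs with hc
    · simpa using hc
    · obtain ⟨r, hr, hr'⟩ := hm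
      refine ih ⟨r, ?_, hr'⟩
      rcases Nat.lt_succ_iff_lt_or_eq.1 hr with h | rfl
      · exact h
      · exact absurd hr' hc

open RAM

/-- Count the clients close to and from client `reg 8`. -/
def countProg : Prog :=
  .seq (.assign 9 (.lit 0)) <| .seq (.assign 10 (.lit 0)) <| .seq (.assign 11 (.lit 0)) <|
  .seq (.assign 13 (.var 12)) <| .seq (.assign 14 (.var 8)) <|
  .loop (.var 9) (.var 0) <|
    .seq (.ite (.load 0 (.var 14)) (.add (.var 17) (.lit 1))
      (.assign 10 (.add (.var 10) (.lit 1))) .skip) <|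
    .seq (.ite (.load 0 (.var 13)) (.add (.add (.var 17) (.var 17)) (.lit 1))
      (.assign 11 (.add (.var 11) (.lit 1))) .skip) <|
    .seq (.assign 9 (.add (.var 9) (.lit 1))) <|
    .seq (.assign 13 (.add (.var 13) (.lit 1)))
      (.assign 14 (.add (.add (.var 14) (.var 0)) (.lit 2)))

/-- Array `0` holds the matrix `c`, and variable `0` the number of clients. -/
def HoldsMatrix (c : ℕ → ℕ → ℕ) (n : ℕ) (σ : State) : Prop :=
  σ.reg 0 = n ∧ ∀ a < n + 2, ∀ b < n + 2, σ.arr 0 (a * (n + 2) + b) = c a b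

theorem ball_succ {p : ℕ → Prop} [DecidablePred p] (i : ℕ) :
    ((Finset.range (i + 1)).filter p).card =
      if p i then ((Finset.range i).filter p).card + 1 else ((Finset.range i).filter p).card := by
  rw [Finset.range_add_one, Finset.filter_insert]
  split_ifs <;> simp

/-- Variables `13` and `14` hold the addresses of the current entries of row `r` and column `r`.
They are advanced by `1` and `n + 2`, since the machine cannot multiply. Variable `17` holds the
radius. -/
theorem runs_countProg {c : ℕ → ℕ → ℕ} {n r : ℕ} {σ : State} (hσ : HoldsMatrix c n σ)
    (hr : r < n) (h8 : σ.reg 8 = r) (h12 : σ.reg 12 = r * (n + 2)) :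
    Runs countProg σ (10 + (n + 1) * 60) fun τ =>
      τ.reg 10 = ballIn c n (σ.reg 17) r ∧ τ.reg 11 = ballOut c n (2 * σ.reg 17) r ∧
      (∀ x, x ≤ 8 ∨ x = 12 ∨ 15 ≤ x → τ.reg x = σ.reg x) ∧ τ.arr = σ.arr := by
  refine (Runs.assign_seq <| Runs.assign_seq <| Runs.assign_seq <| Runs.assign_seq <|
    Runs.assign_seq <| Runs.loop (B := 50) n (fun i τ =>
      τ.reg 9 = i ∧ τ.reg 10 = ((Finset.range i).filter fun w => c w r ≤ σ.reg 17).card ∧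
      τ.reg 11 = ((Finset.range i).filter fun w => c r w ≤ 2 * σ.reg 17).card ∧
      τ.reg 13 = r * (n + 2) + i ∧ τ.reg 14 = i * (n + 2) + r ∧
      (∀ x, x ≤ 8 ∨ x = 12 ∨ 15 ≤ x → τ.reg x = σ.reg x) ∧ τ.arr = σ.arr)
      ?_ ?_ ?_).mono ?_ ?_
  · simp [Expr.eval, h8, h12]
    intro x hx
    have : x ≠ 9 ∧ x ≠ 10 ∧ x ≠ 11 ∧ x ≠ 13 ∧ x ≠ 14 := by omega
    simp [this]
  · rintro i hi τ ⟨t9, t10, t11, t13, t14, tr, ta⟩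
    have t0 : τ.reg 0 = n := by rw [tr 0 (by omega), hσ.1]
    have t17 : τ.reg 17 = σ.reg 17 := tr 17 (by omega)
    have hin : τ.arr 0 (τ.reg 14) = c i r := by
      rw [ta, t14, hσ.2 i (by omega) r (by omega)]
    have hout : τ.arr 0 (τ.reg 13) = c r i := by
      rw [ta, t13, hσ.2 r (by omega) i (by omega)]
    refine ⟨by simpa [Expr.eval, t9, t0] using hi, ?_⟩
    refine Runs.ite_seq (B₁ := 4) (B₂ := 30) (fun υ => υ.arr = τ.arr ∧
      (∀ x, x ≠ 10 → υ.reg x = τ.reg x) ∧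
      υ.reg 10 = ((Finset.range (i + 1)).filter fun w => c w r ≤ σ.reg 17).card)
      ?_ ?_ ?_ (by simp [Expr.cost])
    · intro h
      refine Runs.assign ⟨rfl, by intro x hx; simp [hx], ?_⟩
      simp [Expr.eval, hin, t17] at h
      simp [Expr.eval, ball_succ, h, t10]
    · intro h
      refine (Runs.skip ⟨rfl, by intros; rfl, ?_⟩).mono (by omega) (fun _ h => h)
      simp only [Expr.eval, hin, t17, Nat.lt_succ_iff] at h
      rw [ball_succ, if_neg h, t10]
    · rintro υ ⟨ua, ur, u10⟩
      refine Runs.ite_seq (B₁ := 4) (B₂ := 14) (fun ω => ω.arr = τ.arr ∧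
        (∀ x, x ≠ 10 → x ≠ 11 → ω.reg x = τ.reg x) ∧
        ω.reg 10 = ((Finset.range (i + 1)).filter fun w => c w r ≤ σ.reg 17).card ∧
        ω.reg 11 = ((Finset.range (i + 1)).filter fun w => c r w ≤ 2 * σ.reg 17).card)
        ?_ ?_ ?_ (by simp [Expr.cost])
      · intro h
        refine Runs.assign ⟨ua, by intro x hx hx'; simp [hx', ur x hx], by simp [u10], ?_⟩
        simp [Expr.eval, hout, t17, ua, ur] at h
        rw [← two_mul] at h
        simp [Expr.eval, ball_succ, h, t11, ur]
      · intro h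
        refine (Runs.skip ⟨ua, fun x hx _ => ur x hx, u10, ?_⟩).mono (by omega) (fun _ h => h)
        simp [Expr.eval, hout, t17, ua, ur] at h
        rw [← two_mul] at h
        rw [ball_succ, if_neg (by omega), ur 11 (by omega), t11]
      · rintro ω ⟨wa, wr, w10, w11⟩
        refine (Runs.assign_seq <| Runs.assign_seq <| Runs.assign ?_).mono
          (by simp [Expr.cost]) (fun _ h => h)
        refine ⟨?_, ?_, ?_, ?_, ?_, ?_, ?_⟩
        · simp [Expr.eval, wr, t9]
        · simp [w10]
        · simp [w11]
        · simp [Expr.eval, wr, t13]; ring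
        · simp [Expr.eval, wr, t14, t0]; ring
        · intro x hx
          have : x ≠ 9 ∧ x ≠ 10 ∧ x ≠ 11 ∧ x ≠ 13 ∧ x ≠ 14 := by omega
          simp [this, wr, tr x hx]
        · simp [wa, ta]
  · rintro τ ⟨t9, -, -, -, -, tr, -⟩
    simp [Expr.eval, t9, tr, hσ.1]
  · simp [Expr.cost]; omega
  · rintro τ ⟨-, t10, t11, -, -, tr, ta⟩
    exact ⟨t10, t11, tr, ta⟩

/-- Find a central client. -/
def rootProg : Prog :=
  .seq (.assign 7 (.lit 1)) <| .seq (.assign 8 (.lit 0)) <| .seq (.assign 12 (.lit 0)) <|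
  .loop (.var 8) (.var 0) <|
    .seq countProg <|
    .seq (.ite (.var 0) (.add (.var 10) (.var 2))
      (.ite (.var 11) (.var 2) .skip (.assign 7 (.add (.var 8) (.lit 1)))) .skip) <|
    .seq (.assign 8 (.add (.var 8) (.lit 1)))
      (.assign 12 (.add (.add (.var 12) (.var 0)) (.lit 2)))

/-- Variable `12` is the start of the row of the candidate in variable `8`; the radius and the count
`h` are expected in variables `17` and `2`. -/
theorem runs_rootProg {c : ℕ → ℕ → ℕ} {n : ℕ} {σ : State} (hσ : HoldsMatrix c n σ) :
    Runs rootProg σ (10 + (n + 1) * (120 + 60 * n)) fun τ =>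
      τ.reg 7 = pickRoot c n (σ.reg 17) (σ.reg 2) n ∧
      (∀ x, x ≤ 6 ∨ 15 ≤ x → τ.reg x = σ.reg x) ∧ τ.arr = σ.arr := by
  refine (Runs.assign_seq <| Runs.assign_seq <| Runs.assign_seq <|
    Runs.loop (B := 110 + 60 * n) n (fun i τ =>
      τ.reg 8 = i ∧ τ.reg 12 = i * (n + 2) ∧
      τ.reg 7 = pickRoot c n (σ.reg 17) (σ.reg 2) i ∧
      (∀ x, x ≤ 6 ∨ 15 ≤ x → τ.reg x = σ.reg x) ∧ τ.arr = σ.arr)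
      ?_ ?_ ?_).mono ?_ ?_
  · simp [Expr.eval, pickRoot]
    intro x hx
    have : x ≠ 7 ∧ x ≠ 8 ∧ x ≠ 12 := by omega
    simp [this]
  · rintro i hi τ ⟨t8, t12, t7, tr, ta⟩
    have t0 : τ.reg 0 = n := by rw [tr 0 (by omega), hσ.1]
    have hτ : HoldsMatrix c n τ := ⟨t0, by rw [ta]; exact hσ.2⟩
    refine ⟨by simpa [Expr.eval, t8, t0] using hi, ?_⟩
    refine Runs.then (B₂ := 30) (runs_countProg hτ hi t8 t12) ?_ (by omega)
    rintro υ ⟨u10, u11, ur, ua⟩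
    refine Runs.ite_seq (B₁ := 8) (B₂ := 10) (fun ω => ω.arr = τ.arr ∧
      (∀ x, x ≤ 6 ∨ x = 8 ∨ x = 12 ∨ 15 ≤ x → ω.reg x = τ.reg x) ∧
      ω.reg 7 = pickRoot c n (σ.reg 17) (σ.reg 2) (i + 1)) ?_ ?_ ?_ (by simp [Expr.cost])
    · intro h
      refine (Runs.ite (B := 4) ?_ ?_).mono (by simp [Expr.cost]) (fun _ h => h)
      · intro h'
        refine (Runs.skip ⟨ua, fun x hx => ur x (by omega), ?_⟩).mono (by omega) (fun _ h => h)
        have : ¬ IsCentral c n (σ.reg 17) (σ.reg 2) i := by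
          simp [Expr.eval, ur, u11, tr] at h'
          intro h''
          exact absurd h''.2 (by omega)
        rw [pickRoot, if_neg this, ur 7 (by omega), t7]
      · intro h'
        refine Runs.assign ⟨ua, fun x hx => ?_, ?_⟩
        · have : x ≠ 7 := by omega
          simp [this, ur x (by omega)]
        · have : IsCentral c n (σ.reg 17) (σ.reg 2) i := by
            simp [Expr.eval, ur, u11, u10, tr, hσ.1] at h' h
            exact ⟨h, by omega⟩
          simp [pickRoot, this, Expr.eval, ur, t8]
    · intro h
      refine (Runs.skip ⟨ua, fun x hx => ur x (by omega), ?_⟩).mono (by omega) (fun _ h => h)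
      have : ¬ IsCentral c n (σ.reg 17) (σ.reg 2) i := by
        simp [Expr.eval, ur, u10, tr, hσ.1] at h
        intro h''
        exact absurd h''.1 (by omega)
      rw [pickRoot, if_neg this, ur 7 (by omega), t7]
    · rintro ω ⟨wa, wr, w7⟩
      refine (Runs.assign_seq <| Runs.assign ?_).mono (by simp [Expr.cost]) (fun _ h => h)
      refine ⟨?_, ?_, ?_, ?_, ?_⟩
      · simp [Expr.eval, wr, t8]
      · simp [Expr.eval, wr, t12, t0]; ring
      · simp [w7]
      · intro x hx
        have : x ≠ 8 ∧ x ≠ 12 := by omega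
        simp [this, wr x (by omega), tr x hx]
      · simp [wa, ta]
  · rintro τ ⟨t8, -, -, tr, -⟩
    simp [Expr.eval, t8, tr, hσ.1]
  · simp only [Expr.cost]
    have : (n + 1) * (1 + 1 + 1 + (110 + 60 * n)) ≤ (n + 1) * (120 + 60 * n) :=
      Nat.mul_le_mul_left _ (by omega)
    omega
  · rintro τ ⟨-, -, t7, tr, ta⟩
    exact ⟨t7, tr, ta⟩

end DirLat

/-! ## Guesses of thresholds and tour-intervals

A number encodes a sequence of stages. Read from the least significant bit, a stage consists of a
run of ones, the number of times that the current scale is increased by the factor `33 / 32`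
before it becomes the next threshold, a zero, and a bit that tells whether the interval which ends
at this threshold is a tour-interval. After each threshold the scale grows by the factor `3 / 2`. -/

namespace DirLat

/-- The number of trailing ones in the binary expansion. -/
def ones (g : ℕ) : ℕ := if g % 2 = 1 then ones (g / 2) + 1 else 0
termination_by g
decreasing_by omega

theorem ones_le (g : ℕ) : ones g ≤ g := by
  induction g using Nat.strong_induction_on with
  | _ g ih =>
    unfold ones
    split_ifs with h
    · have := ih (g / 2) (by omega)
      omega
    · omega

theorem odd_of_lt_ones {g i : ℕ} (hi : i < ones g) : g / 2 ^ i % 2 = 1 := by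
  induction i generalizing g with
  | zero =>
    unfold ones at hi
    split_ifs at hi with h
    · simpa using h
    · omega
  | succ i ih =>
    unfold ones at hi
    split_ifs at hi with h
    · have := ih (g := g / 2) (by omega)
      rwa [Nat.div_div_eq_div_mul, ← pow_succ'] at this
    · omega

theorem even_of_ones (g : ℕ) : g / 2 ^ ones g % 2 = 0 := by
  induction g using Nat.strong_induction_on with
  | _ g ih =>
    rw [ones]
    split_ifs with h
    · rw [pow_succ', ← Nat.div_div_eq_div_mul]
      exact ih (g / 2) (by omega)
    · simp; omega

/-- Remove the trailing ones from the binary expansion. -/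
def dropOnes (g : ℕ) : ℕ := g / 2 ^ ones g

/-- What is left of a guess after `j` stages. -/
def guessAt (g : ℕ) : ℕ → ℕ
  | 0 => g
  | j + 1 => dropOnes (guessAt g j) / 4

theorem guessAt_le (g j : ℕ) : guessAt g j ≤ g := by
  induction j with
  | zero => rfl
  | succ j ih => exact (Nat.div_le_self _ _).trans ((Nat.div_le_self _ _).trans ih)

/-- The tour bit of stage `j + 1`. -/
def tourBit (g j : ℕ) : ℕ := dropOnes (guessAt g j) / 2 % 2

/-- The tour bit of stage `j`, and `0` for `j = 0`. -/
def prevBit (g : ℕ) : ℕ → ℕ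
  | 0 => 0
  | j + 1 => tourBit g j

/-- Increase a scale. -/
def grow (s : ℕ) : ℕ := s + s / 32

/-- The scale at the start of stage `j + 1`. -/
def scale (g : ℕ) : ℕ → ℕ
  | 0 => 32
  | j + 1 => grow^[ones (guessAt g j)] (scale g j) + grow^[ones (guessAt g j)] (scale g j) / 2

/-- The thresholds of a guess. -/
def threshold (g : ℕ) : ℕ → ℕ
  | 0 => 0
  | j + 1 => grow^[ones (guessAt g j)] (scale g j)

theorem scale_succ (g j : ℕ) : scale g (j + 1) = threshold g (j + 1) + threshold g (j + 1) / 2 :=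
  rfl

/-- The root in use after stage `j`, plus one: a central client is chosen in a stage with a
tour-interval that does not follow another one. -/
noncomputable def rootWord (c : ℕ → ℕ → ℕ) (n g : ℕ) : ℕ → ℕ
  | 0 => 1
  | j + 1 =>
    if 0 < tourBit g j ∧ prevBit g j < 1 then
      pickRoot c n (threshold g (j + 1) / 32) ((n + 1) / 2 ^ j) n
    else rootWord c n g j

/-- Guarantees that every guess, sensible or not, decodes to a genuine triple. -/
theorem rootWord_mem (c : ℕ → ℕ → ℕ) {n : ℕ} (hn : 0 < n) (g j : ℕ) :
    0 < rootWord c n g j ∧ rootWord c n g j ≤ n := by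
  induction j with
  | zero => exact ⟨one_pos, hn⟩
  | succ j ih =>
    rw [rootWord]
    split_ifs
    · exact ⟨pickRoot_pos _ _ _ _ _, (pickRoot_le _ _ _ _ _).2 hn⟩
    · exact ih

theorem le_grow (s : ℕ) : s ≤ grow s := Nat.le_add_right _ _

theorem grow_mono : Monotone grow := fun a b h => by unfold grow; omega

theorem le_grow_iterate (i s : ℕ) : s ≤ grow^[i] s := by
  induction i generalizing s with
  | zero => rfl
  | succ i ih => exact (le_grow s).trans (ih _)

theorem le_scale (g j : ℕ) : 32 ≤ scale g j := by
  induction j with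
  | zero => rfl
  | succ j ih => exact (ih.trans (le_grow_iterate _ _)).trans (Nat.le_add_right _ _)

theorem scale_le_threshold (g j : ℕ) : scale g j ≤ threshold g (j + 1) := le_grow_iterate _ _

/-- The next threshold is at least the scale, which is `3 / 2` of the last threshold up to rounding.
Validity needs only `4 / 3`; the sharper third bound makes room for the detours of a tour. -/
theorem threshold_step (g j : ℕ) : threshold g j < threshold g (j + 1) ∧
    4 * threshold g j ≤ 3 * threshold g (j + 1) ∧
    3 * threshold g j ≤ 2 * threshold g (j + 1) + 1 := by
  have h := scale_le_threshold g j
  have h' := le_scale g j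
  cases j with
  | zero => simp only [threshold] at *; omega
  | succ j =>
    rw [scale_succ] at h h'
    omega

/-- A triple from sequences; index `i` stands for stage `i + 1`. -/
def Triple.ofSeq {n : ℕ} (q : ℕ) (t : ℕ → ℕ) (A : ℕ → Prop) [DecidablePred A] (r : ℕ → Fin n) :
    Triple n where
  q := q
  t := fun i => t i
  tour := Finset.univ.filter fun i => A i
  root := fun i => r i.1

theorem Triple.encode_ofSeq {n : ℕ} (q : ℕ) (t : ℕ → ℕ) (A : ℕ → Prop) [DecidablePred A]
    (r : ℕ → Fin n) : (Triple.ofSeq q t A r).encode =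
      q :: (List.ofFn (fun i : Fin (q + 1) => t i) ++
        List.ofFn fun i : Fin q => if A i then (r i : ℕ) + 1 else 0) := by
  simp only [Triple.encode, Triple.ofSeq]
  congr 4
  funext i
  have hm : i ∈ (Finset.univ.filter fun i : Fin q => A i) ↔ A i := by simp
  by_cases h : A i
  · exact (dif_pos (hm.2 h)).trans (if_pos h).symm
  · exact (dif_neg (mt hm.1 h)).trans (if_neg h).symm

/-- The distances between points given by their numbers. -/
def Instance.cost {n : ℕ} (I : Instance n) (a b : ℕ) : ℕ := I.c (locOf n a) (locOf n b)

/-- The root of stage `j + 1`. -/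
noncomputable def Instance.rootOf {n : ℕ} (I : Instance n) (hn : 0 < n) (g j : ℕ) : Fin n :=
  ⟨rootWord I.cost n g (j + 1) - 1, by have := rootWord_mem I.cost hn g (j + 1); omega⟩

/-- The triple with `k` intervals that a guess encodes. -/
noncomputable def Instance.decode {n : ℕ} (I : Instance n) (hn : 0 < n) (k g : ℕ) : Triple n :=
  Triple.ofSeq k (threshold g) (fun j => 0 < tourBit g j) (I.rootOf hn g)

theorem Instance.isValid_decode {n : ℕ} (I : Instance n) (hn : 0 < n) {k : ℕ} (hk : n + 1 = 2 ^ k)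
    (g : ℕ) : (I.decode hn k g).IsValid := by
  refine ⟨rfl, hk.ge, fun i => ?_⟩
  have := threshold_step g i
  exact ⟨this.1, this.2.1⟩

/-- The word for the interval of stage `j + 1` in the output. -/
noncomputable def tourWord (c : ℕ → ℕ → ℕ) (n g j : ℕ) : ℕ :=
  if 0 < tourBit g j then rootWord c n g (j + 1) else 0

theorem Instance.encode_decode {n : ℕ} (I : Instance n) (hn : 0 < n) (k g : ℕ) :
    (I.decode hn k g).encode = k :: (List.ofFn (fun i : Fin (k + 1) => threshold g i) ++
      List.ofFn fun i : Fin k => tourWord I.cost n g i) := by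
  rw [Instance.decode, Triple.encode_ofSeq]
  congr 4
  ext i
  have := rootWord_mem I.cost hn g (i + 1)
  simp only [Instance.rootOf, tourWord]
  split_ifs <;> omega

/-- Every sequence of increases and tour bits has a guess. -/
theorem exists_guess (k : ℕ) (a : ℕ → ℕ) (b : ℕ → Prop) :
    ∃ g < 2 ^ (∑ i ∈ Finset.range k, a i) * 4 ^ k,
      ∀ j < k, ones (guessAt g j) = a j ∧ (0 < tourBit g j ↔ b j) := by
  have hones : ∀ m g, g % 2 = 0 → ones (g * 2 ^ m + (2 ^ m - 1)) = m := by
    intro m g hg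
    induction m with
    | zero => unfold ones; simp [hg]
    | succ m ih =>
      have h2 : 0 < 2 ^ m := by positivity
      have e : g * 2 ^ (m + 1) + (2 ^ (m + 1) - 1) = 2 * (g * 2 ^ m + (2 ^ m - 1)) + 1 := by
        rw [pow_succ, ← mul_assoc]; omega
      rw [e, ones, if_pos (by omega)]
      rw [show (2 * (g * 2 ^ m + (2 ^ m - 1)) + 1) / 2 = g * 2 ^ m + (2 ^ m - 1) by omega, ih]
  have hdrop : ∀ m g, g % 2 = 0 → dropOnes (g * 2 ^ m + (2 ^ m - 1)) = g := by
    intro m g hg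
    have h2 : 0 < 2 ^ m := by positivity
    rw [dropOnes, hones m g hg, mul_comm, Nat.mul_add_div h2, Nat.div_eq_of_lt (by omega), add_zero]
  induction k generalizing a b with
  | zero => exact ⟨0, by simp, by simp⟩
  | succ k ih =>
    obtain ⟨g', hg', h⟩ := ih (fun i => a (i + 1)) (fun i => b (i + 1))
    classical
    -- The new first stage occupies the low bits: `a 0` ones, then a zero, then the tour bit (of
    -- weight `2` in `e`); `g'` encodes the later stages.
    set e := 4 * g' + (if b 0 then 2 else 0) with he
    set g := e * 2 ^ a 0 + (2 ^ a 0 - 1) with hg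
    have hb : (if b 0 then 2 else 0) = 0 ∨ (if b 0 then 2 else 0) = 2 := by split_ifs <;> simp
    have heven : e % 2 = 0 := by omega
    have hshift : ∀ j, guessAt g (j + 1) = guessAt g' j := by
      intro j
      induction j with
      | zero =>
        simp only [guessAt]
        rw [hg, hdrop _ _ heven]
        omega
      | succ j ihj => rw [guessAt, ihj, guessAt]
    refine ⟨g, ?_, ?_⟩
    · have h2 : 0 < 2 ^ a 0 := by positivity
      -- Stage `0` is split off the sum, because the later stages are those of `g'`.
      rw [Finset.sum_range_succ', pow_add, pow_succ]
      set X := 2 ^ (∑ i ∈ Finset.range k, a (i + 1)) * 4 ^ k with hX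
      have h3 : (e + 1) * 2 ^ a 0 ≤ 4 * X * 2 ^ a 0 := Nat.mul_le_mul_right _ (by omega)
      have h4 : 2 ^ (∑ i ∈ Finset.range k, a (i + 1)) * 2 ^ a 0 * (4 ^ k * 4) = 4 * X * 2 ^ a 0 := by
        rw [hX]; ring
      rw [h4]
      rw [add_mul] at h3
      omega
    · intro j hj
      cases j with
      | zero =>
        refine ⟨hones _ _ heven, ?_⟩
        simp only [tourBit, guessAt]
        rw [hg, hdrop _ _ heven]
        by_cases hb0 : b 0
        · simp [he, hb0]; omega
        · simp [he, hb0]; omega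
      | succ j =>
        rw [tourBit, hshift]
        exact h j (by omega)

end DirLat

/-! ## The algorithm -/

namespace DirLat

open RAM

/-- The parity of the value of an expression. -/
def parity (e : Expr) : Expr := .sub e (.add (.half e) (.half e))

@[simp] theorem eval_parity (σ : State) (e : Expr) : (parity e).eval σ = e.eval σ % 2 := by
  simp only [parity, Expr.eval]; omega

/-- The value of an expression, divided by `32`. -/
def div32 (e : Expr) : Expr := .half (.half (.half (.half (.half e))))

@[simp] theorem eval_div32 (σ : State) (e : Expr) : (div32 e).eval σ = e.eval σ / 32 := by
  simp only [div32, Expr.eval]; omega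

theorem cost_parity (e : Expr) : (parity e).cost = 3 * e.cost + 4 := by
  simp only [parity, Expr.cost]; ring

theorem cost_div32 (e : Expr) : (div32 e).cost = e.cost + 5 := rfl

/-- Read a run of ones of the guess `reg 4`, and increase the scale `reg 5`. -/
def skipProg : Prog :=
  .loop (.lit 0) (parity (.var 4)) <|
    .seq (.assign 4 (.half (.var 4))) (.assign 5 (.add (.var 5) (div32 (.var 5))))

/-- Bounding the number of trailing ones by the guess itself is wasteful but harmless, since guesses
are polynomially bounded. -/
theorem runs_skipProg (σ : State) : Runs skipProg σ ((σ.reg 4 + 1) * 30) fun τ =>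
    τ.reg 4 = dropOnes (σ.reg 4) ∧ τ.reg 5 = grow^[ones (σ.reg 4)] (σ.reg 5) ∧
    (∀ x, x ≠ 4 → x ≠ 5 → τ.reg x = σ.reg x) ∧ τ.arr = σ.arr := by
  refine (Runs.loop (B := 15) (ones (σ.reg 4)) (fun i τ =>
    τ.reg 4 = σ.reg 4 / 2 ^ i ∧ τ.reg 5 = grow^[i] (σ.reg 5) ∧
    (∀ x, x ≠ 4 → x ≠ 5 → τ.reg x = σ.reg x) ∧ τ.arr = σ.arr) ?_ ?_ ?_).mono ?_ ?_
  · simp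
  · rintro i hi τ ⟨t4, t5, tr, ta⟩
    refine ⟨by simp [Expr.eval, t4, odd_of_lt_ones hi], ?_⟩
    refine (Runs.assign_seq <| Runs.assign ?_).mono (by simp [Expr.cost, cost_div32]) (fun _ h => h)
    refine ⟨?_, ?_, ?_, ?_⟩
    · simp [Expr.eval, t4, Nat.div_div_eq_div_mul, pow_succ]
    · simp [Expr.eval, t5, Function.iterate_succ_apply', grow]
    · intro x h4 h5
      simp [h4, h5, tr x h4 h5]
    · simp [ta]
  · rintro τ ⟨t4, -, -, -⟩
    simp [Expr.eval, t4, even_of_ones]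
  · have h := ones_le (σ.reg 4)
    calc _ ≤ (σ.reg 4 + 1) * _ := Nat.mul_le_mul_right _ (by omega)
      _ ≤ _ := Nat.mul_le_mul_left _ (by simp [Expr.cost, cost_parity])
  · rintro τ ⟨t4, t5, tr, ta⟩
    exact ⟨t4, t5, tr, ta⟩

/-- Read a stage of a guess, and write its threshold and the word for its interval. -/
def stageProg : Prog :=
  .seq skipProg <|
  .seq (.assign 18 (parity (.half (.var 4)))) <|
  .seq (.assign 17 (div32 (.var 5))) <|
  .seq (.store 1 (.var 1) (.var 5)) <|
  .seq (.ite (.lit 0) (.var 18) (.ite (.var 6) (.lit 1) rootProg .skip) .skip) <|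
  .seq (.ite (.lit 0) (.var 18) (.store 1 (.add (.var 1) (.var 19)) (.var 7))
    (.store 1 (.add (.var 1) (.var 19)) (.lit 0))) <|
  .seq (.assign 6 (.var 18)) <| .seq (.assign 4 (.half (.half (.var 4)))) <|
  .seq (.assign 5 (.add (.var 5) (.half (.var 5)))) <|
  .seq (.assign 2 (.half (.var 2))) (.assign 1 (.add (.var 1) (.lit 1)))

/-- The contents of the variables at the start of stage `j + 1` of guess `g`. -/
structure AtStage (c : ℕ → ℕ → ℕ) (n g j : ℕ) (τ : State) : Prop where
  r0 : τ.reg 0 = n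
  r2 : τ.reg 2 = (n + 1) / 2 ^ j
  r4 : τ.reg 4 = guessAt g j
  r5 : τ.reg 5 = scale g j
  r6 : τ.reg 6 = prevBit g j
  r7 : τ.reg 7 = rootWord c n g j

/-- A bound on the number of steps of a stage. -/
def stageBound (n g : ℕ) : ℕ := (g + 1) * 30 + (n + 1) * (120 + 60 * n) + 100

/-- In the encoding of a triple, a threshold and the word of the interval that it ends are `k` cells
apart. Hence variable `1` serves as the only position, shifted by variable `19` for the second
write. -/
theorem runs_stageProg {c : ℕ → ℕ → ℕ} {n g j : ℕ} {σ : State} (hσ : HoldsMatrix c n σ)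
    (h : AtStage c n g j σ) : Runs stageProg σ (stageBound n g) fun τ =>
      AtStage c n g (j + 1) τ ∧ τ.reg 1 = σ.reg 1 + 1 ∧
      (∀ x, x = 3 ∨ x = 15 ∨ x = 19 → τ.reg x = σ.reg x) ∧ τ.arr 0 = σ.arr 0 ∧
      ∀ m, τ.arr 1 m = if m = σ.reg 1 + σ.reg 19 then tourWord c n g j else
        if m = σ.reg 1 then threshold g (j + 1) else σ.arr 1 m := by
  have hg : σ.reg 4 ≤ g := h.r4 ▸ guessAt_le g j
  refine Runs.then (B₂ := (n + 1) * (120 + 60 * n) + 100) (runs_skipProg σ) ?_ ?_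
  swap
  · rw [stageBound]
    have : (σ.reg 4 + 1) * 30 ≤ (g + 1) * 30 := by omega
    omega
  rintro τ ⟨t4, t5, tr, ta⟩
  rw [h.r4] at t4
  rw [h.r4, h.r5] at t5
  change τ.reg 5 = threshold g (j + 1) at t5
  refine (Runs.assign_seq <| Runs.assign_seq <| Runs.store_seq <|
    Runs.ite_seq (B₁ := (n + 1) * (120 + 60 * n) + 14) (B₂ := 45)
      (B := (n + 1) * (120 + 60 * n) + 65) (fun υ =>
      υ.reg 7 = rootWord c n g (j + 1) ∧ υ.reg 18 = tourBit g j ∧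
      (∀ x, x ≤ 5 ∨ x = 15 ∨ x = 19 → υ.reg x = τ.reg x) ∧ υ.arr 0 = τ.arr 0 ∧
      ∀ m, υ.arr 1 m = if m = σ.reg 1 then threshold g (j + 1) else σ.arr 1 m)
      ?_ ?_ ?_ (by simp [Expr.cost]; omega)).mono ?_ (fun _ h => h)
  · intro htour
    simp [Expr.eval, t4] at htour
    refine (Runs.ite (B := 10 + (n + 1) * (120 + 60 * n)) ?_ ?_).mono
      (by simp [Expr.cost]; omega) (fun _ h => h)
    · intro hprev
      simp [Expr.eval, tr, h.r6] at hprev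
      refine (runs_rootProg (c := c) (n := n) ⟨?_, ?_⟩).mono le_rfl ?_
      · simp [tr, h.r0]
      · intro a ha b hb
        simp [ta, hσ.2 a ha b hb]
      · rintro υ ⟨u7, ur, ua⟩
        refine ⟨?_, ?_, ?_, ?_, ?_⟩
        · rw [u7, rootWord, if_pos ⟨by rw [tourBit]; omega, by omega⟩]
          simp [Expr.eval, tr, h.r2, t5]
        · simp [ur, Expr.eval, t4, tourBit]
        · intro x hx
          have : x ≠ 17 ∧ x ≠ 18 := by omega
          rw [ur x (by omega)]
          simp [this]
        · rw [ua]; ext m; simp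
        · intro m
          simp [ua, Expr.eval, ta, tr, t5]
    · intro hprev
      simp [Expr.eval, tr, h.r6] at hprev
      refine (Runs.skip ⟨?_, ?_, ?_, ?_, ?_⟩).mono (by omega) (fun _ h => h)
      · rw [rootWord, if_neg (by omega)]
        simp [tr, h.r7]
      · simp [Expr.eval, t4, tourBit]
      · intro x hx
        have : x ≠ 17 ∧ x ≠ 18 := by omega
        simp [this]
      · ext m; simp
      · intro m
        simp [Expr.eval, ta, tr, t5]
  · intro htour
    simp [Expr.eval, t4] at htour
    refine (Runs.skip ⟨?_, ?_, ?_, ?_, ?_⟩).mono (by omega) (fun _ h => h)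
    · rw [rootWord, if_neg (by rw [tourBit]; omega)]
      simp [tr, h.r7]
    · simp [Expr.eval, t4, tourBit]
    · intro x hx
      have : x ≠ 17 ∧ x ≠ 18 := by omega
      simp [this]
    · ext m; simp
    · intro m
      simp [Expr.eval, ta, tr, t5]
  · rintro υ ⟨u7, u18, ur, ua0, ua1⟩
    refine Runs.ite_seq (B₁ := 5) (B₂ := 30) (fun ω => ω.reg = υ.reg ∧ ω.arr 0 = υ.arr 0 ∧
      ∀ m, ω.arr 1 m = if m = σ.reg 1 + σ.reg 19 then tourWord c n g j else υ.arr 1 m)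
      ?_ ?_ ?_ (by simp [Expr.cost])
    · intro htour
      simp [Expr.eval, u18] at htour
      refine Runs.store ⟨rfl, by ext m; simp, fun m => ?_⟩
      simp [Expr.eval, ur, tr, u7, tourWord, htour]
    · intro htour
      simp [Expr.eval, u18] at htour
      refine (Runs.store ⟨rfl, by ext m; simp, fun m => ?_⟩).mono
        (by simp [Expr.cost]) (fun _ h => h)
      simp [Expr.eval, ur, tr, tourWord, htour]
    · rintro ω ⟨wr, wa0, wa1⟩
      refine (Runs.assign_seq <| Runs.assign_seq <| Runs.assign_seq <| Runs.assign_seq <|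
        Runs.assign ?_).mono (by simp [Expr.cost]) (fun _ h => h)
      refine ⟨⟨?_, ?_, ?_, ?_, ?_, ?_⟩, ?_, ?_, ?_, ?_⟩
      · simp [wr, ur, tr, h.r0]
      · simp [Expr.eval, wr, ur, tr, h.r2, Nat.div_div_eq_div_mul, pow_succ]
      · simp [Expr.eval, wr, ur, t4, guessAt]
        omega
      · simp [Expr.eval, wr, ur, t5, scale_succ]
      · simp [Expr.eval, wr, u18, prevBit]
      · simp [wr, u7]
      · simp [Expr.eval, wr, ur, tr]
      · intro x hx
        have : x ≠ 6 ∧ x ≠ 4 ∧ x ≠ 5 ∧ x ≠ 2 ∧ x ≠ 1 := by omega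
        simp [this, wr, ur x (by omega), tr]
      · simp [wa0, ua0, ta]
      · intro m
        simp [wa1, ua1]
  · simp only [Expr.cost, cost_parity, cost_div32]
    omega

/-- The cells of array `1` from `p` on hold the word `w`. -/
def HoldsWord (σ : State) (p : ℕ) (w : List ℕ) : Prop :=
  ∀ (i : ℕ) (h : i < w.length), σ.arr 1 (p + i) = w[i]

theorem HoldsWord.append {σ : State} {p : ℕ} {w w' : List ℕ} (h : HoldsWord σ p w)
    (h' : HoldsWord σ (p + w.length) w') : HoldsWord σ p (w ++ w') := by
  intro i hi
  rw [List.getElem_append]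
  split_ifs with hw
  · exact h i hw
  · rw [← h' (i - w.length) (by simp at hi; omega)]
    congr 1
    omega

/-- Write the triple that the guess `reg 3` encodes. -/
def tripleProg : Prog :=
  .seq (.store 1 (.var 1) (.var 19)) <|
  .seq (.store 1 (.add (.var 1) (.lit 1)) (.lit 0)) <|
  .seq (.assign 1 (.add (.var 1) (.lit 2))) <|
  .seq (.assign 4 (.var 3)) <| .seq (.assign 5 (.lit 32)) <|
  .seq (.assign 2 (.add (.var 0) (.lit 1))) <|
  .seq (.assign 6 (.lit 0)) <| .seq (.assign 7 (.lit 1)) <|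
  .seq (.loop (.lit 1) (.var 2) stageProg) <|
  .assign 1 (.add (.var 1) (.var 19))

/-- As `n + 1 = 2 ^ k`, halving `n + 1` until it is `1` runs exactly `k` stages. The position moves
only along the thresholds, so a final addition of `k` skips the interval words. -/
theorem runs_tripleProg {n k g : ℕ} (I : Instance n) (hn : 0 < n) (hk : n + 1 = 2 ^ k) {σ : State}
    (hσ : HoldsMatrix I.cost n σ) (h3 : σ.reg 3 = g) (h19 : σ.reg 19 = k) :
    Runs tripleProg σ (50 + (k + 1) * (10 + stageBound n g)) fun τ =>
      τ.reg 1 = σ.reg 1 + (I.decode hn k g).encode.length ∧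
      (∀ x, x = 0 ∨ x = 3 ∨ x = 15 ∨ x = 19 → τ.reg x = σ.reg x) ∧ τ.arr 0 = σ.arr 0 ∧
      (∀ m < σ.reg 1, τ.arr 1 m = σ.arr 1 m) ∧
      HoldsWord τ (σ.reg 1) (I.decode hn k g).encode := by
  have hpow : ∀ i ≤ k, (n + 1) / 2 ^ i = 2 ^ (k - i) := fun i hi => by
    rw [hk, Nat.pow_div hi two_pos]
  refine (Runs.store_seq <| Runs.store_seq <| Runs.assign_seq <| Runs.assign_seq <|
    Runs.assign_seq <| Runs.assign_seq <| Runs.assign_seq <| Runs.assign_seq <|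
    Runs.then (B₂ := 5) (B := (k + 1) * (10 + stageBound n g) + 5)
      (Runs.loop (B := stageBound n g) k (fun j τ =>
        AtStage I.cost n g j τ ∧ τ.reg 1 = σ.reg 1 + 2 + j ∧
        (∀ x, x = 3 ∨ x = 15 ∨ x = 19 → τ.reg x = σ.reg x) ∧ τ.arr 0 = σ.arr 0 ∧
        (∀ m < σ.reg 1, τ.arr 1 m = σ.arr 1 m) ∧ τ.arr 1 (σ.reg 1) = k ∧
        (∀ i ≤ j, τ.arr 1 (σ.reg 1 + 1 + i) = threshold g i) ∧
        ∀ i < j, τ.arr 1 (σ.reg 1 + 2 + k + i) = tourWord I.cost n g i) ?_ ?_ ?_) ?_ ?_).mono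
    ?_ (fun _ h => h)
  · refine ⟨⟨?_, ?_, ?_, ?_, ?_, ?_⟩, ?_, ?_, ?_, ?_, ?_, ?_, ?_⟩
    · simp [hσ.1]
    · simp [Expr.eval, hσ.1]
    · simp [Expr.eval, h3, guessAt]
    · simp [Expr.eval, scale]
    · simp [Expr.eval, prevBit]
    · simp [Expr.eval, rootWord]
    · simp [Expr.eval]
    · intro x hx
      have : x ≠ 1 ∧ x ≠ 2 ∧ x ≠ 4 ∧ x ≠ 5 ∧ x ≠ 6 ∧ x ≠ 7 := by omega
      simp [this]
    · ext m; simp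
    · intro m hm
      have : m ≠ σ.reg 1 ∧ m ≠ σ.reg 1 + 1 := by omega
      simp [Expr.eval, this]
    · simp [Expr.eval, h19]
    · intro i hi
      obtain rfl : i = 0 := by omega
      simp [Expr.eval, threshold]
    · intro i hi
      omega
  · rintro j hj τ ⟨hst, t1, tr, ta, tlo, tk, tt, tw⟩
    have hlt : 1 < τ.reg 2 := by
      rw [hst.r2, hpow j hj.le]
      exact Nat.one_lt_two_pow (by omega)
    refine ⟨by simpa [Expr.eval] using hlt, ?_⟩
    have hτ : HoldsMatrix I.cost n τ := ⟨hst.r0, by rw [ta]; exact hσ.2⟩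
    refine (runs_stageProg hτ hst).mono le_rfl ?_
    rintro υ ⟨ust, u1, ur, ua0, ua1⟩
    have t19 : τ.reg 19 = k := by rw [tr 19 (by omega), h19]
    refine ⟨ust, by omega, fun x hx => by rw [ur x hx, tr x hx], ua0.trans ta, ?_, ?_, ?_, ?_⟩
    · intro m hm
      rw [ua1, if_neg (by omega), if_neg (by omega), tlo m hm]
    · rw [ua1, if_neg (by omega), if_neg (by omega), tk]
    · intro i hi
      rw [ua1, if_neg (by omega)]
      by_cases hij : i = j + 1
      · rw [if_pos (by omega), hij]
      · rw [if_neg (by omega), tt i (by omega)]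
    · intro i hi
      rw [ua1]
      by_cases hij : i = j
      · rw [if_pos (by omega), hij]
      · rw [if_neg (by omega), if_neg (by omega), tw i (by omega)]
  · rintro τ ⟨hst, -⟩
    simp [Expr.eval, hst.r2, hpow k le_rfl]
  · rintro τ ⟨hst, t1, tr, ta, tlo, tk, tt, tw⟩
    have t19 : τ.reg 19 = k := by rw [tr 19 (by omega), h19]
    refine (Runs.assign ?_).mono (by simp [Expr.cost]) fun _ h => h
    refine ⟨?_, ?_, ?_, ?_, ?_⟩
    · simp [Expr.eval, t1, t19, I.encode_decode]
      omega
    · intro x hx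
      have : x ≠ 1 := by omega
      simp only [State.assign_reg, this, if_false]
      rcases hx with rfl | hx
      · rw [hst.r0, hσ.1]
      · exact tr x hx
    · simp [ta]
    · simpa using tlo
    · rw [I.encode_decode, ← List.singleton_append]
      refine HoldsWord.append ?_ (HoldsWord.append ?_ ?_)
      · intro i hi
        simp at hi
        subst hi
        simpa using tk
      · intro i hi
        simp at hi
        simp only [List.length_singleton, State.assign_arr, List.getElem_ofFn]
        exact tt i (by omega)
      · intro i hi
        simp at hi
        simp only [List.length_singleton, List.length_ofFn, State.assign_arr, List.getElem_ofFn]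
        rw [← tw i hi]
        congr 1
        omega
  · simp only [Expr.cost]
    have : (k + 1) * (1 + 1 + 1 + stageBound n g) ≤ (k + 1) * (10 + stageBound n g) :=
      Nat.mul_le_mul_left _ (by omega)
    omega
  · simp only [Expr.cost]
    omega

end DirLat

/-! ### Computing the number of guesses and listing all triples -/

namespace DirLat

open RAM

/-- Add up the distance matrix in `reg 16`. -/
def sumProg : Prog :=
  .seq (.assign 20 (.add (.var 0) (.lit 2))) <|
  .seq (.loop (.var 8) (.var 20) <|
    .seq (.assign 9 (.add (.var 9) (.var 20))) (.assign 8 (.add (.var 8) (.lit 1)))) <|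
  .loop (.var 10) (.var 9) <|
    .seq (.assign 16 (.add (.var 16) (.load 0 (.var 10)))) (.assign 10 (.add (.var 10) (.lit 1)))

/-- The sum of all distances. -/
def Instance.matrixSum {n : ℕ} (I : Instance n) : ℕ :=
  ∑ m ∈ Finset.range ((n + 2) * (n + 2)), I.cost (m / (n + 2)) (m % (n + 2))

theorem Instance.cost_le_matrixSum {n : ℕ} (I : Instance n) {a b : ℕ} (ha : a < n + 2)
    (hb : b < n + 2) : I.cost a b ≤ I.matrixSum := by
  have hm : a * (n + 2) + b ∈ Finset.range ((n + 2) * (n + 2)) := by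
    rw [Finset.mem_range]
    nlinarith
  have h := Finset.single_le_sum
    (f := fun m => I.cost (m / (n + 2)) (m % (n + 2))) (fun _ _ => Nat.zero_le _) hm
  have h1 : (a * (n + 2) + b) / (n + 2) = a := by
    rw [mul_comm, Nat.mul_add_div (by omega), Nat.div_eq_of_lt hb, add_zero]
  have h2 : (a * (n + 2) + b) % (n + 2) = b := by
    rw [mul_comm, Nat.mul_add_mod, Nat.mod_eq_of_lt hb]
  simp only [h1, h2] at h
  exact h

theorem holdsMatrix_input {n : ℕ} (I : Instance n) : HoldsMatrix I.cost n I.input := by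
  refine ⟨by simp [Instance.input], fun a ha b hb => ?_⟩
  have h1 : (a * (n + 2) + b) / (n + 2) = a := by
    rw [mul_comm, Nat.mul_add_div (by omega), Nat.div_eq_of_lt hb, add_zero]
  have h2 : (a * (n + 2) + b) % (n + 2) = b := by
    rw [mul_comm, Nat.mul_add_mod, Nat.mod_eq_of_lt hb]
  have hm : a * (n + 2) + b < (n + 2) * (n + 2) := by nlinarith
  simp [Instance.input, hm, h1, h2, Instance.cost]

/-- The sum of all distances is a bound on every distance that is easy to compute. The number of
entries, `(n + 2) * (n + 2)`, is obtained by repeated addition. -/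
theorem runs_sumProg {n : ℕ} (I : Instance n) :
    Runs sumProg I.input (20 + (n + 3) * 20 + ((n + 2) * (n + 2) + 1) * 20) fun τ =>
      τ.reg 16 = I.matrixSum ∧ τ.reg 0 = n ∧ τ.reg 3 = 0 ∧ τ.reg 19 = 0 ∧
      τ.arr = I.input.arr := by
  refine (Runs.assign_seq <| Runs.then (B₁ := (n + 3) * 20) (B₂ := ((n + 2) * (n + 2) + 1) * 20)
    (B := (n + 3) * 20 + ((n + 2) * (n + 2) + 1) * 20)
    ((Runs.loop (B := 10) (n + 2) (fun i τ => τ.reg 8 = i ∧ τ.reg 9 = i * (n + 2) ∧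
      τ.reg 20 = n + 2 ∧ τ.reg 0 = n ∧ τ.reg 3 = 0 ∧ τ.reg 10 = 0 ∧ τ.reg 16 = 0 ∧
      τ.reg 19 = 0 ∧ τ.arr = I.input.arr) ?_ ?_ ?_).mono ?_ fun _ h => h) ?_ le_rfl).mono
      ?_ fun _ h => h
  · simp [Expr.eval, Instance.input]
  · rintro i hi τ ⟨t8, t9, t20, t0, t3, t10, t16, t19, ta⟩
    refine ⟨by simpa [Expr.eval, t8, t20] using hi, ?_⟩
    refine (Runs.assign_seq <| Runs.assign ?_).mono (by simp [Expr.cost]) fun _ h => h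
    simp [Expr.eval, t8, t9, t20, t0, t3, t10, t16, t19, ta]
    ring
  · rintro τ ⟨t8, -, t20, -⟩
    simp [Expr.eval, t8, t20]
  · exact Nat.mul_le_mul (by omega) (by simp [Expr.cost])
  · rintro τ ⟨-, t9, -, t0, t3, t10, t16, t19, ta⟩
    refine (Runs.loop (B := 10) ((n + 2) * (n + 2)) (fun i υ => υ.reg 10 = i ∧
      υ.reg 9 = (n + 2) * (n + 2) ∧ υ.reg 0 = n ∧ υ.reg 3 = 0 ∧ υ.reg 19 = 0 ∧
      υ.arr = I.input.arr ∧
      υ.reg 16 = ∑ m ∈ Finset.range i, I.cost (m / (n + 2)) (m % (n + 2))) ?_ ?_ ?_).mono ?_ ?_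
    · simp [t9, t0, t3, t10, t16, t19, ta]
    · rintro i hi υ ⟨u10, u9, u0, u3, u19, ua, u16⟩
      refine ⟨by simpa [Expr.eval, u10, u9] using hi, ?_⟩
      refine (Runs.assign_seq <| Runs.assign ?_).mono (by simp [Expr.cost]) fun _ h => h
      simp [Expr.eval, u10, u9, u0, u3, u19, ua, u16, Finset.sum_range_succ, Instance.input, hi,
        Instance.cost]
    · rintro υ ⟨u10, u9, -⟩
      simp [Expr.eval, u10, u9]
    · exact Nat.mul_le_mul le_rfl (by simp [Expr.cost])
    · rintro υ ⟨-, -, u0, u3, u19, ua, u16⟩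
      exact ⟨u16, u0, u3, u19, ua⟩
  · simp only [Expr.cost]
    omega

/-- The number of increases after which the scale is at least `32 B`. -/
noncomputable def skipCount (B : ℕ) : ℕ := sInf {i | B ≤ grow^[i] 32 / 32}

/-- Every increase adds at least `1` to a scale that is at least `32`. This crude bound only shows
that every target is reached. -/
theorem add_le_grow_iterate (i : ℕ) : 32 + i ≤ grow^[i] 32 := by
  induction i with
  | zero => rfl
  | succ i ih =>
    rw [Function.iterate_succ_apply', grow]
    omega

theorem le_of_skipCount (B : ℕ) : B ≤ grow^[skipCount B] 32 / 32 := by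
  refine Nat.sInf_mem (s := {i | B ≤ grow^[i] 32 / 32}) ⟨32 * B, ?_⟩
  have := add_le_grow_iterate (32 * B)
  rw [Set.mem_ofPred_eq]
  omega

theorem lt_of_lt_skipCount {B i : ℕ} (hi : i < skipCount B) : grow^[i] 32 / 32 < B := by
  have := Nat.notMem_of_lt_sInf hi
  simpa using this

/-- The largest threshold that a guess has to reach, divided by `32`. -/
def Instance.reach {n : ℕ} (I : Instance n) (k : ℕ) : ℕ := I.matrixSum * 2 ^ k

/-- The number of guesses. -/
noncomputable def Instance.guessCount {n : ℕ} (I : Instance n) (k : ℕ) : ℕ :=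
  2 ^ skipCount (I.reach k) * 4 ^ k

/-- Compute the number of guesses in `reg 15`, and the number of stages in `reg 19`. -/
def guessCountProg : Prog :=
  .seq (.assign 15 (.lit 1)) <| .seq (.assign 2 (.add (.var 0) (.lit 1))) <|
  .seq (.loop (.lit 1) (.var 2) <|
    .seq (.assign 2 (.half (.var 2))) <|
    .seq (.assign 15 (.add (.add (.var 15) (.var 15)) (.add (.var 15) (.var 15)))) <|
    .seq (.assign 19 (.add (.var 19) (.lit 1))) (.assign 16 (.add (.var 16) (.var 16)))) <|
  .seq (.assign 5 (.lit 32)) <|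
  .loop (div32 (.var 5)) (.var 16) <|
    .seq (.assign 5 (.add (.var 5) (div32 (.var 5)))) (.assign 15 (.add (.var 15) (.var 15)))

/-- While `n + 1` is halved down to `1`, quadrupling yields `4 ^ k` and doubling yields `I.reach k`.
The second loop doubles the count with each increase of the scale. -/
theorem runs_guessCountProg {n k : ℕ} (I : Instance n) (hk : n + 1 = 2 ^ k) {σ : State}
    (h0 : σ.reg 0 = n) (h3 : σ.reg 3 = 0) (h16 : σ.reg 16 = I.matrixSum) (h19 : σ.reg 19 = 0) :
    Runs guessCountProg σ (20 + (k + 1) * 40 + (skipCount (I.reach k) + 1) * 40) fun τ =>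
      τ.reg 15 = I.guessCount k ∧ τ.reg 19 = k ∧ τ.reg 0 = n ∧ τ.reg 3 = 0 ∧ τ.arr = σ.arr := by
  have hpow : ∀ i ≤ k, (n + 1) / 2 ^ i = 2 ^ (k - i) := fun i hi => by
    rw [hk, Nat.pow_div hi two_pos]
  refine (Runs.assign_seq <| Runs.assign_seq <| Runs.then (B₁ := (k + 1) * 40)
    (B₂ := 5 + (skipCount (I.reach k) + 1) * 40)
    (B := (k + 1) * 40 + (5 + (skipCount (I.reach k) + 1) * 40))
    ((Runs.loop (B := 30) k (fun i τ => τ.reg 2 = (n + 1) / 2 ^ i ∧ τ.reg 15 = 4 ^ i ∧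
      τ.reg 19 = i ∧ τ.reg 16 = I.matrixSum * 2 ^ i ∧ τ.reg 0 = n ∧ τ.reg 3 = 0 ∧
      τ.arr = σ.arr) ?_ ?_ ?_).mono ?_ fun _ h => h) ?_ le_rfl).mono ?_ fun _ h => h
  · simp [Expr.eval, h0, h3, h16, h19]
  · rintro i hi τ ⟨t2, t15, t19, t16, t0, t3, ta⟩
    have hlt : 1 < τ.reg 2 := by
      rw [t2, hpow i hi.le]
      exact Nat.one_lt_two_pow (by omega)
    refine ⟨by simpa [Expr.eval] using hlt, ?_⟩
    refine (Runs.assign_seq <| Runs.assign_seq <| Runs.assign_seq <| Runs.assign ?_).mono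
      (by simp [Expr.cost]) fun _ h => h
    simp [Expr.eval, t2, t15, t19, t16, t0, t3, ta, Nat.div_div_eq_div_mul, pow_succ]
    constructor <;> ring
  · rintro τ ⟨t2, -⟩
    simp [Expr.eval, t2, hpow k le_rfl]
  · exact Nat.mul_le_mul le_rfl (by simp [Expr.cost])
  · rintro τ ⟨-, t15, t19, t16, t0, t3, ta⟩
    refine (Runs.assign_seq <| Runs.loop (B := 20) (skipCount (I.reach k)) (fun i υ =>
      υ.reg 5 = grow^[i] 32 ∧ υ.reg 15 = 2 ^ i * 4 ^ k ∧ υ.reg 19 = k ∧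
      υ.reg 16 = I.reach k ∧ υ.reg 0 = n ∧ υ.reg 3 = 0 ∧ υ.arr = σ.arr) ?_ ?_ ?_).mono ?_ ?_
    · simp [Expr.eval, t15, t19, t16, t0, t3, ta, Instance.reach]
    · rintro i hi υ ⟨u5, u15, u19, u16, u0, u3, ua⟩
      refine ⟨by simpa [Expr.eval, u5, u16] using lt_of_lt_skipCount hi, ?_⟩
      refine (Runs.assign_seq <| Runs.assign ?_).mono
        (by simp [Expr.cost, cost_div32]) fun _ h => h
      simp [Expr.eval, u5, u15, u19, u16, u0, u3, ua, Function.iterate_succ_apply', grow, pow_succ]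
      ring
    · rintro υ ⟨u5, -, -, u16, -⟩
      simpa [Expr.eval, u5, u16] using le_of_skipCount (I.reach k)
    · have : (skipCount (I.reach k) + 1) * ((div32 (.var 5)).cost + (Expr.var 16).cost + 1 + 20) ≤
        (skipCount (I.reach k) + 1) * 40 := Nat.mul_le_mul le_rfl (by simp [Expr.cost, cost_div32])
      simp only [Expr.cost] at this ⊢
      omega
    · rintro υ ⟨-, u15, u19, -, u0, u3, ua⟩
      exact ⟨u15, u19, u0, u3, ua⟩
  · simp only [Expr.cost]
    omega

/-- Write the triples of all guesses. -/
def listProg : Prog :=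
  .seq (.store 1 (.lit 0) (.var 15)) <| .seq (.assign 1 (.lit 1)) <|
  .loop (.var 3) (.var 15) <| .seq tripleProg (.assign 3 (.add (.var 3) (.lit 1)))

/-- The list of all triples. -/
noncomputable def Instance.triples {n : ℕ} (I : Instance n) (hn : 0 < n) (k : ℕ) :
    List (Triple n) :=
  (List.range (I.guessCount k)).map (I.decode hn k)

theorem runs_listProg {n k : ℕ} (I : Instance n) (hn : 0 < n) (hk : n + 1 = 2 ^ k) {σ : State}
    (hσ : HoldsMatrix I.cost n σ) (h3 : σ.reg 3 = 0) (h15 : σ.reg 15 = I.guessCount k)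
    (h19 : σ.reg 19 = k) :
    Runs listProg σ (10 + (I.guessCount k + 1) *
        (60 + (k + 1) * (10 + stageBound n (I.guessCount k)))) fun τ =>
      τ.HasOutput (encodeTriples (I.triples hn k)) := by
  set G := I.guessCount k with hG
  refine (Runs.store_seq <| Runs.assign_seq <|
    Runs.loop (B := 54 + (k + 1) * (10 + stageBound n G)) G (fun i τ =>
      τ.reg 1 = 1 + (((List.range i).map (I.decode hn k)).flatMap Triple.encode).length ∧
      τ.reg 3 = i ∧ τ.reg 0 = n ∧ τ.reg 15 = G ∧ τ.reg 19 = k ∧ τ.arr 0 = σ.arr 0 ∧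
      τ.arr 1 0 = G ∧
      HoldsWord τ 1 (((List.range i).map (I.decode hn k)).flatMap Triple.encode))
      ?_ ?_ ?_).mono ?_ ?_
  · refine ⟨?_, ?_, ?_, ?_, ?_, ?_, ?_, ?_⟩
    · simp [Expr.eval]
    · simp [h3]
    · simp [hσ.1]
    · simp [h15]
    · simp [h19]
    · ext m; simp
    · simp [Expr.eval, h15]
    · intro i hi
      simp at hi
  · rintro i hi τ ⟨t1, t3, t0, t15, t19, ta, tG, tw⟩
    refine ⟨by simpa [Expr.eval, t3, t15] using hi, ?_⟩
    have hτ : HoldsMatrix I.cost n τ := ⟨t0, by rw [ta]; exact hσ.2⟩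
    have hbound : stageBound n i ≤ stageBound n G := by
      unfold stageBound
      omega
    refine Runs.then (B₂ := 4) (runs_tripleProg I hn hk hτ t3 t19) ?_ ?_
    · rintro υ ⟨u1, ur, ua, ulo, uw⟩
      have hflat : ((List.range (i + 1)).map (I.decode hn k)).flatMap Triple.encode =
          ((List.range i).map (I.decode hn k)).flatMap Triple.encode ++
            (I.decode hn k i).encode := by
        simp [List.range_succ]
      refine (Runs.assign ?_).mono (by simp [Expr.cost]) fun _ h => h
      refine ⟨?_, ?_, ?_, ?_, ?_, ?_, ?_, ?_⟩
      · rw [hflat, List.length_append]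
        simp only [State.assign_reg]
        rw [if_neg (by norm_num), u1, t1, add_assoc]
      · simp [Expr.eval, ur, t3]
      · simp [ur, t0]
      · simp [ur, t15]
      · simp [ur, t19]
      · simp [ua, ta]
      · simp [ulo 0 (by omega), tG]
      · rw [hflat]
        refine HoldsWord.append ?_ ?_
        · intro m hm
          rw [State.assign_arr, ulo _ (by omega)]
          exact tw m hm
        · rw [t1] at uw
          exact uw
    · have : (k + 1) * (10 + stageBound n i) ≤ (k + 1) * (10 + stageBound n G) :=
        Nat.mul_le_mul_left _ (by omega)
      omega
  · rintro τ ⟨-, t3, -, t15, -⟩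
    simp [Expr.eval, t3, t15]
  · simp only [Expr.cost]
    have : (G + 1) * (1 + 1 + 1 + (54 + (k + 1) * (10 + stageBound n G))) ≤
      (G + 1) * (60 + (k + 1) * (10 + stageBound n G)) := Nat.mul_le_mul_left _ (by omega)
    omega
  · rintro τ ⟨t1, -, -, -, -, -, tG, tw⟩
    have hw : HoldsWord τ 0 (encodeTriples (I.triples hn k)) := by
      rw [encodeTriples, ← List.singleton_append]
      refine HoldsWord.append ?_ tw
      intro i hi
      simp at hi
      subst hi
      simpa [Instance.triples] using tG
    refine ⟨?_, fun i hi => by rw [← hw i hi, zero_add]⟩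
    rw [t1, encodeTriples, List.length_cons, add_comm, Instance.triples]

/-- The algorithm. -/
def mainProg : Prog := .seq sumProg (.seq guessCountProg listProg)

/-- A bound on the number of steps of the algorithm. -/
noncomputable def Instance.stepBound {n : ℕ} (I : Instance n) (k : ℕ) : ℕ :=
  (20 + (n + 3) * 20 + ((n + 2) * (n + 2) + 1) * 20) +
  ((20 + (k + 1) * 40 + (skipCount (I.reach k) + 1) * 40) +
  (10 + (I.guessCount k + 1) * (60 + (k + 1) * (10 + stageBound n (I.guessCount k)))))

theorem runs_mainProg {n k : ℕ} (I : Instance n) (hn : 0 < n) (hk : n + 1 = 2 ^ k) :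
    Runs mainProg I.input (I.stepBound k) fun τ =>
      τ.HasOutput (encodeTriples (I.triples hn k)) := by
  refine Runs.then (runs_sumProg I) ?_ le_rfl
  rintro τ ⟨t16, t0, t3, t19, ta⟩
  refine Runs.then (runs_guessCountProg I hk t0 t3 t16 t19) ?_ le_rfl
  rintro υ ⟨u15, u19, u0, u3, ua⟩
  refine runs_listProg I hn hk ⟨u0, ?_⟩ u3 u15 u19
  rw [ua, ta]
  exact (holdsMatrix_input I).2

end DirLat

/-! ## Polynomial bounds -/

/-- `f` is bounded by a polynomial in `X`. -/
def PolyBounded {ι : Type*} (X : ι → ℝ) (f : ι → ℕ) : Prop :=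
  ∃ C d : ℕ, ∀ i, (f i : ℝ) ≤ C * X i ^ d

namespace PolyBounded

variable {ι : Type*} {X : ι → ℝ} {f g : ι → ℕ}

theorem mono (hg : PolyBounded X g) (h : ∀ i, f i ≤ g i) : PolyBounded X f := by
  obtain ⟨C, d, hg⟩ := hg
  exact ⟨C, d, fun i => (Nat.cast_le.2 (h i)).trans (hg i)⟩

theorem const (m : ℕ) : PolyBounded X fun _ => m := ⟨m, 0, fun i => by simp⟩

theorem add (hX : ∀ i, 1 ≤ X i) (hf : PolyBounded X f) (hg : PolyBounded X g) :
    PolyBounded X fun i => f i + g i := by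
  obtain ⟨C, d, hf⟩ := hf
  obtain ⟨C', d', hg⟩ := hg
  refine ⟨C + C', d + d', fun i => ?_⟩
  push_cast
  rw [add_mul]
  refine add_le_add ((hf i).trans ?_) ((hg i).trans ?_)
  · gcongr
    · exact hX i
    · omega
  · gcongr
    · exact hX i
    · omega

theorem mul (hX : ∀ i, 1 ≤ X i) (hf : PolyBounded X f) (hg : PolyBounded X g) :
    PolyBounded X fun i => f i * g i := by
  obtain ⟨C, d, hf⟩ := hf
  obtain ⟨C', d', hg⟩ := hg
  refine ⟨C * C', d + d', fun i => ?_⟩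
  have h0 : 0 ≤ X i := zero_le_one.trans (hX i)
  calc ((f i * g i : ℕ) : ℝ) = f i * g i := by push_cast; rfl
    _ ≤ (C * X i ^ d) * (C' * X i ^ d') := by
      have := hf i
      have := hg i
      gcongr
    _ = _ := by push_cast; ring

theorem pow (hX : ∀ i, 1 ≤ X i) (hf : PolyBounded X f) (m : ℕ) :
    PolyBounded X fun i => f i ^ m := by
  induction m with
  | zero => exact const 1
  | succ m ih => simpa only [pow_succ] using mul hX ih hf

end PolyBounded

namespace DirLat

/-- `64` increases at least double the scale, so the number of increases is logarithmic in the scale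
reached. -/
theorem two_pow_le_grow_iterate (i : ℕ) : 32 ≤ grow^[i] 32 ∧ 2 ^ i ≤ (grow^[i] 32) ^ 64 := by
  induction i with
  | zero => exact ⟨le_rfl, Nat.one_le_pow 64 32 (by norm_num)⟩
  | succ i ih =>
    rw [Function.iterate_succ_apply']
    set s := grow^[i] 32
    -- For `s ≥ 32`, rounding down `s / 32` loses at most half of it, so the true factor is at least
    -- `65 / 64`.
    have h : 65 * s ≤ 64 * grow s := by unfold grow; omega
    refine ⟨ih.1.trans (le_grow s), ?_⟩
    have h1 : (65 * s) ^ 64 ≤ (64 * grow s) ^ 64 := Nat.pow_le_pow_left h 64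
    rw [mul_pow, mul_pow] at h1
    -- This is `(1 + 1 / 64) ^ 64 ≥ 2`.
    have h2 : 2 * 64 ^ 64 ≤ 65 ^ 64 := by norm_num
    have h3 : 64 ^ 64 * (2 * s ^ 64) ≤ 64 ^ 64 * grow s ^ 64 :=
      calc 64 ^ 64 * (2 * s ^ 64) = 2 * 64 ^ 64 * s ^ 64 := by rw [← mul_assoc, mul_comm (64 ^ 64) 2]
        _ ≤ 65 ^ 64 * s ^ 64 := Nat.mul_le_mul_right _ h2
        _ ≤ _ := h1
    have h4 : 2 * s ^ 64 ≤ grow s ^ 64 := Nat.le_of_mul_le_mul_left h3 (by positivity)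
    rw [pow_succ']
    exact (Nat.mul_le_mul_left 2 ih.2).trans h4

/-- One increase before the last, the scale is still below `32 * B`; a guess with one bit per
increase is therefore polynomial in `B`. -/
theorem two_pow_skipCount_le (B : ℕ) : 2 ^ skipCount B ≤ 2 * (32 * B) ^ 64 + 1 := by
  rcases h : skipCount B with _ | i
  · rw [pow_zero]
    exact Nat.le_add_left _ _
  · have h1 := lt_of_lt_skipCount (B := B) (i := i) (by omega)
    have h2 : grow^[i] 32 ≤ 32 * B := by omega
    rw [pow_succ']
    exact (Nat.mul_le_mul_left 2 ((two_pow_le_grow_iterate i).2.trans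
      (Nat.pow_le_pow_left h2 64))).trans (Nat.le_succ _)

/-- A nice instance. -/
structure NiceInput where
  n : ℕ
  k : ℕ
  ε : ℝ
  inst : Instance n
  pos : 0 < ε
  nice : inst.IsNice ε
  card : n + 1 = 2 ^ k

namespace NiceInput

/-- The quantity in which the running time is to be polynomial. -/
noncomputable def size (J : NiceInput) : ℝ := (J.n : ℝ) + 1 / J.ε + 1

theorem inv_pos (J : NiceInput) : 0 < 1 / J.ε := one_div_pos.2 J.pos

theorem one_le_size (J : NiceInput) : 1 ≤ J.size := by
  have := J.inv_pos
  have : (0 : ℝ) ≤ J.n := Nat.cast_nonneg _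
  rw [size]
  linarith

theorem polyBounded_n : PolyBounded size n := by
  refine ⟨1, 1, fun J => ?_⟩
  have := J.inv_pos
  rw [size]
  push_cast
  linarith

theorem k_le (J : NiceInput) : J.k ≤ J.n := by
  have := Nat.lt_two_pow_self (n := J.k)
  have := J.card
  omega

/-- The upper bound on distances in nice instances enters here: `n ^ 5 / ε ^ 2` has total degree `7`
in `n` and `1 / ε`. -/
theorem polyBounded_maxCost : PolyBounded size fun J => J.inst.maxCost := by
  refine ⟨2, 7, fun J => ?_⟩
  have h0 := J.inv_pos
  have hn0 : (0 : ℝ) ≤ J.n := Nat.cast_nonneg _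
  have hn : (J.n : ℝ) ≤ J.size := by rw [size]; linarith
  have he : 1 / J.ε ≤ J.size := by rw [size]; linarith
  have hs : 0 ≤ J.size := zero_le_one.trans J.one_le_size
  have key : ∀ u v, (J.inst.c u v : ℝ) ≤ 2 * J.size ^ 7 := by
    intro u v
    by_cases huv : u = v
    · rw [huv, J.inst.c_self]
      have := J.one_le_size
      push_cast
      positivity
    · calc (J.inst.c u v : ℝ) ≤ 2 * (J.n : ℝ) ^ 5 / J.ε ^ 2 := (J.nice.2 u v huv).2
        _ = 2 * ((J.n : ℝ) ^ 5 * (1 / J.ε) ^ 2) := by rw [one_div, inv_pow]; ring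
        _ ≤ 2 * (J.size ^ 5 * J.size ^ 2) := by gcongr
        _ = _ := by ring
  have hsup : J.inst.maxCost ≤ ⌊2 * J.size ^ 7⌋₊ :=
    Finset.sup_le fun u _ => Finset.sup_le fun v _ => Nat.le_floor (key u v)
  have := J.one_le_size
  calc (J.inst.maxCost : ℝ) ≤ ⌊2 * J.size ^ 7⌋₊ := Nat.cast_le.2 hsup
    _ ≤ 2 * J.size ^ 7 := Nat.floor_le (by positivity)
    _ = _ := by norm_num

theorem polyBounded_reach : PolyBounded size fun J => J.inst.reach J.k := by
  refine PolyBounded.mono (g := fun J => (J.n + 2) * (J.n + 2) * J.inst.maxCost * (J.n + 1)) ?_ ?_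
  · exact (((polyBounded_n.add one_le_size (.const 2)).mul one_le_size
      (polyBounded_n.add one_le_size (.const 2))).mul one_le_size polyBounded_maxCost).mul
      one_le_size (polyBounded_n.add one_le_size (.const 1))
  · intro J
    rw [Instance.reach, ← J.card]
    refine Nat.mul_le_mul_right _ ?_
    rw [Instance.matrixSum]
    refine (Finset.sum_le_card_nsmul _ _ J.inst.maxCost fun m _ => ?_).trans (by simp)
    exact (Finset.le_sup (f := fun v => J.inst.c _ v) (Finset.mem_univ _)).trans
      (Finset.le_sup (f := fun u => Finset.univ.sup fun v => J.inst.c u v) (Finset.mem_univ _))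

theorem polyBounded_two_pow_skipCount :
    PolyBounded size fun J => 2 ^ skipCount (J.inst.reach J.k) :=
  ((PolyBounded.const 2).mul one_le_size
    ((((PolyBounded.const 32).mul one_le_size polyBounded_reach).pow one_le_size 64)) |>.add
    one_le_size (.const 1)).mono fun _ => two_pow_skipCount_le _

/-- The two further bits per stage contribute `4 ^ k = (n + 1) ^ 2`. -/
theorem polyBounded_guessCount : PolyBounded size fun J => J.inst.guessCount J.k := by
  refine (polyBounded_two_pow_skipCount.mul one_le_size
    ((polyBounded_n.add one_le_size (.const 1)).pow one_le_size 2)).mono fun J => ?_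
  rw [Instance.guessCount, J.card, ← pow_mul, mul_comm J.k, pow_mul]
  norm_num

theorem polyBounded_stepBound : PolyBounded size fun J => J.inst.stepBound J.k := by
  have hX := one_le_size
  have hn := polyBounded_n
  have hk : PolyBounded size k := hn.mono k_le
  have hG := polyBounded_guessCount
  have hS : PolyBounded size fun J => skipCount (J.inst.reach J.k) :=
    polyBounded_two_pow_skipCount.mono fun J => Nat.lt_two_pow_self.le
  have c : ∀ m, PolyBounded size fun _ => m := fun m => .const m
  have hst : PolyBounded size fun J => stageBound J.n (J.inst.guessCount J.k) :=
    (((hG.add hX (c 1)).mul hX (c 30)).add hX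
      ((hn.add hX (c 1)).mul hX ((c 120).add hX ((c 60).mul hX hn)))).add hX (c 100)
  exact ((((c 20).add hX ((hn.add hX (c 3)).mul hX (c 20))).add hX
    ((((hn.add hX (c 2)).mul hX (hn.add hX (c 2))).add hX (c 1)).mul hX (c 20)))).add hX
    (((((c 20).add hX ((hk.add hX (c 1)).mul hX (c 40))).add hX
      ((hS.add hX (c 1)).mul hX (c 40)))).add hX
    ((c 10).add hX ((hG.add hX (c 1)).mul hX ((c 60).add hX
      ((hk.add hX (c 1)).mul hX ((c 10).add hX hst))))))

end NiceInput

end DirLat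

/-! ## Solutions of the linear program from walks -/

namespace DirLat

variable {n : ℕ}

/-- The vertices `P 0, …, P (N + 1)` form a walk through the time-indexed graph from `(s, 0)` to
`(s', T + 1)`, on which time increases and which visits client `v` once, at time `τ v`. -/
structure IsWalk (I : Instance n) (R : Finset (Fin n)) (T N : ℕ) (P : ℕ → Site n × ℕ)
    (τ : Fin n → ℕ) : Prop where
  start : P 0 = (.source, 0)
  finish : P (N + 1) = (.target, T + 1)
  lt : ∀ i ≤ N, (P i).2 < (P (i + 1)).2
  dist : ∀ i ≤ N, (P i).2 + I.c (P i).1.loc (P (i + 1)).1.loc ≤ (P (i + 1)).2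
  mem : ∀ i, 1 ≤ i → i ≤ N → (∃ v, (P i).1 = .client v) ∨ ∃ r ∈ R, (P i).1 = .root r
  visit : ∀ v, ∃ i, 1 ≤ i ∧ i ≤ N ∧ P i = (.client v, τ v)
  unique : ∀ i, 1 ≤ i → i ≤ N → ∀ v t, P i = (.client v, t) → t = τ v

namespace IsWalk

variable {I : Instance n} {R : Finset (Fin n)} {T N : ℕ} {P : ℕ → Site n × ℕ} {τ : Fin n → ℕ}

theorem strictMono (h : IsWalk I R T N P τ) {i j : ℕ} (hij : i < j) (hj : j ≤ N + 1) :
    (P i).2 < (P j).2 := by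
  induction j, hij using Nat.le_induction with
  | base => exact h.lt i (by omega)
  | succ j hj' ih => exact (ih (by omega)).trans (h.lt j (by omega))

/-- Times increase strictly along a walk, so no vertex repeats and every vertex has at most one walk
edge in and one out. -/
theorem inj (h : IsWalk I R T N P τ) {i j : ℕ} (hi : i ≤ N + 1) (hj : j ≤ N + 1)
    (hij : P i = P j) : i = j := by
  rcases lt_trichotomy i j with hlt | heq | hlt
  · exact absurd (congrArg Prod.snd hij) (h.strictMono hlt hj).ne
  · exact heq
  · exact absurd (congrArg Prod.snd hij) (h.strictMono hlt hi).ne'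

theorem time_mem (h : IsWalk I R T N P τ) {i : ℕ} (h1 : 1 ≤ i) (hi : i ≤ N) :
    (P i).2 ∈ Finset.Icc 1 T := by
  have h0 := h.strictMono (i := 0) (j := i) (by omega) (by omega)
  have h2 := h.strictMono (i := i) (j := N + 1) (by omega) (by omega)
  rw [h.start] at h0
  rw [h.finish] at h2
  simp only [Finset.mem_Icc]
  omega

theorem visit_time_mem (h : IsWalk I R T N P τ) (v : Fin n) : τ v ∈ Finset.Icc 1 T := by
  obtain ⟨i, h1, hi, hP⟩ := h.visit v
  simpa [hP] using h.time_mem h1 hi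

theorem mem_vertices (h : IsWalk I R T N P τ) {i : ℕ} (hi : i ≤ N + 1) :
    P i ∈ timeVertices R T := by
  rw [timeVertices, Finset.mem_union]
  by_cases h0 : i = 0
  · right; simp [h0, h.start]
  by_cases hN : i = N + 1
  · right; simp [hN, h.finish]
  left
  rw [Finset.mem_product]
  refine ⟨?_, h.time_mem (by omega) (by omega)⟩
  rcases h.mem i (by omega) (by omega) with ⟨v, hv⟩ | ⟨r, hr, hv⟩
  · simp [hv]
  · simp [hv, hr]

theorem edge_mem (h : IsWalk I R T N P τ) {i : ℕ} (hi : i ≤ N) :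
    (P i, P (i + 1)) ∈ I.timeEdges R T := by
  rw [Instance.timeEdges, Finset.mem_filter, Finset.mem_product]
  refine ⟨⟨h.mem_vertices (by omega), h.mem_vertices (by omega)⟩, ?_, h.dist i hi⟩
  intro heq
  exact absurd (congrArg Prod.snd heq) (h.lt i hi).ne

end IsWalk

/-! ### Indicator vectors of walks as points of the polytope -/

open Classical in
/-- The visits of a walk. -/
noncomputable def walkVisits (τ : Fin n → ℕ) (p : Site n × ℕ) : ℝ :=
  if ∃ v, p = (.client v, τ v) then 1 else 0

open Classical in
/-- The edges of a walk. -/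
noncomputable def walkFlow (N : ℕ) (P : ℕ → Site n × ℕ) (e : TimeEdge n) : ℝ :=
  if ∃ i ≤ N, e = (P i, P (i + 1)) then 1 else 0

theorem walkVisits_client (τ : Fin n → ℕ) (v : Fin n) (t : ℕ) :
    walkVisits τ (.client v, t) = if t = τ v then 1 else 0 := by
  unfold walkVisits
  congr 1
  simp only [Prod.mk.injEq, Site.client.injEq, eq_iff_iff]
  constructor
  · rintro ⟨w, rfl, h⟩; exact h
  · intro h; exact ⟨v, rfl, h⟩

theorem sum_walkVisits (τ : Fin n → ℕ) (v : Fin n) (S : Finset ℕ) :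
    ∑ t ∈ S, walkVisits τ (.client v, t) = if τ v ∈ S then 1 else 0 := by
  simp only [walkVisits_client, Finset.sum_ite_eq']

theorem walkVisits_nonneg (τ : Fin n → ℕ) (p : Site n × ℕ) :
    0 ≤ walkVisits τ p ∧ walkVisits τ p ≤ 1 := by
  unfold walkVisits; split_ifs <;> norm_num

theorem walkFlow_nonneg (N : ℕ) (P : ℕ → Site n × ℕ) (e : TimeEdge n) :
    0 ≤ walkFlow N P e ∧ walkFlow N P e ≤ 1 := by
  unfold walkFlow; split_ifs <;> norm_num

theorem walkFlow_edge {N : ℕ} (P : ℕ → Site n × ℕ) {i : ℕ} (hi : i ≤ N) :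
    walkFlow N P (P i, P (i + 1)) = 1 := if_pos ⟨i, hi, rfl⟩

namespace IsWalk

variable {I : Instance n} {R : Finset (Fin n)} {T N : ℕ} {P : ℕ → Site n × ℕ} {τ : Fin n → ℕ}

open Classical in
theorem sum_outEdges (h : IsWalk I R T N P τ) (p : Site n × ℕ) :
    ∑ e ∈ I.outEdges R T p, walkFlow N P e = if ∃ i ≤ N, P i = p then 1 else 0 := by
  split_ifs with hp
  · obtain ⟨i, hi, rfl⟩ := hp
    rw [Finset.sum_eq_single (P i, P (i + 1)), walkFlow_edge P hi]
    · intro e he hne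
      refine if_neg ?_
      rintro ⟨j, hj, rfl⟩
      have : j = i := h.inj (by omega) (by omega) (Finset.mem_filter.1 he).2
      subst this
      exact hne rfl
    · intro hnot
      refine absurd ?_ hnot
      exact Finset.mem_filter.2 ⟨h.edge_mem hi, rfl⟩
  · refine Finset.sum_eq_zero fun e he => if_neg ?_
    rintro ⟨j, hj, rfl⟩
    exact hp ⟨j, hj, (Finset.mem_filter.1 he).2⟩

open Classical in
theorem sum_inEdges (h : IsWalk I R T N P τ) (p : Site n × ℕ) :
    ∑ e ∈ I.inEdges R T p, walkFlow N P e = if ∃ i ≤ N, P (i + 1) = p then 1 else 0 := by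
  split_ifs with hp
  · obtain ⟨i, hi, rfl⟩ := hp
    rw [Finset.sum_eq_single (P i, P (i + 1)), walkFlow_edge P hi]
    · intro e he hne
      refine if_neg ?_
      rintro ⟨j, hj, rfl⟩
      have : j + 1 = i + 1 := h.inj (by omega) (by omega) (Finset.mem_filter.1 he).2
      obtain rfl : j = i := by omega
      exact hne rfl
    · intro hnot
      refine absurd ?_ hnot
      exact Finset.mem_filter.2 ⟨h.edge_mem hi, rfl⟩
  · refine Finset.sum_eq_zero fun e he => if_neg ?_
    rintro ⟨j, hj, rfl⟩
    exact hp ⟨j, hj, (Finset.mem_filter.1 he).2⟩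

theorem exists_out_iff (h : IsWalk I R T N P τ) {p : Site n × ℕ} (hs : p.1 ≠ .source) :
    (∃ i ≤ N, P i = p) ↔ ∃ i, 1 ≤ i ∧ i ≤ N ∧ P i = p := by
  constructor
  · rintro ⟨i, hi, rfl⟩
    refine ⟨i, Nat.one_le_iff_ne_zero.2 ?_, hi, rfl⟩
    rintro rfl
    rw [h.start] at hs
    exact hs rfl
  · rintro ⟨i, -, hi, rfl⟩
    exact ⟨i, hi, rfl⟩

theorem exists_in_iff (h : IsWalk I R T N P τ) {p : Site n × ℕ} (ht : p.1 ≠ .target) :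
    (∃ i ≤ N, P (i + 1) = p) ↔ ∃ i, 1 ≤ i ∧ i ≤ N ∧ P i = p := by
  constructor
  · rintro ⟨i, hi, rfl⟩
    refine ⟨i + 1, by omega, ?_, rfl⟩
    rcases hi.lt_or_eq with hlt | rfl
    · exact hlt
    · rw [h.finish] at ht
      exact absurd rfl ht
  · rintro ⟨i, h1, hi, rfl⟩
    exact ⟨i - 1, by omega, by rw [Nat.sub_add_cancel h1]⟩

theorem visits_iff (h : IsWalk I R T N P τ) (v : Fin n) (t : ℕ) :
    (∃ i, 1 ≤ i ∧ i ≤ N ∧ P i = (.client v, t)) ↔ t = τ v := by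
  constructor
  · rintro ⟨i, h1, hi, hP⟩
    exact h.unique i h1 hi v t hP
  · rintro rfl
    exact h.visit v

theorem inPolytope (h : IsWalk I R T N P τ) :
    I.InPolytope R T (walkVisits τ) (walkFlow N P) where
  x_mem p _ := walkVisits_nonneg τ p
  z_mem e _ := walkFlow_nonneg N P e
  visit v := by rw [sum_walkVisits, if_pos (h.visit_time_mem v)]
  flow_out v t _ := by
    classical
    rw [h.sum_outEdges, walkVisits_client]
    simp only [h.exists_out_iff (p := (.client v, t)) (by simp), h.visits_iff]
  flow_in v t _ := by
    classical
    rw [h.sum_inEdges, walkVisits_client]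
    simp only [h.exists_in_iff (p := (.client v, t)) (by simp), h.visits_iff]
  flow_source := by
    classical
    rw [h.sum_outEdges]
    exact if_pos ⟨0, by omega, h.start⟩
  flow_target := by
    classical
    rw [h.sum_inEdges]
    exact if_pos ⟨N, le_rfl, h.finish⟩
  cut S hS v hv t _ := by
    classical
    have hnn : ∀ t' ∈ Finset.Icc 1 t, 0 ≤ ∑ e ∈ I.entering R T S t', walkFlow N P e :=
      fun t' _ => Finset.sum_nonneg fun e _ => (walkFlow_nonneg N P e).1
    rw [sum_walkVisits]
    split_ifs with hτ
    · obtain ⟨i₀, h1, hi₀, hP⟩ := h.visit v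
      have hex : ∃ i, (P i).1 ∈ S := ⟨i₀, by rw [hP]; exact hv⟩
      -- The first vertex of the walk in `S`. The walk enters `S` there, no later than it visits
      -- `v`; it is not the start, since `S` contains no source.
      set i := Nat.find hex with hi
      have hiS : (P i).1 ∈ S := Nat.find_spec hex
      have hile : i ≤ i₀ := Nat.find_min' hex (by rw [hP]; exact hv)
      have hi1 : 1 ≤ i := by
        by_contra h0
        obtain h0 : i = 0 := by omega
        rw [h0, h.start] at hiS
        rcases hS _ hiS with ⟨w, hw⟩ | ⟨r, -, hr⟩
        · cases hw
        · cases hr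
      have hpred : (P (i - 1)).1 ∉ S := Nat.find_min hex (by omega)
      have hle : (P i).2 ≤ τ v := by
        rcases hile.lt_or_eq with hlt | heq
        · have := h.strictMono hlt (by omega)
          rw [hP] at this
          exact this.le
        · rw [heq, hP]
      have hmem := h.time_mem hi1 (by omega)
      have hmem' : (P i).2 ∈ Finset.Icc 1 t := by
        simp only [Finset.mem_Icc] at hmem hτ ⊢
        omega
      refine le_trans ?_ (Finset.single_le_sum hnn hmem')
      have he : (P (i - 1), P (i - 1 + 1)) ∈ I.entering R T S (P i).2 := by
        rw [Instance.entering, Finset.mem_filter]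
        refine ⟨h.edge_mem (by omega), hpred, ?_⟩
        rw [Nat.sub_add_cancel hi1]
        exact ⟨hiS, rfl⟩
      rw [← walkFlow_edge P (N := N) (i := i - 1) (by omega)]
      exact Finset.single_le_sum (fun e _ => (walkFlow_nonneg N P e).1) he
    · exact Finset.sum_nonneg hnn

theorem root_flow (h : IsWalk I R T N P τ) (r : Fin n) (t : ℕ) :
    ∑ e ∈ I.inEdges R T (.root r, t), walkFlow N P e =
      ∑ e ∈ I.outEdges R T (.root r, t), walkFlow N P e := by
  classical
  rw [h.sum_inEdges, h.sum_outEdges]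
  simp only [h.exists_in_iff (p := (.root r, t)) (by simp),
    h.exists_out_iff (p := (.root r, t)) (by simp)]

end IsWalk

/-- A walk that avoids the forbidden edges and visits no pair of clients in the wrong order is a
feasible solution of the linear program. -/
theorem IsWalk.isFeasible {I : Instance n} {G : Triple n} {N : ℕ} {P : ℕ → Site n × ℕ}
    {τ : Fin n → ℕ} (h : IsWalk I G.roots (I.horizon G) N P τ)
    (hforb : ∀ i ≤ N, ¬ G.Forbidden (P i, P (i + 1)))
    (hwithin : ∀ v, τ v < G.t (Fin.last G.q))
    (hord : ∀ (u v : Fin n) (i j : Fin G.q), (j : ℕ) = i + 1 → ¬ I.IsShort u v (G.t j.succ) →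
      τ u ∉ G.tourTimes → τ v ∉ G.tourTimes → τ u < G.t i.succ → τ v < G.t i.succ) :
    I.IsFeasible G (walkVisits τ) (walkFlow N P) where
  mem_polytope := h.inPolytope
  within v t _ ht := by
    rw [walkVisits_client, if_neg]
    have := hwithin v
    omega
  root_flow r _ t _ := h.root_flow r t
  forbidden e _ he := by
    refine if_neg ?_
    rintro ⟨i, hi, rfl⟩
    exact hforb i hi he
  ordering u v i j hij hshort := by
    have hu := h.visit_time_mem u
    have hv := h.visit_time_mem v
    rw [Finset.sum_sub_distrib, Finset.sum_add_distrib]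
    simp only [sum_walkVisits, Finset.mem_inter, hu, hv, true_and]
    have hu1 := (Finset.mem_Icc.1 hu).1
    have hv1 := (Finset.mem_Icc.1 hv).1
    simp only [Finset.mem_Ico, hu1, hv1, true_and]
    have := hord u v i j hij hshort
    -- A visit of `u` or `v` in a tour makes the right side at least `1`. Otherwise the constraint
    -- fails only if `u` is before the threshold and `v` is not, which `hord` excludes.
    split_ifs <;> first | (norm_num; done) | (exfalso; tauto)

theorem IsWalk.lpCost_eq {I : Instance n} {G : Triple n} {N : ℕ} {P : ℕ → Site n × ℕ}
    {τ : Fin n → ℕ} (h : IsWalk I G.roots (I.horizon G) N P τ) :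
    I.lpCost G (walkVisits τ) =
      ∑ v, ∑ i : Fin G.q, if τ v ∈ G.interval i then (G.t i.succ : ℝ) else 0 := by
  unfold Instance.lpCost
  refine Finset.sum_congr rfl fun v _ => Finset.sum_congr rfl fun i _ => ?_
  rw [← Finset.mul_sum, sum_walkVisits]
  simp only [Finset.mem_inter, h.visit_time_mem v, true_and, mul_ite, mul_one, mul_zero]

end DirLat

/-! ## Guesses that meet given targets -/

namespace DirLat

/-- The number of increases that bring the scale `s` to at least `32 B`. -/
noncomputable def skipsTo (s B : ℕ) : ℕ := sInf {i | 32 * B ≤ grow^[i] s}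

theorem grow_iterate_mono (i : ℕ) : Monotone grow^[i] := grow_mono.iterate i

theorem le_of_skipsTo {s B : ℕ} (hs : 32 ≤ s) : 32 * B ≤ grow^[skipsTo s B] s := by
  refine Nat.sInf_mem (s := {i | 32 * B ≤ grow^[i] s}) ⟨32 * B, ?_⟩
  rw [Set.mem_ofPred_eq]
  exact (Nat.le_add_left _ _).trans
    ((add_le_grow_iterate (32 * B)).trans (grow_iterate_mono _ hs))

theorem lt_of_lt_skipsTo {s B i : ℕ} (hi : i < skipsTo s B) : grow^[i] s < 32 * B := by
  have := Nat.notMem_of_lt_sInf hi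
  simpa using this

/-- The scales of the guess with the least thresholds that are at least `32 D 1, 32 D 2, …`. -/
noncomputable def targetScale (D : ℕ → ℕ) : ℕ → ℕ
  | 0 => 32
  | j + 1 =>
    grow^[skipsTo (targetScale D j) (D (j + 1))] (targetScale D j) +
      grow^[skipsTo (targetScale D j) (D (j + 1))] (targetScale D j) / 2

theorem le_targetScale (D : ℕ → ℕ) (j : ℕ) : 32 ≤ targetScale D j := by
  induction j with
  | zero => rfl
  | succ j ih => exact (ih.trans (le_grow_iterate _ _)).trans (Nat.le_add_right _ _)

/-- The number of increases before the threshold of stage `j + 1`. -/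
noncomputable def targetSkips (D : ℕ → ℕ) (j : ℕ) : ℕ := skipsTo (targetScale D j) (D (j + 1))

/-- The factor `3 / 2` between stages only raises the scale further. -/
theorem grow_iterate_sum_le (D : ℕ → ℕ) (j : ℕ) :
    grow^[∑ i ∈ Finset.range j, targetSkips D i] 32 ≤ targetScale D j := by
  induction j with
  | zero => rfl
  | succ j ih =>
    rw [Finset.sum_range_succ, add_comm, Function.iterate_add_apply]
    exact (grow_iterate_mono _ ih).trans (Nat.le_add_right _ _)

/-- All stages share one budget of increases: before the last increase of a stage the scale is below
`32 * B`, yet it dominates the scale that results from all increases so far applied to `32`. -/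
theorem sum_targetSkips_le {D : ℕ → ℕ} {B k : ℕ} (hD : ∀ j < k, D (j + 1) ≤ B) :
    ∑ i ∈ Finset.range k, targetSkips D i ≤ skipCount B := by
  induction k with
  | zero => simp
  | succ k ih =>
    have ih := ih fun j hj => hD j (by omega)
    rw [Finset.sum_range_succ]
    set S := ∑ i ∈ Finset.range k, targetSkips D i with hS
    rcases h : targetSkips D k with _ | m
    · simpa using ih
    · have h1 : grow^[m] (targetScale D k) < 32 * D (k + 1) :=
        lt_of_lt_skipsTo (show m < targetSkips D k by omega)
      have h2 : grow^[S + m] 32 ≤ grow^[m] (targetScale D k) := by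
        rw [add_comm, Function.iterate_add_apply]
        exact grow_iterate_mono _ (grow_iterate_sum_le D k)
      have h3 := hD k (by omega)
      have h4 : S + m < skipCount B := by
        by_contra hcon
        have h5 : grow^[skipCount B] 32 ≤ grow^[S + m] 32 := by
          obtain ⟨r, hr⟩ := Nat.exists_eq_add_of_le (not_lt.1 hcon)
          rw [hr, add_comm, Function.iterate_add_apply]
          exact le_grow_iterate _ _
        have := le_of_skipCount B
        omega
      omega

/-- There are thresholds that meet the targets `32 D 1, 32 D 2, …`, are not much larger than
necessary, and belong to some guess, whatever its tour bits are. -/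
theorem exists_guess_of_targets {n k : ℕ} (I : Instance n) {D : ℕ → ℕ}
    (hpos : ∀ j < k, 0 < D (j + 1)) (hD : ∀ j < k, D (j + 1) ≤ I.reach k) :
    ∃ t : ℕ → ℕ, ∀ b : ℕ → Prop, ∃ g < I.guessCount k, (∀ j ≤ k, threshold g j = t j) ∧
      (∀ j < k, (0 < tourBit g j ↔ b j)) ∧
      ∀ j < k, 32 * D (j + 1) ≤ threshold g (j + 1) ∧
        2 * threshold g (j + 1) ≤ 3 * threshold g j + 66 * D (j + 1) := by
  set t : ℕ → ℕ := fun j => match j with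
    | 0 => 0
    | j + 1 => grow^[targetSkips D j] (targetScale D j) with ht
  refine ⟨t, fun b => ?_⟩
  obtain ⟨g, hg, h⟩ := exists_guess k (targetSkips D) b
  have hscale : ∀ j ≤ k, scale g j = targetScale D j := by
    intro j hj
    induction j with
    | zero => rfl
    | succ j ih =>
      rw [scale, ih (by omega), (h j (by omega)).1]
      rfl
  have hthr : ∀ j ≤ k, threshold g j = t j := by
    intro j hj
    cases j with
    | zero => rfl
    | succ j => rw [threshold, hscale j (by omega), (h j (by omega)).1]
  refine ⟨g, hg.trans_le ?_, hthr, fun j hj => (h j hj).2, fun j hj => ?_⟩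
  · exact Nat.mul_le_mul_right _ (Nat.pow_le_pow_right two_pos (sum_targetSkips_le hD))
  · have hp := hpos j hj
    have e : threshold g (j + 1) = grow^[targetSkips D j] (targetScale D j) := hthr (j + 1) hj
    refine ⟨e ▸ le_of_skipsTo (le_targetScale D j), ?_⟩
    rcases hm : targetSkips D j with _ | m
    -- Without an increase the threshold is the scale: `32 ≤ 33 * D 1` at the start, and at most `3
    -- / 2` of the last threshold later.
    · rw [hm, Function.iterate_zero, id] at e
      rw [← hscale j hj.le] at e
      cases j with
      | zero =>
        rw [scale] at e
        omega
      | succ j =>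
        rw [scale_succ] at e
        omega
    -- Before the last increase the scale was below `32 * D (j + 1)`, so the threshold is below `33
    -- * D (j + 1)`.
    · rw [hm, Function.iterate_succ_apply', grow] at e
      have h1 : grow^[m] (targetScale D j) < 32 * D (j + 1) :=
        lt_of_lt_skipsTo (show m < targetSkips D j by omega)
      omega

/-! ## The stages of a path -/

/-- The number of clients in the first `j` of `k` blocks. -/
def blockEnd (k j : ℕ) : ℕ := 2 ^ k - 2 ^ (k - j)

theorem blockEnd_add {k j : ℕ} (hj : j ≤ k) : blockEnd k j + 2 ^ (k - j) = 2 ^ k :=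
  Nat.sub_add_cancel (Nat.pow_le_pow_right two_pos (by omega))

theorem blockEnd_succ {k j : ℕ} (hj : j < k) :
    blockEnd k (j + 1) = blockEnd k j + 2 ^ (k - (j + 1)) := by
  have h1 := blockEnd_add hj.le
  have h2 := blockEnd_add (Nat.succ_le_of_lt hj)
  have h3 : 2 ^ (k - j) = 2 ^ (k - (j + 1)) * 2 := by rw [← pow_succ]; congr 1; omega
  simp only [Nat.succ_eq_add_one] at h2
  omega

theorem blockEnd_mono {k i j : ℕ} (hij : i ≤ j) : blockEnd k i ≤ blockEnd k j :=
  Nat.sub_le_sub_left (Nat.pow_le_pow_right two_pos (by omega)) _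

theorem blockEnd_strict {k j : ℕ} (hj : j < k) : blockEnd k j < blockEnd k (j + 1) := by
  rw [blockEnd_succ hj]
  exact Nat.lt_add_of_pos_right (by positivity)

theorem blockEnd_zero (k : ℕ) : blockEnd k 0 = 0 := by simp [blockEnd]

/-- In stage `j`, the point `m` is much closer to an earlier point `l` than `l` is to `m`,
where `l` belongs to a stage `i + 1 ≤ j - 2` without a tour. -/
def Bad (c : ℕ → ℕ → ℕ) (t p : ℕ → ℕ) (tour : ℕ → Prop) (j m : ℕ) : Prop :=
  ∃ i, i + 3 ≤ j ∧ ¬ tour (i + 1) ∧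
    ∃ l, p i < l ∧ l ≤ p (i + 1) ∧ max (c m l) (t (i + 2)) < c l m

/-- Stage `j + 1` consists of the points `p j + 1, …, p (j + 1)`. It has a tour if there is a bad
point, and then it ends at the last one. -/
structure IsStaging (c : ℕ → ℕ → ℕ) (t : ℕ → ℕ) (k : ℕ) (p : ℕ → ℕ) (tour : ℕ → Prop) :
    Prop where
  zero : p 0 = 0
  not_tour_zero : ¬ tour 0
  of_tour : ∀ j < k, tour (j + 1) → p j < p (j + 1) ∧ p (j + 1) ≤ blockEnd k (j + 1) ∧
    Bad c t p tour (j + 1) (p (j + 1))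
  of_not_tour : ∀ j < k, ¬ tour (j + 1) → p (j + 1) = blockEnd k (j + 1)
  not_bad : ∀ j < k, ∀ m ≤ blockEnd k (j + 1), p j < m → (tour (j + 1) → p (j + 1) < m) →
    ¬ Bad c t p tour (j + 1) m

/-- Badness in stage `j` depends on earlier stages only, so stages can be chosen one after another.
-/
theorem Bad.congr {c : ℕ → ℕ → ℕ} {t p p' : ℕ → ℕ} {tour tour' : ℕ → Prop} {j m : ℕ}
    (hp : ∀ i < j, p i = p' i) (ht : ∀ i < j, tour i ↔ tour' i) :
    Bad c t p tour j m ↔ Bad c t p' tour' j m := by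
  unfold Bad
  refine exists_congr fun i => and_congr_right fun hi => ?_
  rw [hp i (by omega), hp (i + 1) (by omega), ht (i + 1) (by omega)]

theorem IsStaging.congr {c : ℕ → ℕ → ℕ} {t t' p : ℕ → ℕ} {k : ℕ} {tour : ℕ → Prop}
    (h : IsStaging c t k p tour) (ht : ∀ j ≤ k, t j = t' j) : IsStaging c t' k p tour := by
  have hbad : ∀ j < k, ∀ m, Bad c t p tour (j + 1) m ↔ Bad c t' p tour (j + 1) m := by
    intro j hj m
    unfold Bad
    refine exists_congr fun i => and_congr_right fun hi => ?_
    rw [ht (i + 2) (by omega)]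
  refine ⟨h.zero, h.not_tour_zero, fun j hj => ?_, h.of_not_tour, fun j hj m => ?_⟩
  · rw [← hbad j hj]
    exact h.of_tour j hj
  · rw [← hbad j hj]
    exact h.not_bad j hj m

/-- Greedy recursion: given the earlier stages, the next one ends at the last bad point within its
block bound, or at the block end if there is none. -/
theorem exists_staging (c : ℕ → ℕ → ℕ) (t : ℕ → ℕ) (k : ℕ) :
    ∃ p tour, IsStaging c t k p tour := by
  classical
  suffices h : ∀ N ≤ k, ∃ (p : ℕ → ℕ) (tour : ℕ → Prop), p 0 = 0 ∧ ¬ tour 0 ∧ ∀ j < N,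
      (tour (j + 1) → p j < p (j + 1) ∧ p (j + 1) ≤ blockEnd k (j + 1) ∧
        Bad c t p tour (j + 1) (p (j + 1))) ∧
      (¬ tour (j + 1) → p (j + 1) = blockEnd k (j + 1)) ∧
      ∀ m ≤ blockEnd k (j + 1), p j < m → (tour (j + 1) → p (j + 1) < m) →
        ¬ Bad c t p tour (j + 1) m by
    obtain ⟨p, tour, h0, h0', h⟩ := h k le_rfl
    exact ⟨p, tour, h0, h0', fun j hj => (h j hj).1, fun j hj => (h j hj).2.1,
      fun j hj => (h j hj).2.2⟩
  intro N hN
  induction N with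
  | zero => exact ⟨fun _ => 0, fun _ => False, rfl, id, by simp⟩
  | succ N ih =>
    obtain ⟨p, tour, h0, h0', h⟩ := ih (by omega)
    set B : ℕ → Prop := fun m => p N < m ∧ Bad c t p tour (N + 1) m with hB
    set b : Prop := ∃ m ≤ blockEnd k (N + 1), B m with hb
    set v : ℕ := if b then Nat.findGreatest B (blockEnd k (N + 1)) else blockEnd k (N + 1) with hv
    have hp : ∀ i < N + 1, p i = Function.update p (N + 1) v i := fun i hi =>
      (Function.update_of_ne (by omega) _ _).symm
    have ht : ∀ i < N + 1, tour i ↔ Function.update tour (N + 1) b i := fun i hi => by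
      rw [Function.update_of_ne (by omega)]
    have hbad : ∀ j < N + 1, ∀ m, Bad c t p tour (j + 1) m ↔
        Bad c t (Function.update p (N + 1) v) (Function.update tour (N + 1) b) (j + 1) m :=
      fun j hj m => Bad.congr (fun i hi => hp i (by omega)) fun i hi => ht i (by omega)
    refine ⟨Function.update p (N + 1) v, Function.update tour (N + 1) b, ?_, ?_, ?_⟩
    · rw [← hp 0 (by omega), h0]
    · rw [← ht 0 (by omega)]; exact h0'
    · intro j hj
      rcases Nat.lt_succ_iff_lt_or_eq.1 hj with hlt | rfl
      · rw [← hp j (by omega), ← hp (j + 1) (by omega)]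
        simp only [← hbad j hj, ← ht (j + 1) (by omega)]
        exact h j hlt
      · rw [← hp j (by omega)]
        simp only [← hbad j hj, Function.update_self]
        refine ⟨?_, ?_, ?_⟩
        · intro hb'
          obtain ⟨m, hm, hBm⟩ := hb'
          have hspec := Nat.findGreatest_spec hm hBm
          have hle := Nat.findGreatest_le (P := B) (blockEnd k (j + 1))
          rw [hv, if_pos ⟨m, hm, hBm⟩]
          exact ⟨hspec.1, hle, hspec.2⟩
        · intro hb'
          rw [hv, if_neg hb']
        · intro m hm hlt hlt' hbadm
          by_cases hb' : b
          · have hlt' := hlt' hb'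
            rw [hv, if_pos hb'] at hlt'
            exact Nat.findGreatest_is_greatest hlt' hm ⟨hlt, hbadm⟩
          · exact hb' ⟨m, hm, hlt, hbadm⟩

end DirLat

/-! ## Distances along a path -/

namespace DirLat

variable {n : ℕ}

/-- The distance between two points of a path, given by their numbers. -/
def Instance.wdist (I : Instance n) (π : Equiv.Perm (Fin n)) (l m : ℕ) : ℕ :=
  I.c (waypoint π l) (waypoint π m)

theorem Instance.wdist_add_arrival_le (I : Instance n) (π : Equiv.Perm (Fin n)) {l m : ℕ}
    (h : l ≤ m) : I.wdist π l m + I.arrival π l ≤ I.arrival π m := by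
  induction m, h using Nat.le_induction with
  | base => simp [Instance.wdist, I.c_self]
  | succ m hm ih =>
    have h1 : I.arrival π (m + 1) = I.arrival π m + I.wdist π m (m + 1) :=
      Finset.sum_range_succ _ _
    have h2 : I.wdist π l (m + 1) ≤ I.wdist π l m + I.wdist π m (m + 1) := I.triangle _ _ _
    omega

theorem Instance.arrival_mono (I : Instance n) (π : Equiv.Perm (Fin n)) :
    Monotone (I.arrival π) := fun _ _ h =>
  (Nat.le_add_left _ _).trans (I.wdist_add_arrival_le π h)

theorem waypoint_client (π : Equiv.Perm (Fin n)) {m : ℕ} (h0 : 0 < m) (hm : m ≤ n) :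
    waypoint π m = .client (π ⟨m - 1, by omega⟩) := by
  obtain ⟨m, rfl⟩ := Nat.exists_eq_succ_of_ne_zero h0.ne'
  exact dif_pos (by omega)

theorem locOf_client (v : Fin n) : locOf n v = .client v := dif_pos v.2

open Classical in
/-- The number of clients with a property. -/
noncomputable def clientCount (n : ℕ) (Q : Loc n → Prop) : ℕ :=
  ((Finset.range n).filter fun w => Q (locOf n w)).card

theorem le_clientCount (π : Equiv.Perm (Fin n)) {Q : Loc n → Prop} {a b : ℕ} (hb : b ≤ n)
    (hQ : ∀ m, a < m → m ≤ b → Q (waypoint π m)) : b - a ≤ clientCount n Q := by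
  classical
  rw [← Nat.card_Ioc, clientCount]
  refine Finset.card_le_card_of_injOn
    (fun m => if h : m - 1 < n then (π ⟨m - 1, h⟩ : ℕ) else 0) ?_ ?_
  · intro m hm
    obtain ⟨hm1, hm2⟩ := Finset.mem_Ioc.1 (Finset.mem_coe.1 hm)
    have hlt : m - 1 < n := by omega
    simp only [dif_pos hlt]
    refine Finset.mem_coe.2 (Finset.mem_filter.2 ⟨Finset.mem_range.2 (Fin.is_lt _), ?_⟩)
    rw [locOf_client, ← waypoint_client π (by omega) (by omega)]
    exact hQ m hm1 hm2
  · intro m hm m' hm' heq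
    obtain ⟨hm1, hm2⟩ := Finset.mem_Ioc.1 (Finset.mem_coe.1 hm)
    obtain ⟨hm1', hm2'⟩ := Finset.mem_Ioc.1 (Finset.mem_coe.1 hm')
    have hlt : m - 1 < n := by omega
    have hlt' : m' - 1 < n := by omega
    simp only [dif_pos hlt, dif_pos hlt'] at heq
    have := congrArg Fin.val (π.injective (Fin.ext heq))
    simp only at this
    omega

/-- Pigeonhole: fewer than `b - a` clients lack the property, too few to fill the positions after
`a` up to `b`. -/
theorem exists_of_lt_clientCount (π : Equiv.Perm (Fin n)) {Q : Loc n → Prop} {a b : ℕ}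
    (hb : b ≤ n) (hQ : n < clientCount n Q + (b - a)) :
    ∃ m, a < m ∧ m ≤ b ∧ Q (waypoint π m) := by
  classical
  by_contra! hcon
  have h1 := le_clientCount π (Q := fun x => ¬ Q x) hb fun m hm hm' => hcon m hm hm'
  have h2 := Finset.card_filter_add_card_filter_not (s := Finset.range n)
    (fun w => Q (locOf n w))
  have h3 : clientCount n (fun x => ¬ Q x) =
      ((Finset.range n).filter fun w => ¬ Q (locOf n w)).card := by
    unfold clientCount
    congr
  rw [Finset.card_range] at h2
  rw [h3] at h1
  unfold clientCount at hQ
  omega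

/-! ## Tours and their roots -/

/-- Thresholds that are large enough for the blocks of a path, and the stages of the path. -/
structure IsStaged (I : Instance n) (π : Equiv.Perm (Fin n)) (k : ℕ) (t p : ℕ → ℕ)
    (tour : ℕ → Prop) : Prop where
  card : n + 1 = 2 ^ k
  t_zero : t 0 = 0
  t_strictMono : StrictMono t
  t_gap : ∀ j, 3 * t j ≤ 2 * t (j + 1) + 1
  target : ∀ j < k, 32 * I.arrival π (blockEnd k (j + 1)) ≤ t (j + 1)
  staging : IsStaging (I.wdist π) t k p tour

namespace IsStaged

variable {I : Instance n} {π : Equiv.Perm (Fin n)} {k : ℕ} {t p : ℕ → ℕ} {tour : ℕ → Prop}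

theorem blockEnd_le (h : IsStaged I π k t p tour) (j : ℕ) : blockEnd k j ≤ n := by
  have := h.card
  have : 0 < 2 ^ (k - j) := by positivity
  unfold blockEnd
  omega

theorem arrival_le (h : IsStaged I π k t p tour) {j : ℕ} (hj : j ≤ k) :
    I.arrival π (blockEnd k j) ≤ t j / 32 := by
  cases j with
  | zero => simp [blockEnd_zero, Instance.arrival]
  | succ j =>
    have := h.target j hj
    omega

theorem not_tour_eq (h : IsStaged I π k t p tour) {j : ℕ} (hj : j ≤ k) (ht : ¬ tour j) :
    p j = blockEnd k j := by
  cases j with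
  | zero => rw [h.staging.zero, blockEnd_zero]
  | succ j => exact h.staging.of_not_tour j hj ht

theorem p_le (h : IsStaged I π k t p tour) {j : ℕ} (hj : j ≤ k) : p j ≤ blockEnd k j := by
  cases j with
  | zero => rw [h.staging.zero]; exact Nat.zero_le _
  | succ j =>
    by_cases ht : tour (j + 1)
    · exact (h.staging.of_tour j hj ht).2.1
    · exact (h.staging.of_not_tour j hj ht).le

theorem p_lt (h : IsStaged I π k t p tour) {j : ℕ} (hj : j < k) : p j < p (j + 1) := by
  by_cases ht : tour (j + 1)
  · exact (h.staging.of_tour j hj ht).1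
  · rw [h.staging.of_not_tour j hj ht]
    exact (h.p_le hj.le).trans_lt (blockEnd_strict hj)

theorem p_mono (h : IsStaged I π k t p tour) {i j : ℕ} (hij : i ≤ j) (hj : j ≤ k) :
    p i ≤ p j := by
  induction j, hij using Nat.le_induction with
  | base => rfl
  | succ j hij ih => exact (ih (by omega)).trans (h.p_lt hj).le

/-- Limits the postponement of clients to one stage. Only a tour after another tour is in question:
there, a last bad point inside the preceding block would contradict the choice of the end of the
earlier tour, or be too close for its threshold. -/
theorem lt_p (h : IsStaged I π k t p tour) {j : ℕ} (hj : j < k) : blockEnd k j < p (j + 1) := by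
  by_cases ht : tour (j + 1)
  swap
  · rw [h.staging.of_not_tour j hj ht]
    exact blockEnd_strict hj
  obtain ⟨hlt, -, i, hi, hti, l, hl, hl', hbad⟩ := h.staging.of_tour j hj ht
  by_cases ht' : tour j
  swap
  · rwa [h.not_tour_eq hj.le ht'] at hlt
  by_contra hcon
  obtain ⟨j, rfl⟩ : ∃ j', j = j' + 1 := ⟨j - 1, by omega⟩
  -- If the witness stage is early enough, the point was bad in the earlier tour already, beyond its
  -- end. Otherwise the pair is more than `t (i + 2)` apart, although the path up to the end of this
  -- block has length at most `t (i + 2) / 32`.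
  by_cases hij : i + 3 ≤ j + 1
  · exact h.staging.not_bad j (by omega) (p (j + 1 + 1)) (by omega)
      ((h.p_lt (by omega)).trans hlt) (fun _ => hlt) ⟨i, hij, hti, l, hl, hl', hbad⟩
  · obtain rfl : i + 1 = j := by omega
    have h1 := h.p_lt (j := i + 1) (by omega)
    have h2 := I.wdist_add_arrival_le π (l := l) (m := p (i + 1 + 1 + 1)) (by omega)
    have h3 := I.arrival_mono π (not_lt.1 hcon)
    have h4 := h.arrival_le hj.le
    have h5 : t (i + 2) < I.wdist π l (p (i + 1 + 1 + 1)) := (le_max_right _ _).trans_lt hbad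
    have : t (i + 1 + 1) = t (i + 2) := rfl
    omega

/-- The last block is a single client, so `lt_p` for stage `k` leaves nothing to postpone. -/
theorem p_last (h : IsStaged I π k t p tour) : p k = n := by
  have h1 := h.p_le le_rfl
  have h2 := h.blockEnd_le k
  have h3 := h.card
  rcases Nat.eq_zero_or_pos k with rfl | hk
  · rw [h.staging.zero]
    simp at h3
    exact h3.symm
  · have h4 := h.lt_p (j := k - 1) (by omega)
    rw [Nat.sub_add_cancel hk] at h4
    have h5 : blockEnd k (k - 1) + 2 = 2 ^ k := by
      have := blockEnd_add (k := k) (j := k - 1) (by omega)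
      rwa [show k - (k - 1) = 1 by omega, pow_one] at this
    omega

/-- In a stage with a tour, some early point can be reached cheaply from the last point. -/
theorem exists_return (h : IsStaged I π k t p tour) {j : ℕ} (hj : j < k) (ht : tour (j + 1)) :
    ∃ i l, i + 2 ≤ j ∧ ¬ tour (i + 1) ∧ l ≤ p (i + 1) ∧
      I.wdist π (p (j + 1)) l + I.arrival π l ≤ I.arrival π (p (j + 1)) := by
  obtain ⟨hlt, -, i, hi, hti, l, hl, hl', hbad⟩ := h.staging.of_tour j hj ht
  refine ⟨i, l, by omega, hti, hl', ?_⟩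
  have h1 := h.p_mono (i := i + 1) (j := j) (by omega) hj.le
  have h2 := I.wdist_add_arrival_le π (l := l) (m := p (j + 1)) (by omega)
  -- Badness makes the way back shorter than the way forth, which is at most the length of the path
  -- in between.
  have h3 : I.wdist π (p (j + 1)) l < I.wdist π l (p (j + 1)) := (le_max_left _ _).trans_lt hbad
  omega

theorem arrival_p_le (h : IsStaged I π k t p tour) {j : ℕ} (hj : j ≤ k) :
    I.arrival π (p j) ≤ t j / 32 :=
  (I.arrival_mono π (h.p_le hj)).trans (h.arrival_le hj)

/-- In a stage with a tour, one can go back within the preceding block. -/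
theorem wdist_back_le (h : IsStaged I π k t p tour) {j : ℕ} (hj : j < k) (ht : tour (j + 1))
    {w l : ℕ} (hw : blockEnd k (j - 1) < w) (hwl : w ≤ l) (hl : l ≤ blockEnd k j) :
    I.wdist π l w ≤ 2 * (t (j + 1) / 32) := by
  obtain ⟨i, u, hi, -, hu, hret⟩ := h.exists_return hj ht
  have h1 := h.p_le (j := i + 1) (by omega)
  have h2 := blockEnd_mono (k := k) (i := i + 1) (j := j - 1) (by omega)
  have h3 := h.lt_p hj
  have h4 := I.wdist_add_arrival_le π (l := l) (m := p (j + 1)) (by omega)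
  have h5 := I.wdist_add_arrival_le π (l := u) (m := w) (by omega)
  -- The route follows the path from `l` to the last bad point, jumps back to the early point `u`,
  -- and follows the path to `w`, which comes after `u`. It uses the path up to the bad point at
  -- most twice.
  have h6 : I.wdist π l w ≤ I.wdist π l (p (j + 1)) + I.wdist π (p (j + 1)) w := I.triangle _ _ _
  have h7 : I.wdist π (p (j + 1)) w ≤ I.wdist π (p (j + 1)) u + I.wdist π u w := I.triangle _ _ _
  have h8 := h.arrival_p_le (j := j + 1) hj
  have h9 := I.arrival_mono π hwl
  omega

theorem two_le_of_tour (h : IsStaged I π k t p tour) {j : ℕ} (hj : j < k) (ht : tour (j + 1)) :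
    2 ≤ j := by
  obtain ⟨i, u, hi, -⟩ := h.exists_return hj ht
  omega

/-- With `h = 2 ^ (k - j)`: block `j` has `h` clients, and all but `h - 1` clients belong to blocks
up to `j`. These are the counts behind `IsCentral`. -/
theorem blockEnd_pred (h : IsStaged I π k t p tour) {j : ℕ} (hj : j < k) (ht : tour (j + 1)) :
    blockEnd k j = blockEnd k (j - 1) + 2 ^ (k - j) ∧ blockEnd k j + 2 ^ (k - j) = n + 1 := by
  have h2 := h.two_le_of_tour hj ht
  have h3 := blockEnd_succ (k := k) (j := j - 1) (by omega)
  rw [show j - 1 + 1 = j by omega] at h3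
  exact ⟨h3, by rw [h.card, blockEnd_add hj.le]⟩

theorem ballIn_eq (d : ℕ) (v : Fin n) :
    ballIn I.cost n d v = clientCount n fun x => I.c x (.client v) ≤ d := by
  simp only [ballIn, clientCount, Instance.cost, locOf_client]

theorem ballOut_eq (d : ℕ) (v : Fin n) :
    ballOut I.cost n d v = clientCount n fun x => I.c (.client v) x ≤ d := by
  simp only [ballOut, clientCount, Instance.cost, locOf_client]

/-- The last client of block `j` is central: all clients up to it reach it along the path, and the
tour allows a return to every client of its block. -/
theorem exists_central (h : IsStaged I π k t p tour) {j : ℕ} (hj : j < k) (ht : tour (j + 1)) :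
    ∃ r < n, IsCentral I.cost n (t (j + 1) / 32) (2 ^ (k - j)) r := by
  obtain ⟨e1, e2⟩ := h.blockEnd_pred hj ht
  have hpos : 0 < 2 ^ (k - j) := by positivity
  have hle := h.blockEnd_le j
  have hw := waypoint_client π (m := blockEnd k j) (by omega) hle
  set v := π ⟨blockEnd k j - 1, by omega⟩ with hv
  refine ⟨v, v.2, ?_, ?_⟩
  · rw [ballIn_eq, ← hw]
    have := le_clientCount π (Q := fun x => I.c x (waypoint π (blockEnd k j)) ≤ t (j + 1) / 32)
      (a := 0) hle ?_
    · omega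
    · intro m _ hm
      have h1 := I.wdist_add_arrival_le π hm
      have h2 := h.arrival_le hj.le
      have h3 := (h.t_strictMono (Nat.lt_succ_self j)).le
      have h4 : t j / 32 ≤ t (j + 1) / 32 := Nat.div_le_div_right h3
      unfold Instance.wdist at h1
      omega
  · rw [ballOut_eq, ← hw]
    have := le_clientCount π
      (Q := fun x => I.c (waypoint π (blockEnd k j)) x ≤ 2 * (t (j + 1) / 32))
      (a := blockEnd k (j - 1)) hle ?_
    · omega
    · intro m hm hm'
      exact h.wdist_back_le hj ht hm hm' le_rfl

end IsStaged

/-! ### Detours between a tour and its root -/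

/-- Stages together with roots: `r j` is the root for stage `j + 1`. -/
structure IsPlan (I : Instance n) (π : Equiv.Perm (Fin n)) (k : ℕ) (t p : ℕ → ℕ)
    (tour : ℕ → Prop) (r : ℕ → Fin n) : Prop extends IsStaged I π k t p tour where
  central : ∀ j < k, tour (j + 1) → ¬ tour j →
    IsCentral I.cost n (t (j + 1) / 32) (2 ^ (k - j)) (r j)
  root_eq : ∀ j < k, tour (j + 1) → tour j → r j = r (j - 1)

namespace IsPlan

variable {I : Instance n} {π : Equiv.Perm (Fin n)} {k : ℕ} {t p : ℕ → ℕ} {tour : ℕ → Prop}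
  {r : ℕ → Fin n}

/-- A sequence of consecutive tours has a common root, which is close to and from the block before
the first of them. -/
theorem exists_first (h : IsPlan I π k t p tour r) {j : ℕ} (hj : j < k) (ht : tour (j + 1)) :
    ∃ j₀ ≤ j, (∀ i, j₀ ≤ i → i ≤ j → tour (i + 1)) ∧ ¬ tour j₀ ∧
      (∃ w, blockEnd k (j₀ - 1) < w ∧ w ≤ blockEnd k j₀ ∧
        I.c (waypoint π w) (.client (r j)) ≤ t (j₀ + 1) / 32) ∧
      ∃ w ≤ blockEnd k j₀, I.c (.client (r j)) (waypoint π w) ≤ 2 * (t (j₀ + 1) / 32) := by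
  induction j with
  | zero => exact absurd (h.two_le_of_tour hj ht) (by omega)
  | succ j ih =>
    by_cases ht' : tour (j + 1)
    · obtain ⟨j₀, hj₀, h1, h2, h3, h4⟩ := ih (by omega) ht'
      have e : r (j + 1) = r j := h.root_eq (j + 1) hj ht ht'
      rw [e]
      refine ⟨j₀, by omega, fun i hi hi' => ?_, h2, h3, h4⟩
      rcases Nat.lt_succ_iff_lt_or_eq.1 (Nat.lt_succ_of_le hi') with hlt | rfl
      · exact h1 i hi (by omega)
      · exact ht
    · obtain ⟨e1, e2⟩ := h.blockEnd_pred hj ht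
      obtain ⟨c1, c2⟩ := h.central (j + 1) hj ht ht'
      rw [IsStaged.ballIn_eq] at c1
      rw [IsStaged.ballOut_eq] at c2
      refine ⟨j + 1, le_rfl, fun i hi hi' => ?_, ht', ?_, ?_⟩
      · obtain rfl : i = j + 1 := by omega
        exact ht
      -- Fewer than `h` clients are far from the root, and the block has `h` clients.
      · exact exists_of_lt_clientCount π (a := blockEnd k (j + 1 - 1)) (b := blockEnd k (j + 1))
          (h.blockEnd_le _) (Q := fun x => I.c x (.client (r (j + 1))) ≤ t (j + 1 + 1) / 32)
          (by omega)
      -- At least `h` clients are close from the root, and only `h - 1` come after the block.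
      · obtain ⟨w, -, hw, hw'⟩ := exists_of_lt_clientCount π (a := 0) (b := blockEnd k (j + 1))
          (h.blockEnd_le _) (Q := fun x => I.c (.client (r (j + 1))) x ≤
            2 * (t (j + 1 + 1) / 32)) (by omega)
        exact ⟨w, hw, hw'⟩

theorem scale_mono (h : IsPlan I π k t p tour r) {i j : ℕ} (hij : i ≤ j) :
    t i / 32 ≤ t j / 32 := Nat.div_le_div_right (h.t_strictMono.monotone hij)

/-- From the last point of a tour to the root. -/
theorem last_root_le (h : IsPlan I π k t p tour r) {j : ℕ} (hj : j < k) (ht : tour (j + 1)) :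
    I.c (waypoint π (p (j + 1))) (.client (r j)) ≤ 4 * (t (j + 1) / 32) := by
  obtain ⟨j₀, hj₀, htours, hnot, ⟨w, hw, hw', hwr⟩, -⟩ := h.exists_first hj ht
  obtain ⟨i, u, hi, hti, hu, hret⟩ := h.exists_return hj ht
  -- The way back leads to a stage without a tour, hence to before the whole sequence of tours.
  have hij : i + 1 ≤ j₀ := by
    by_contra hcon
    exact hti (htours i (by omega) (by omega))
  have hu' : u ≤ blockEnd k j₀ :=
    hu.trans ((h.p_le (by omega)).trans (blockEnd_mono hij))
  have h1 := h.arrival_p_le (j := j + 1) hj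
  have h2 := h.scale_mono (i := j₀ + 1) (j := j + 1) (by omega)
  -- The point `u` may lie on either side of `w`: follow the path forward, or go back within the
  -- block. In all, the bounds are one unit to `u`, two to `w`, and one to the root.
  have h3 : I.wdist π u w ≤ 2 * (t (j₀ + 1) / 32) := by
    rcases le_or_gt u w with huw | huw
    · have h4 := I.wdist_add_arrival_le π huw
      have h5 := I.arrival_mono π hw'
      have h6 := h.arrival_le (j := j₀) (by omega)
      have h7 := h.scale_mono (i := j₀) (j := j₀ + 1) (by omega)
      omega
    · exact h.wdist_back_le (by omega) (htours j₀ le_rfl hj₀) hw huw.le hu'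
  have h4 := I.triangle (waypoint π (p (j + 1))) (waypoint π u) (.client (r j))
  have h5 := I.triangle (waypoint π u) (waypoint π w) (.client (r j))
  unfold Instance.wdist at h3 hret
  omega

/-- From the root of a tour to the points of this stage and later ones. -/
theorem root_le (h : IsPlan I π k t p tour r) {j : ℕ} (hj : j < k) (ht : tour (j + 1)) {m : ℕ}
    (hm : p j < m) :
    I.c (.client (r j)) (waypoint π m) ≤ 2 * (t (j + 1) / 32) + I.arrival π m := by
  obtain ⟨j₀, hj₀, htours, hnot, -, w, hw, hwr⟩ := h.exists_first hj ht
  have h1 := h.p_mono hj₀ hj.le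
  rw [h.not_tour_eq (by omega) hnot] at h1
  have h2 := I.wdist_add_arrival_le π (l := w) (m := m) (by omega)
  have h3 := h.scale_mono (i := j₀ + 1) (j := j + 1) (by omega)
  have h4 := I.triangle (.client (r j)) (waypoint π w) (waypoint π m)
  unfold Instance.wdist at h2
  omega

/-- From the last point before a tour to its root. -/
theorem enter_le (h : IsPlan I π k t p tour r) {j : ℕ} (hj : j < k) (ht : tour (j + 1))
    (ht' : ¬ tour j) : I.c (waypoint π (p j)) (.client (r j)) ≤ 3 * (t (j + 1) / 32) := by
  obtain ⟨j₀, hj₀, htours, hnot, ⟨w, hw, hw', hwr⟩, -⟩ := h.exists_first hj ht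
  obtain rfl : j₀ = j := by
    by_contra hne
    refine ht' ?_
    have := htours (j - 1) (by omega) (by omega)
    rwa [Nat.sub_add_cancel (by omega)] at this
  rw [h.not_tour_eq hj.le ht']
  have h1 := h.wdist_back_le hj ht hw hw' le_rfl
  have h2 := I.triangle (waypoint π (blockEnd k j₀)) (waypoint π w) (.client (r j₀))
  unfold Instance.wdist at h1
  omega

end IsPlan

end DirLat

/-! ## The walk of a plan -/

namespace DirLat

variable {n : ℕ}

theorem not_forbidden_ofSeq {k : ℕ} {t : ℕ → ℕ} {A : ℕ → Prop} [DecidablePred A] {r : ℕ → Fin n}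
    {x y : Site n × ℕ}
    (h : ∀ i < k, A i → (x.2 < t i → t i ≤ y.2 → y.1 = .root (r i)) ∧
      (x.2 < t (i + 1) → t (i + 1) ≤ y.2 → x.1 = .root (r i))) :
    ¬ (Triple.ofSeq k t A r).Forbidden (x, y) := by
  rintro ⟨⟨i, hi⟩, hor⟩
  have hA : A i := (Finset.mem_filter.1 hi).2
  obtain ⟨h1, h2⟩ := h i i.2 hA
  rcases hor with ⟨a, b, c⟩ | ⟨a, b, c⟩
  · exact c (h1 a b)
  · exact c (h2 a b)

/-- An edge of the time-indexed graph that is not forbidden, on which time increases. -/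
def IsStep (I : Instance n) (G : Triple n) (x y : Site n × ℕ) : Prop :=
  x.2 < y.2 ∧ x.2 + I.c x.1.loc y.1.loc ≤ y.2 ∧ ¬ G.Forbidden (x, y)

/-- The points of a path as points of the time-indexed graph. -/
def wsite (π : Equiv.Perm (Fin n)) : ℕ → Site n
  | 0 => .source
  | j + 1 => if h : j < n then .client (π ⟨j, h⟩) else .target

theorem Site.loc_root (v : Fin n) : (Site.root v).loc = .client v := rfl

theorem Site.loc_source : (Site.source : Site n).loc = .source := rfl

theorem wsite_loc (π : Equiv.Perm (Fin n)) (m : ℕ) : (wsite π m).loc = waypoint π m := by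
  cases m with
  | zero => rfl
  | succ m => simp only [wsite, waypoint]; split_ifs <;> rfl

theorem wsite_client (π : Equiv.Perm (Fin n)) {m : ℕ} (h0 : 0 < m) (hm : m ≤ n) :
    wsite π m = .client (π ⟨m - 1, by omega⟩) := by
  obtain ⟨m, rfl⟩ := Nat.exists_eq_succ_of_ne_zero h0.ne'
  exact dif_pos (by omega)

theorem waypoint_ne_succ (π : Equiv.Perm (Fin n)) {m : ℕ} (hm : m < n) :
    waypoint π m ≠ waypoint π (m + 1) := by
  rw [waypoint_client π (Nat.succ_pos m) hm]
  rcases Nat.eq_zero_or_pos m with rfl | h0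
  · simp [waypoint]
  · rw [waypoint_client π h0 hm.le]
    intro heq
    have := congrArg Fin.val (π.injective (Loc.client.inj heq))
    simp only at this
    omega

theorem Instance.arrival_lt (I : Instance n) (π : Equiv.Perm (Fin n))
    (hpos : ∀ u v, u ≠ v → 0 < I.c u v) {m : ℕ} (hm : m < n) :
    I.arrival π m < I.arrival π (m + 1) := by
  have h1 : I.arrival π (m + 1) = I.arrival π m + I.c (waypoint π m) (waypoint π (m + 1)) :=
    Finset.sum_range_succ _ _
  have := hpos _ _ (waypoint_ne_succ π hm)
  omega

/-! ### The timetable of the walk and its admissibility -/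

namespace IsPlan

variable {I : Instance n} {π : Equiv.Perm (Fin n)} {k : ℕ} {t p : ℕ → ℕ} {tour : ℕ → Prop}
  {r : ℕ → Fin n}

/-- The time of the visit to point `m` in stage `j + 1`. -/
def clientTime (I : Instance n) (π : Equiv.Perm (Fin n)) (t : ℕ → ℕ) (j m : ℕ) : ℕ :=
  t j + 5 * (t (j + 1) / 32) + I.arrival π m

/-- The visits to clients in stage `j + 1`. -/
def clientItems (I : Instance n) (π : Equiv.Perm (Fin n)) (t p : ℕ → ℕ) (j : ℕ) :
    List (Site n × ℕ) :=
  (List.range' (p j + 1) (p (j + 1) - p j)).map fun m => (wsite π m, clientTime I π t j m)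

open Classical in
/-- The part of the walk in stage `j + 1`. -/
noncomputable def stageItems (I : Instance n) (π : Equiv.Perm (Fin n)) (t p : ℕ → ℕ)
    (tour : ℕ → Prop) (r : ℕ → Fin n) (j : ℕ) : List (Site n × ℕ) :=
  if tour (j + 1) then
    (.root (r j), t j + 3 * (t (j + 1) / 32)) ::
      (clientItems I π t p j ++ [(.root (r j), t j + 10 * (t (j + 1) / 32))])
  else clientItems I π t p j

/-- The part of the walk in the first `j` stages. -/
noncomputable def walkItems (I : Instance n) (π : Equiv.Perm (Fin n)) (t p : ℕ → ℕ)
    (tour : ℕ → Prop) (r : ℕ → Fin n) : ℕ → List (Site n × ℕ)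
  | 0 => [(.source, 0)]
  | j + 1 => walkItems I π t p tour r j ++ stageItems I π t p tour r j

open Classical in
/-- The last vertex of the walk in the first `j` stages. -/
noncomputable def lastItem (I : Instance n) (π : Equiv.Perm (Fin n)) (t p : ℕ → ℕ)
    (tour : ℕ → Prop) (r : ℕ → Fin n) : ℕ → Site n × ℕ
  | 0 => (.source, 0)
  | j + 1 => if tour (j + 1) then (.root (r j), t j + 10 * (t (j + 1) / 32))
    else (wsite π (p (j + 1)), clientTime I π t j (p (j + 1)))

/-- The unit of the timetable is `d = t (j + 1) / 32`. Growth by `3 / 2` leaves about `32 / 3` units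
in an interval, more than the `10` needed: arrival at the root by `3`, clients from `5` to `6`, back
at the root by `10`. Positive distances yield `d > 0`, which covers the rounding. -/
theorem gap (h : IsPlan I π k t p tour r) (hpos : ∀ u v, u ≠ v → 0 < I.c u v) {j : ℕ}
    (hj : j < k) : 0 < t (j + 1) / 32 ∧ t j + 10 * (t (j + 1) / 32) < t (j + 1) := by
  have h1 := h.target j hj
  have h2 := blockEnd_strict hj
  have h3 := h.blockEnd_le (j + 1)
  have h4 := I.arrival_lt π hpos (m := 0) (by omega)
  have h5 := I.arrival_mono π (show 0 + 1 ≤ blockEnd k (j + 1) by omega)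
  have h6 := h.t_gap j
  omega

theorem clientTime_lt (h : IsPlan I π k t p tour r) {j m : ℕ}
    (hj : j < k) (hm : m ≤ p (j + 1)) :
    t j ≤ clientTime I π t j m ∧ clientTime I π t j m ≤ t j + 6 * (t (j + 1) / 32) := by
  have h1 := h.arrival_p_le (j := j + 1) hj
  have h2 := I.arrival_mono π hm
  unfold clientTime
  omega

theorem lastItem_time (h : IsPlan I π k t p tour r) (hpos : ∀ u v, u ≠ v → 0 < I.c u v) {j : ℕ}
    (hj : j < k) : t j ≤ (lastItem I π t p tour r (j + 1)).2 ∧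
      (lastItem I π t p tour r (j + 1)).2 < t (j + 1) := by
  have h1 := h.gap hpos hj
  have h2 := h.clientTime_lt hj le_rfl
  rw [lastItem]
  split_ifs
  · simp only
    omega
  · simp only
    omega

theorem lt_of_t_lt (h : IsPlan I π k t p tour r) {i j : ℕ} (hij : t i < t j) : i < j :=
  h.t_strictMono.lt_iff_lt.1 hij

/-- Within a stage no edge is forbidden. -/
theorem not_forbidden_within (h : IsPlan I π k t p tour r) {A : ℕ → Prop} [DecidablePred A]
    {j : ℕ} {x y : Site n × ℕ} (hx : t j ≤ x.2) (hy : y.2 < t (j + 1)) :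
    ¬ (Triple.ofSeq k t A r).Forbidden (x, y) := by
  refine not_forbidden_ofSeq fun i _ _ => ⟨fun h1 h2 => ?_, fun h1 h2 => ?_⟩
  · have := h.lt_of_t_lt (hx.trans_lt h1)
    have := h.lt_of_t_lt (h2.trans_lt hy)
    omega
  · have := h.lt_of_t_lt (hx.trans_lt h1)
    have := h.lt_of_t_lt (h2.trans_lt hy)
    omega

theorem isChain_clientItems (h : IsPlan I π k t p tour r) (hpos : ∀ u v, u ≠ v → 0 < I.c u v)
    {A : ℕ → Prop} [DecidablePred A] {j : ℕ} (hj : j < k) :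
    (clientItems I π t p j).IsChain (IsStep I (Triple.ofSeq k t A r)) := by
  rw [List.isChain_iff_getElem]
  intro i hi
  simp only [clientItems, List.length_map, List.length_range'] at hi
  simp only [clientItems, List.getElem_map, List.getElem_range', one_mul]
  have hn := (h.p_le (j := j + 1) hj).trans (h.blockEnd_le _)
  have h1 := I.arrival_lt π hpos (m := p j + 1 + i) (by omega)
  have h2 := I.wdist_add_arrival_le π (Nat.le_succ (p j + 1 + i))
  refine ⟨?_, ?_, h.not_forbidden_within (j := j) ?_ ?_⟩
  · simp only [clientTime]
    rw [← add_assoc (p j + 1)]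
    omega
  · simp only [wsite_loc, clientTime]
    rw [← add_assoc (p j + 1)]
    unfold Instance.wdist at h2
    simp only [Nat.succ_eq_add_one] at h2
    omega
  · exact (h.clientTime_lt hj (by omega)).1
  · have h3 := (h.clientTime_lt hj (m := p j + 1 + (i + 1)) (by omega)).2
    have h4 := h.gap hpos hj
    simp only
    omega

theorem head?_clientItems (h : IsPlan I π k t p tour r) {j : ℕ} (hj : j < k) :
    (clientItems I π t p j).head? = some (wsite π (p j + 1), clientTime I π t j (p j + 1)) := by
  have := h.p_lt hj
  rw [clientItems, List.head?_map, List.head?_range', if_neg (by omega)]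
  rfl

theorem getLast?_clientItems (h : IsPlan I π k t p tour r) {j : ℕ} (hj : j < k) :
    (clientItems I π t p j).getLast? =
      some (wsite π (p (j + 1)), clientTime I π t j (p (j + 1))) := by
  have := h.p_lt hj
  rw [clientItems, List.getLast?_map, List.getLast?_range', if_neg (by omega)]
  rw [show p j + 1 + (p (j + 1) - p j) - 1 = p (j + 1) by omega]
  rfl

theorem isChain_stageItems (h : IsPlan I π k t p tour r) (hpos : ∀ u v, u ≠ v → 0 < I.c u v)
    {A : ℕ → Prop} [DecidablePred A] {j : ℕ} (hj : j < k) :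
    (stageItems I π t p tour r j).IsChain (IsStep I (Triple.ofSeq k t A r)) := by
  unfold stageItems
  have hg := h.gap hpos hj
  have hlt := h.p_lt hj
  split_ifs with ht
  swap
  · exact h.isChain_clientItems hpos hj
  rw [List.isChain_cons, List.isChain_append]
  refine ⟨?_, h.isChain_clientItems hpos hj, List.isChain_singleton _, ?_⟩
  · intro y hy
    rw [List.head?_append, h.head?_clientItems hj] at hy
    obtain rfl : _ = y := Option.some.inj hy
    have h1 := h.clientTime_lt hj (m := p j + 1) (by omega)
    -- The two units between the times `3 d` and `5 d` pay for the way from the root to the path;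
    -- the arrival time pays for the rest.
    have h2 := h.root_le hj ht (Nat.lt_succ_self (p j))
    refine ⟨?_, ?_, h.not_forbidden_within (j := j) ?_ ?_⟩
    · simp only [clientTime]
      omega
    · simp only [Site.loc_root, wsite_loc, clientTime]
      simp only [Nat.succ_eq_add_one] at h2
      omega
    · exact Nat.le_add_right _ _
    · simp only
      omega
  · intro x hx y hy
    rw [h.getLast?_clientItems hj] at hx
    obtain rfl : _ = x := Option.some.inj hx
    obtain rfl : _ = y := Option.some.inj hy
    have h1 := h.clientTime_lt hj (m := p (j + 1)) le_rfl
    -- The last client is visited by `6 d`, and the root is at most `4 d` away.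
    have h2 := h.last_root_le hj ht
    refine ⟨?_, ?_, h.not_forbidden_within (j := j) h1.1 hg.2⟩
    · simp only
      omega
    · simp only [Site.loc_root, wsite_loc]
      omega

theorem getLast?_walkItems (h : IsPlan I π k t p tour r) {j : ℕ} (hj : j ≤ k) :
    (walkItems I π t p tour r j).getLast? = some (lastItem I π t p tour r j) := by
  cases j with
  | zero => rfl
  | succ j =>
    rw [walkItems, List.getLast?_append, lastItem, stageItems]
    split_ifs
    · rw [← List.cons_append, List.getLast?_concat]
      rfl
    · rw [h.getLast?_clientItems hj]
      rfl

/-- The edge from one stage to the next. -/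
theorem isStep_boundary (h : IsPlan I π k t p tour r) (hpos : ∀ u v, u ≠ v → 0 < I.c u v)
    {A : ℕ → Prop} [DecidablePred A] (hA : ∀ j < k, A j ↔ tour (j + 1)) {j : ℕ} (hj : j < k)
    {y : Site n × ℕ} (hy : (stageItems I π t p tour r j).head? = some y) :
    IsStep I (Triple.ofSeq k t A r) (lastItem I π t p tour r j) y := by
  have hg := h.gap hpos hj
  have hlt := h.p_lt hj
  have hct := h.clientTime_lt hj (m := p j + 1) (by omega)
  have hyt : t j < y.2 ∧ y.2 < t (j + 1) := by
    unfold stageItems at hy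
    split_ifs at hy with ht
    · obtain rfl : _ = y := Option.some.inj hy
      simp only
      omega
    · rw [h.head?_clientItems hj] at hy
      obtain rfl : _ = y := Option.some.inj hy
      simp only [clientTime] at hct ⊢
      omega
  rcases j with _ | j
  · have ht : ¬ tour (0 + 1) := fun ht => absurd (h.two_le_of_tour hj ht) (by omega)
    rw [h.t_zero] at hyt
    refine ⟨hyt.1, ?_, h.not_forbidden_within (j := 0) (by simp [h.t_zero]) hyt.2⟩
    rw [stageItems, if_neg ht, h.head?_clientItems hj] at hy
    obtain rfl : _ = y := Option.some.inj hy
    have h1 := I.wdist_add_arrival_le π (Nat.zero_le (p 0 + 1))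
    simp only [lastItem, Site.loc_source, wsite_loc, clientTime]
    unfold Instance.wdist at h1
    change I.c .source _ + _ ≤ _ at h1
    omega
  · have hx := h.lastItem_time hpos (j := j) (by omega)
    have hmono := h.scale_mono (Nat.le_succ (j + 1))
    simp only [Nat.succ_eq_add_one] at hmono
    refine ⟨by omega, ?_, not_forbidden_ofSeq fun i hi hAi => ⟨fun h1 h2 => ?_, fun h1 h2 => ?_⟩⟩
    · have hroot : ∀ {z : Site n × ℕ}, lastItem I π t p tour r (j + 1) = z → z.2 < t (j + 1) :=
        fun hz => hz ▸ hx.2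
      -- Either side of the threshold is a root or a client. Between two tours the root is the same,
      -- so the distance is `0`; two clients are consecutive on the path.
      by_cases ht : tour (j + 1 + 1) <;> by_cases ht' : tour (j + 1)
      · rw [stageItems, if_pos ht] at hy
        obtain rfl : _ = y := Option.some.inj hy
        have h1 := h.root_eq (j + 1) hj ht ht'
        have h2 := hroot (if_pos ht')
        rw [lastItem, if_pos ht']
        simp only [Site.loc_root, h1, Nat.add_sub_cancel, I.c_self] at h2 ⊢
        omega
      · rw [stageItems, if_pos ht] at hy
        obtain rfl : _ = y := Option.some.inj hy
        have h1 := h.enter_le hj ht ht'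
        have h2 := hroot (if_neg ht')
        rw [lastItem, if_neg ht']
        simp only [Site.loc_root, wsite_loc] at h2 ⊢
        omega
      · rw [stageItems, if_neg ht, h.head?_clientItems hj] at hy
        obtain rfl : _ = y := Option.some.inj hy
        have h1 := h.root_le (j := j) (by omega) ht' (m := p (j + 1) + 1)
          ((h.p_lt (by omega)).trans (Nat.lt_succ_self _))
        have h2 := hroot (if_pos ht')
        rw [lastItem, if_pos ht']
        simp only [Site.loc_root, wsite_loc, clientTime] at h2 ⊢
        omega
      · rw [stageItems, if_neg ht, h.head?_clientItems hj] at hy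
        obtain rfl : _ = y := Option.some.inj hy
        have h1 := I.wdist_add_arrival_le π (Nat.le_succ (p (j + 1)))
        have h2 := hroot (if_neg ht')
        rw [lastItem, if_neg ht']
        unfold Instance.wdist at h1
        simp only [Nat.succ_eq_add_one] at h1
        simp only [wsite_loc] at h2 ⊢
        simp only [clientTime] at h2 ⊢
        omega
    -- Only the threshold `t (j + 1)` lies between the two times. A tour-interval starting there is
    -- entered at its root; the next case treats one ending there.
    · have h3 := h.lt_of_t_lt (hx.1.trans_lt h1)
      have h4 := h.lt_of_t_lt (h2.trans_lt hyt.2)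
      obtain rfl : i = j + 1 := by omega
      rw [stageItems, if_pos ((hA _ hi).1 hAi)] at hy
      obtain rfl : _ = y := Option.some.inj hy
      rfl
    · have h3 := h.lt_of_t_lt (hx.1.trans_lt h1)
      have h4 := h.lt_of_t_lt (h2.trans_lt hyt.2)
      obtain rfl : i = j := by omega
      rw [lastItem, if_pos ((hA _ hi).1 hAi)]

theorem isChain_walkItems (h : IsPlan I π k t p tour r) (hpos : ∀ u v, u ≠ v → 0 < I.c u v)
    {A : ℕ → Prop} [DecidablePred A] (hA : ∀ j < k, A j ↔ tour (j + 1)) {j : ℕ} (hj : j ≤ k) :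
    (walkItems I π t p tour r j).IsChain (IsStep I (Triple.ofSeq k t A r)) := by
  induction j with
  | zero => exact List.isChain_singleton _
  | succ j ih =>
    rw [walkItems, List.isChain_append]
    refine ⟨ih (by omega), h.isChain_stageItems hpos hj, fun x hx y hy => ?_⟩
    rw [h.getLast?_walkItems (by omega)] at hx
    obtain rfl : _ = x := Option.some.inj hx
    exact h.isStep_boundary hpos hA hj hy

/-- The edge to the target. -/
theorem isStep_target (h : IsPlan I π k t p tour r) (hpos : ∀ u v, u ≠ v → 0 < I.c u v)
    {A : ℕ → Prop} [DecidablePred A] (hA : ∀ j < k, A j ↔ tour (j + 1)) (hn : 0 < n) :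
    IsStep I (Triple.ofSeq k t A r) (lastItem I π t p tour r k)
      (.target, I.horizon (Triple.ofSeq k t A r) + 1) := by
  have hk : 0 < k := by
    rcases Nat.eq_zero_or_pos k with rfl | hk
    · have := h.card
      simp at this
      omega
    · exact hk
  obtain ⟨k, rfl⟩ := Nat.exists_eq_succ_of_ne_zero hk.ne'
  have hx := h.lastItem_time hpos (Nat.lt_succ_self k)
  have hmax : ∀ u v, I.c u v ≤ I.maxCost := fun u v =>
    (Finset.le_sup (f := fun v => I.c u v) (Finset.mem_univ v)).trans
      (Finset.le_sup (f := fun u => Finset.univ.sup fun v => I.c u v) (Finset.mem_univ u))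
  -- As `n ^ 2 ≥ 1`, the horizon leaves room for one more edge of maximum length.
  have hT : t (k + 1) + I.maxCost ≤ I.horizon (Triple.ofSeq (k + 1) t A r) := by
    refine Nat.add_le_add_left (Nat.le_mul_of_pos_left _ (by positivity)) _
  simp only [Nat.succ_eq_add_one] at *
  refine ⟨?_, ?_, not_forbidden_ofSeq fun i hi hAi => ⟨fun h1 h2 => ?_, fun h1 h2 => ?_⟩⟩
  · simp only
    omega
  · have := hmax (lastItem I π t p tour r (k + 1)).1.loc (Site.target (n := n)).loc
    simp only
    omega
  · have := h.lt_of_t_lt (hx.1.trans_lt h1)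
    omega
  · have := h.lt_of_t_lt (hx.1.trans_lt h1)
    obtain rfl : i = k := by omega
    rw [lastItem, if_pos ((hA _ hi).1 hAi)]

end IsPlan

end DirLat

/-! ## The solution of a plan -/

namespace DirLat

variable {n : ℕ}

/-- A list of vertices that starts at the source, follows steps of the time-indexed graph to the
target, and contains every client once, is a walk. -/
theorem exists_isWalk {I : Instance n} {G : Triple n} {τ : Fin n → ℕ} {L : List (Site n × ℕ)}
    (hchain : ((.source, 0) :: (L ++ [(.target, I.horizon G + 1)])).IsChain (IsStep I G))
    (hmem : ∀ x ∈ L, (∃ v, x.1 = .client v) ∨ ∃ r ∈ G.roots, x.1 = .root r)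
    (hvisit : ∀ v, (.client v, τ v) ∈ L) (hunique : ∀ v t, (.client v, t) ∈ L → t = τ v) :
    ∃ N P, IsWalk I G.roots (I.horizon G) N P τ ∧ ∀ i ≤ N, IsStep I G (P i) (P (i + 1)) := by
  set W : List (Site n × ℕ) := (.source, 0) :: (L ++ [(.target, I.horizon G + 1)]) with hW
  have hlen : W.length = L.length + 2 := by simp [hW]
  rw [List.isChain_iff_getElem] at hchain
  have hP : ∀ i (hi : i < W.length), W.getD i (.source, 0) = W[i] := fun i hi => by
    rw [List.getD_eq_getElem _ _ hi]
  have hstep : ∀ i ≤ L.length, IsStep I G (W.getD i (.source, 0)) (W.getD (i + 1) (.source, 0)) := by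
    intro i hi
    rw [hP i (by omega), hP (i + 1) (by omega)]
    exact hchain i (by omega)
  have hin : ∀ i, 1 ≤ i → i ≤ L.length → W.getD i (.source, 0) ∈ L := by
    intro i h1 hi
    obtain ⟨i, rfl⟩ := Nat.exists_eq_succ_of_ne_zero (Nat.one_le_iff_ne_zero.1 h1)
    rw [hP _ (by omega)]
    simp only [hW, Nat.succ_eq_add_one, List.getElem_cons_succ]
    rw [List.getElem_append_left (by omega)]
    exact List.getElem_mem _
  refine ⟨L.length, fun i => W.getD i (.source, 0), ⟨rfl, ?_, fun i hi => (hstep i hi).1,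
    fun i hi => (hstep i hi).2.1, fun i h1 hi => hmem _ (hin i h1 hi), ?_, ?_⟩, hstep⟩
  · rw [hP _ (by omega)]
    simp [hW]
  · intro v
    obtain ⟨i, hi, heq⟩ := List.getElem_of_mem (hvisit v)
    refine ⟨i + 1, by omega, hi, ?_⟩
    rw [hP _ (by omega), ← heq]
    simp only [hW, List.getElem_cons_succ]
    rw [List.getElem_append_left hi]
  · intro i h1 hi v s heq
    refine hunique v s ?_
    rw [← heq]
    exact hin i h1 hi

theorem mem_roots_ofSeq {k : ℕ} {t : ℕ → ℕ} {A : ℕ → Prop} [DecidablePred A] {r : ℕ → Fin n}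
    {j : ℕ} (hj : j < k) (hA : A j) : r j ∈ (Triple.ofSeq k t A r).roots := by
  have hm : (⟨j, hj⟩ : Fin k) ∈ (Triple.ofSeq k t A r).tour :=
    Finset.mem_filter.2 ⟨Finset.mem_univ _, hA⟩
  exact Finset.mem_image.2 ⟨⟨_, hm⟩, Finset.mem_univ _, rfl⟩

theorem mem_tourTimes_ofSeq {k : ℕ} {t : ℕ → ℕ} {A : ℕ → Prop} [DecidablePred A] {r : ℕ → Fin n}
    {j s : ℕ} (hj : j < k) (hA : A j) (h1 : t j ≤ s) (h2 : s < t (j + 1)) :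
    s ∈ (Triple.ofSeq k t A r).tourTimes := by
  have hm : (⟨j, hj⟩ : Fin k) ∈ (Triple.ofSeq k t A r).tour :=
    Finset.mem_filter.2 ⟨Finset.mem_univ _, hA⟩
  exact Finset.mem_biUnion.2 ⟨_, hm, Finset.mem_Ico.2 ⟨h1, h2⟩⟩

namespace IsPlan

variable {I : Instance n} {π : Equiv.Perm (Fin n)} {k : ℕ} {t p : ℕ → ℕ} {tour : ℕ → Prop}
  {r : ℕ → Fin n}

theorem mem_stageItems (h : IsPlan I π k t p tour r) {j : ℕ} (hj : j < k) (x : Site n × ℕ) :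
    x ∈ stageItems I π t p tour r j ↔
      (tour (j + 1) ∧ (x = (.root (r j), t j + 3 * (t (j + 1) / 32)) ∨
        x = (.root (r j), t j + 10 * (t (j + 1) / 32)))) ∨
      ∃ m, p j < m ∧ m ≤ p (j + 1) ∧ x = (wsite π m, clientTime I π t j m) := by
  have hlt := h.p_lt hj
  have hc : x ∈ clientItems I π t p j ↔
      ∃ m, p j < m ∧ m ≤ p (j + 1) ∧ x = (wsite π m, clientTime I π t j m) := by
    simp only [clientItems, List.mem_map, List.mem_range'_1]
    constructor
    · rintro ⟨m, ⟨h1, h2⟩, rfl⟩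
      exact ⟨m, by omega, by omega, rfl⟩
    · rintro ⟨m, h1, h2, rfl⟩
      exact ⟨m, ⟨by omega, by omega⟩, rfl⟩
  rw [← hc]
  unfold stageItems
  split_ifs with ht
  · simp only [List.mem_cons, List.mem_append, List.not_mem_nil, ht, true_and]
    tauto
  · simp [ht]

theorem exists_walkItems (I : Instance n) (π : Equiv.Perm (Fin n)) (t p : ℕ → ℕ)
    (tour : ℕ → Prop) (r : ℕ → Fin n) (j : ℕ) :
    ∃ L, walkItems I π t p tour r j = (.source, 0) :: L ∧
      ∀ x, x ∈ L ↔ ∃ i < j, x ∈ stageItems I π t p tour r i := by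
  induction j with
  | zero => exact ⟨[], rfl, by simp⟩
  | succ j ih =>
    obtain ⟨L, h1, h2⟩ := ih
    refine ⟨L ++ stageItems I π t p tour r j, by rw [walkItems, h1, List.cons_append],
      fun x => ?_⟩
    rw [List.mem_append, h2]
    constructor
    · rintro (⟨i, hi, hx⟩ | hx)
      · exact ⟨i, by omega, hx⟩
      · exact ⟨j, by omega, hx⟩
    · rintro ⟨i, hi, hx⟩
      rcases Nat.lt_succ_iff_lt_or_eq.1 hi with hlt | rfl
      · exact .inl ⟨i, hlt, hx⟩
      · exact .inr hx

theorem exists_stage (h : IsPlan I π k t p tour r) (m : ℕ) (h0 : 0 < m) (hm : m ≤ n) :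
    ∃ j < k, p j < m ∧ m ≤ p (j + 1) := by
  have hex : ∃ j, m ≤ p j := ⟨k, by rw [h.p_last]; exact hm⟩
  have h1 := Nat.find_spec hex
  have h2 : Nat.find hex ≤ k := Nat.find_min' hex (by rw [h.p_last]; exact hm)
  have h3 : Nat.find hex ≠ 0 := by
    intro h3
    rw [h3, h.staging.zero] at h1
    omega
  have h4 := Nat.find_min hex (m := Nat.find hex - 1) (by omega)
  refine ⟨Nat.find hex - 1, by omega, by omega, ?_⟩
  rwa [Nat.sub_add_cancel (by omega)]

theorem stage_unique (h : IsPlan I π k t p tour r) {i j m : ℕ} (hi : i < k) (hj : j < k)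
    (hi1 : p i < m) (hi2 : m ≤ p (i + 1)) (hj1 : p j < m) (hj2 : m ≤ p (j + 1)) : i = j := by
  by_contra hne
  rcases Nat.lt_or_gt_of_ne hne with hlt | hlt
  · have := h.p_mono (i := i + 1) (j := j) hlt hj.le
    omega
  · have := h.p_mono (i := j + 1) (j := i) hlt hi.le
    omega

/-- The linear program has a solution that charges every client the end of its stage. -/
theorem exists_feasible (h : IsPlan I π k t p tour r) (hpos : ∀ u v, u ≠ v → 0 < I.c u v)
    (hn : 0 < n) {A : ℕ → Prop} [DecidablePred A] (hA : ∀ j < k, A j ↔ tour (j + 1))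
    {st : ℕ → ℕ} (hst : ∀ m, 0 < m → m ≤ n → st m < k ∧ p (st m) < m ∧ m ≤ p (st m + 1)) :
    ∃ x z, I.IsFeasible (Triple.ofSeq k t A r) x z ∧
      I.lpCost (Triple.ofSeq k t A r) x =
        ∑ v : Fin n, (t (st ((π.symm v : ℕ) + 1) + 1) : ℝ) := by
  set G := Triple.ofSeq k t A r with hG
  set τ : Fin n → ℕ := fun v =>
    clientTime I π t (st ((π.symm v : ℕ) + 1)) ((π.symm v : ℕ) + 1) with hτ
  have hpv : ∀ v : Fin n, 0 < (π.symm v : ℕ) + 1 ∧ (π.symm v : ℕ) + 1 ≤ n := fun v =>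
    ⟨Nat.succ_pos _, (π.symm v).2⟩
  have hws : ∀ v : Fin n, wsite π ((π.symm v : ℕ) + 1) = .client v := fun v => by
    rw [wsite_client π (hpv v).1 (hpv v).2]
    simp
  have hwp : ∀ v : Fin n, waypoint π ((π.symm v : ℕ) + 1) = .client v := fun v => by
    rw [waypoint_client π (hpv v).1 (hpv v).2]
    simp
  have hstv := fun v : Fin n => hst _ (hpv v).1 (hpv v).2
  have htime : ∀ v : Fin n, t (st ((π.symm v : ℕ) + 1)) ≤ τ v ∧
      τ v < t (st ((π.symm v : ℕ) + 1) + 1) := fun v => by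
    have h1 := h.clientTime_lt (hstv v).1 (hstv v).2.2
    have h2 := h.gap hpos (hstv v).1
    exact ⟨h1.1, by simp only [hτ]; omega⟩
  obtain ⟨L, hL, hLmem⟩ := exists_walkItems I π t p tour r k
  obtain ⟨N, P, hwalk, hstep⟩ := exists_isWalk (I := I) (G := G) (τ := τ) (L := L) (by
      rw [← List.cons_append, ← hL, List.isChain_append]
      refine ⟨h.isChain_walkItems hpos hA le_rfl, List.isChain_singleton _, fun x hx y hy => ?_⟩
      rw [h.getLast?_walkItems le_rfl] at hx
      obtain rfl : _ = x := Option.some.inj hx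
      obtain rfl : _ = y := Option.some.inj hy
      exact h.isStep_target hpos hA hn) (by
      intro x hx
      obtain ⟨i, hi, hx⟩ := (hLmem x).1 hx
      rcases (h.mem_stageItems hi x).1 hx with ⟨ht, rfl | rfl⟩ | ⟨m, h1, h2, rfl⟩
      · exact .inr ⟨r i, mem_roots_ofSeq hi ((hA i hi).2 ht), rfl⟩
      · exact .inr ⟨r i, mem_roots_ofSeq hi ((hA i hi).2 ht), rfl⟩
      · have := (h.p_le (j := i + 1) hi).trans (h.blockEnd_le _)
        exact .inl ⟨_, wsite_client π (by omega) (by omega)⟩) (by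
      intro v
      refine (hLmem _).2 ⟨_, (hstv v).1, (h.mem_stageItems (hstv v).1 _).2 (.inr
        ⟨_, (hstv v).2.1, (hstv v).2.2, ?_⟩)⟩
      rw [hws]) (by
      intro v s hs
      obtain ⟨i, hi, hx⟩ := (hLmem _).1 hs
      rcases (h.mem_stageItems hi _).1 hx with ⟨ht, heq | heq⟩ | ⟨m, h1, h2, heq⟩
      · cases congrArg Prod.fst heq
      · cases congrArg Prod.fst heq
      · obtain ⟨heq1, rfl⟩ := Prod.mk.inj heq
        have hm : m ≤ n := by
          have := (h.p_le (j := i + 1) hi).trans (h.blockEnd_le _)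
          omega
        rw [wsite_client π (by omega) hm] at heq1
        have hmv : m = (π.symm v : ℕ) + 1 := by
          rw [Site.client.inj heq1]
          simp
          omega
        subst hmv
        have := h.stage_unique hi (hstv v).1 h1 h2 (hstv v).2.1 (hstv v).2.2
        simp only [hτ, ← this])
  refine ⟨_, _, hwalk.isFeasible (fun i hi => (hstep i hi).2.2) ?_ ?_, ?_⟩
  · intro v
    exact (htime v).2.trans_le (h.t_strictMono.monotone (hstv v).1)
  · intro u v i j hij hshort hu hv hlt
    by_contra hcon
    have hnot : ∀ w, τ w ∉ G.tourTimes → ¬ tour (st ((π.symm w : ℕ) + 1) + 1) := fun w hw ht =>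
      hw (mem_tourTimes_ofSeq (hstv w).1 ((hA _ (hstv w).1).2 ht) (htime w).1 (htime w).2)
    have hu' := hnot u hu
    have hv' := hnot v hv
    set l := (π.symm u : ℕ) + 1 with hl
    set m := (π.symm v : ℕ) + 1 with hm
    obtain ⟨hsu, hsu1, hsu2⟩ : st l < k ∧ p (st l) < l ∧ l ≤ p (st l + 1) := hstv u
    obtain ⟨hsv, hsv1, hsv2⟩ : st m < k ∧ p (st m) < m ∧ m ≤ p (st m + 1) := hstv v
    have hi1 : st l < (i : ℕ) + 1 := h.lt_of_t_lt ((htime u).1.trans_lt hlt)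
    have hi2 : (i : ℕ) + 1 < st m + 1 := h.lt_of_t_lt ((not_lt.1 hcon).trans_lt (htime v).2)
    refine hshort ?_
    have ej : G.t j.succ = t (i + 2) := congrArg (fun a => t (a + 1)) hij
    rw [Instance.IsShort, ← hwp u, ← hwp v, ej]
    change I.wdist π l m ≤ max (I.wdist π m l) (t (i + 2))
    -- If `v` is in the stage after that of `u`, the path up to `v` is shorter than the threshold,
    -- so the pair is short. Otherwise a pair that is not short would make `v` bad in a stage
    -- without a tour.
    by_cases hadj : st m ≤ st l + 1
    · have h1 := h.p_mono (i := st l + 1) (j := st m) (by omega) (by omega)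
      have h2 := I.wdist_add_arrival_le π (l := l) (m := m) (by omega)
      have h3 := I.arrival_mono π hsv2
      have h4 := h.arrival_p_le (j := st m + 1) hsv
      have h5 : st m + 1 = i + 2 := by omega
      rw [h5] at h4 h3
      refine le_max_of_le_right ?_
      omega
    · have h1 := h.staging.not_bad (st m) hsv m (hsv2.trans (h.p_le hsv)) hsv1
        (fun ht => absurd ht hv')
      by_contra hlt'
      refine h1 ⟨st l, by omega, hu', l, hsu1, hsu2, ?_⟩
      refine lt_of_le_of_lt (max_le_max le_rfl (h.t_strictMono.monotone ?_)) (not_le.1 hlt')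
      omega
  · rw [hwalk.lpCost_eq]
    refine Finset.sum_congr rfl fun v _ => ?_
    have hin : ∀ i : Fin G.q, τ v ∈ G.interval i ↔ i = ⟨st ((π.symm v : ℕ) + 1), (hstv v).1⟩ := by
      intro i
      rw [Triple.interval, Finset.mem_Ico]
      change t i ≤ τ v ∧ τ v < t (i + 1) ↔ _
      constructor
      · rintro ⟨h1, h2⟩
        have h3 := h.lt_of_t_lt (h1.trans_lt (htime v).2)
        have h4 := h.lt_of_t_lt ((htime v).1.trans_lt h2)
        exact Fin.ext (by simp only; omega)
      · rintro rfl
        exact htime v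
    simp only [hin, Finset.sum_ite_eq', Finset.mem_univ, if_true]
    rfl

end IsPlan

end DirLat

/-! ## The cost of a plan -/

namespace DirLat

variable {n : ℕ}

theorem sum_perm_eq (π : Equiv.Perm (Fin n)) (f : ℕ → ℕ) :
    ∑ v : Fin n, f ((π.symm v : ℕ) + 1) = ∑ i ∈ Finset.range n, f (i + 1) := by
  rw [Equiv.sum_comp π.symm (fun i : Fin n => f ((i : ℕ) + 1))]
  exact Fin.sum_univ_eq_sum_range (fun i => f (i + 1)) n

theorem sum_range_blockEnd_succ {k j : ℕ} (hj : j < k) (f : ℕ → ℕ) :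
    ∑ i ∈ Finset.range (blockEnd k (j + 1)), f (i + 1) =
      ∑ i ∈ Finset.range (blockEnd k j), f (i + 1) +
        ∑ i ∈ Finset.range (2 ^ (k - (j + 1))), f (blockEnd k j + i + 1) := by
  rw [blockEnd_succ hj, Finset.sum_range_add]

/-- The cost of thresholds that grow geometrically until they meet the arrival times at the ends
of the blocks, when every point is charged the end of the stage after its block. -/
theorem sum_threshold_le {k : ℕ} {t a F : ℕ → ℕ} (hk : 0 < k) (ha : Monotone a) (ha0 : a 0 = 0)
    (ht0 : t 0 = 0)
    (ht : ∀ j < k, 2 * t (j + 1) ≤ 3 * t j + 66 * a (blockEnd k (j + 1)))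
    (hF : ∀ j < k, ∀ m, blockEnd k j < m → m ≤ blockEnd k (j + 1) → F m ≤ t (min (j + 2) k)) :
    ∑ i ∈ Finset.range (blockEnd k k), F (i + 1) ≤
      528 * ∑ i ∈ Finset.range (blockEnd k k), a (i + 1) := by
  set X : ℕ → ℕ := fun j => ∑ i ∈ Finset.range j, 2 ^ (k - (i + 1)) * t (i + 1) with hX
  set Y : ℕ → ℕ := fun j => ∑ i ∈ Finset.range j, 2 ^ (k - (i + 1)) * a (blockEnd k (i + 1)) with hY
  set S : ℕ → ℕ := fun j => ∑ i ∈ Finset.range (blockEnd k j), F (i + 1) with hS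
  set Z : ℕ → ℕ := fun j => ∑ i ∈ Finset.range (blockEnd k j), a (i + 1) with hZ
  have hXs : ∀ j, X (j + 1) = X j + 2 ^ (k - (j + 1)) * t (j + 1) := fun j =>
    Finset.sum_range_succ _ _
  have hYs : ∀ j, Y (j + 1) = Y j + 2 ^ (k - (j + 1)) * a (blockEnd k (j + 1)) := fun j =>
    Finset.sum_range_succ _ _
  have hpow : ∀ j < k, 2 ^ (k - j) = 2 * 2 ^ (k - (j + 1)) := fun j hj => by
    rw [← pow_succ']
    congr 1
    omega
  -- A potential argument: passing to the next stage halves the weight, and the recursion for `t`,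
  -- doubled, is exactly what the potential pays for.
  have h1 : ∀ j ≤ k, X j + 3 * (2 ^ (k - j) * t j) ≤ 132 * Y j := by
    intro j hj
    induction j with
    | zero => simp [hX, ht0]
    | succ j ih =>
      have ih := ih (by omega)
      rw [hpow j hj] at ih
      rw [hXs, hYs]
      have := Nat.mul_le_mul_left (2 ^ (k - (j + 1))) (ht j hj)
      rw [mul_add] at this
      nlinarith
  have hSs : ∀ j < k, S (j + 1) ≤ S j + 2 ^ (k - (j + 1)) * t (min (j + 2) k) := by
    intro j hj
    simp only [hS]
    rw [sum_range_blockEnd_succ hj F]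
    refine Nat.add_le_add_left ?_ _
    refine (Finset.sum_le_card_nsmul _ _ (t (min (j + 2) k)) fun i hi => ?_).trans (by simp)
    refine hF j hj _ (by omega) ?_
    rw [blockEnd_succ hj]
    have := Finset.mem_range.1 hi
    omega
  -- A block is charged the end of the following stage, whose weight in `X` is half the size of the
  -- block.
  have h2 : ∀ j < k, S j ≤ 2 * X (j + 1) := by
    intro j hj
    induction j with
    | zero => simp [hS, blockEnd_zero]
    | succ j ih =>
      have ih := ih (by omega)
      have h3 := hSs j (by omega)
      rw [min_eq_left (by omega)] at h3
      rw [hXs]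
      rw [hpow (j + 1) hj] at h3
      nlinarith
  -- Every client of a block arrives no earlier than the end of the preceding block, which is twice
  -- as large. Each block end is thus paid for by the following block, at a loss of a factor `2`.
  have h3 : ∀ j ≤ k, Y j + 2 * a (blockEnd k j) ≤ 2 * Z j + 2 ^ (k - j) * a (blockEnd k j) := by
    intro j hj
    induction j with
    | zero => simp [hY, hZ, blockEnd_zero, ha0]
    | succ j ih =>
      have ih := ih (by omega)
      have hpos : 0 < 2 ^ (k - (j + 1)) := by positivity
      have h4 : Z j + (2 ^ (k - (j + 1)) - 1) * a (blockEnd k j) + a (blockEnd k (j + 1)) ≤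
          Z (j + 1) := by
        simp only [hZ]
        rw [sum_range_blockEnd_succ hj a, add_assoc]
        refine Nat.add_le_add_left ?_ _
        obtain ⟨h, hh⟩ : ∃ h, 2 ^ (k - (j + 1)) = h + 1 := ⟨_, (Nat.sub_add_cancel hpos).symm⟩
        rw [blockEnd_succ hj, hh, Finset.sum_range_succ]
        refine Nat.add_le_add ?_ (by rw [add_assoc])
        rw [Nat.add_sub_cancel]
        have := Finset.card_nsmul_le_sum (Finset.range h) (fun i => a (blockEnd k j + i + 1))
          (a (blockEnd k j)) fun i _ => ha (by omega)
        simpa using this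
      rw [hpow j hj] at ih
      rw [hYs]
      obtain ⟨h, hh⟩ : ∃ h, 2 ^ (k - (j + 1)) = h + 1 := ⟨_, (Nat.sub_add_cancel hpos).symm⟩
      rw [hh] at ih h4 ⊢
      rw [Nat.add_sub_cancel] at h4
      nlinarith
  obtain ⟨q, rfl⟩ := Nat.exists_eq_succ_of_ne_zero hk.ne'
  have e1 := h1 (q + 1) le_rfl
  have e2 := h2 q (Nat.lt_succ_self q)
  have e3 := h3 (q + 1) le_rfl
  have e4 := hSs q (Nat.lt_succ_self q)
  simp only [Nat.succ_eq_add_one, Nat.sub_self, pow_zero, one_mul] at e1 e2 e3 e4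
  rw [min_eq_right (by omega)] at e4
  -- `S ≤ 2 X + t k ≤ 264 Y ≤ 528 Z`; the `3 * t k` in `h1` absorbs the charge for the single client
  -- of the last block.
  change S (q + 1) ≤ 528 * Z (q + 1)
  omega

theorem exists_locOf (x : Loc n) : ∃ a < n + 2, locOf n a = x := by
  cases x with
  | client v => exact ⟨v, by omega, locOf_client v⟩
  | source => exact ⟨n, by omega, by simp [locOf]⟩
  | target => exact ⟨n + 1, by omega, by simp [locOf]⟩

/-- At most `n < 2 ^ k` edges, each no longer than the sum of all distances. -/
theorem Instance.arrival_le_reach (I : Instance n) (π : Equiv.Perm (Fin n)) {k m : ℕ}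
    (hk : n + 1 = 2 ^ k) (hm : m ≤ n) : I.arrival π m ≤ I.reach k := by
  have h1 : I.arrival π m ≤ m * I.matrixSum := by
    refine (Finset.sum_le_card_nsmul _ _ I.matrixSum fun j _ => ?_).trans (by simp)
    obtain ⟨a, ha, ha'⟩ := exists_locOf (waypoint π j)
    obtain ⟨b, hb, hb'⟩ := exists_locOf (waypoint π (j + 1))
    rw [← ha', ← hb']
    exact I.cost_le_matrixSum ha hb
  rw [Instance.reach, ← hk, mul_comm]
  exact h1.trans (Nat.mul_le_mul_right _ (by omega))

theorem IsPlan.sum_le {I : Instance n} {π : Equiv.Perm (Fin n)} {k : ℕ} {t p : ℕ → ℕ}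
    {tour : ℕ → Prop} {r : ℕ → Fin n} (h : IsPlan I π k t p tour r) (hn : 0 < n)
    (ht : ∀ j < k, 2 * t (j + 1) ≤ 3 * t j + 66 * I.arrival π (blockEnd k (j + 1)))
    {st : ℕ → ℕ} (hst : ∀ m, 0 < m → m ≤ n → st m < k ∧ p (st m) < m ∧ m ≤ p (st m + 1)) :
    ∑ v : Fin n, t (st ((π.symm v : ℕ) + 1) + 1) ≤ 528 * I.latency π := by
  have hk : 0 < k := (hst 1 one_pos hn).1.pos
  have he : blockEnd k k = n := by
    have h1 := h.card
    have h2 := blockEnd_add (le_refl k)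
    simp only [Nat.sub_self, pow_zero] at h2
    omega
  have hmain := sum_threshold_le (t := t) (a := I.arrival π) (F := fun m => t (st m + 1)) hk
    (I.arrival_mono π) rfl h.t_zero ht ?_
  · rw [he] at hmain
    rw [Instance.latency, sum_perm_eq π (I.arrival π), sum_perm_eq π (fun m => t (st m + 1))]
    exact hmain
  · intro j hj m hm hm'
    have h1 := h.blockEnd_le (j + 1)
    obtain ⟨h2, h3, h4⟩ := hst m (by omega) (by omega)
    -- By `lt_p`, stage `j + 2` reaches beyond the end of block `j + 1`, so the point belongs to
    -- stage `j + 2` or an earlier one.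
    refine h.t_strictMono.monotone (le_min ?_ h2)
    by_cases hjk : j + 1 < k
    · have h5 := h.lt_p hjk
      by_contra hcon
      have h6 := h.p_mono (i := j + 1 + 1) (j := st m) (by omega) h2.le
      omega
    · omega

/-! ## The theorem -/

/-- For every path, some guess admits a cheap solution of its linear program. -/
theorem Instance.exists_cheap {k : ℕ} (I : Instance n) (hn : 0 < n) (hk : n + 1 = 2 ^ k)
    (hpos : ∀ u v, u ≠ v → 0 < I.c u v) (π : Equiv.Perm (Fin n)) :
    ∃ G ∈ I.triples hn k, ∃ x z, I.IsFeasible G x z ∧ I.lpCost G x ≤ 532 * (I.latency π : ℝ) := by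
  have hend : ∀ j, blockEnd k j ≤ n := fun j => by
    have : 0 < 2 ^ (k - j) := by positivity
    unfold blockEnd
    omega
  -- The order of choices matters: thresholds depend only on the path, the stages depend on the
  -- thresholds, and the tour bits are known only after the stages.
  obtain ⟨t, ht⟩ := exists_guess_of_targets (k := k) I
    (D := fun j => I.arrival π (blockEnd k j)) (fun j hj => by
      have h1 := I.arrival_lt π hpos hn
      have h2 := blockEnd_strict hj
      have h3 := I.arrival_mono π (show 0 + 1 ≤ blockEnd k (j + 1) by omega)
      omega) (fun j _ => I.arrival_le_reach π hk (hend _))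
  obtain ⟨p, tour, hstag⟩ := exists_staging (I.wdist π) t k
  obtain ⟨g, hg, hthr, hbit, htarget⟩ := ht fun j => tour (j + 1)
  have hstaged : IsStaged I π k (threshold g) p tour :=
    ⟨hk, rfl, strictMono_nat_of_lt_succ fun j => (threshold_step g j).1,
      fun j => (threshold_step g j).2.2, fun j hj => (htarget j hj).1,
      hstag.congr fun j hj => (hthr j hj).symm⟩
  have hplan : IsPlan I π k (threshold g) p tour (I.rootOf hn g) := by
    refine ⟨hstaged, fun j hj ht ht' => ?_, fun j hj ht ht' => ?_⟩
    · have h1 := (hbit j hj).2 ht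
      have h2 : prevBit g j < 1 := by
        cases j with
        | zero => exact one_pos
        | succ j =>
          have := (hbit j (by omega)).not.2 ht'
          simp only [prevBit]
          omega
      have h3 : (n + 1) / 2 ^ j = 2 ^ (k - j) := by rw [hk, Nat.pow_div hj.le two_pos]
      change IsCentral _ _ _ _ (rootWord I.cost n g (j + 1) - 1)
      rw [rootWord, if_pos ⟨h1, h2⟩, h3]
      exact isCentral_pickRoot (hstaged.exists_central hj ht)
    · obtain ⟨j, rfl⟩ : ∃ j', j = j' + 1 :=
        ⟨j - 1, by have := hstaged.two_le_of_tour hj ht; omega⟩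
      have h2 : ¬ prevBit g (j + 1) < 1 := by
        have := (hbit j (by omega)).2 ht'
        simp only [prevBit]
        omega
      refine Fin.ext ?_
      change rootWord I.cost n g (j + 1 + 1) - 1 = rootWord I.cost n g (j + 1) - 1
      rw [rootWord, if_neg fun hcon => h2 hcon.2]
  choose! st hst using hplan.exists_stage
  obtain ⟨x, z, hx, hcost⟩ := hplan.exists_feasible hpos hn (A := fun j => 0 < tourBit g j)
    hbit hst
  refine ⟨I.decode hn k g, List.mem_map.2 ⟨g, List.mem_range.2 hg, rfl⟩, x, z, hx, ?_⟩
  have h1 := hplan.sum_le hn (fun j hj => (htarget j hj).2) hst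
  calc I.lpCost (I.decode hn k g) x = _ := hcost
    _ ≤ 528 * (I.latency π : ℝ) := by exact_mod_cast h1
    _ ≤ _ := by
      have : (0 : ℝ) ≤ I.latency π := Nat.cast_nonneg _
      linarith

end DirLat

theorem mainTheorem4 :
    ∃ (prog : RAM.Prog) (C d : ℕ),
      ∀ (ε : ℝ), 0 < ε → ∀ (n : ℕ) (I : DirLat.Instance n), I.IsNice ε →
        ∃ (steps : ℕ) (σ : RAM.State) (L : List (DirLat.Triple n)),
          -- on input `I`, the program halts and outputs the list `L`, in polynomial time
          RAM.Exec prog I.input steps σ ∧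
          σ.HasOutput (DirLat.encodeTriples L) ∧
          (steps : ℝ) ≤ C * ((n : ℝ) + 1 / ε + 1) ^ d ∧
          -- the list is polynomial-sized and consists of admissible triples
          (L.length : ℝ) ≤ C * ((n : ℝ) + 1 / ε + 1) ^ d ∧
          (∀ G ∈ L, G.IsValid) ∧
          -- for one of the triples the linear program has a cheap solution
          ∀ OPT : Equiv.Perm (Fin n), I.IsOptimal OPT →
            ∃ G ∈ L, ∃ (x : DirLat.Site n × ℕ → ℝ) (z : DirLat.TimeEdge n → ℝ),
              I.IsFeasible G x z ∧ I.lpCost G x ≤ 532 * (I.latency OPT : ℝ) := by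
  obtain ⟨C, d, hCd⟩ := DirLat.NiceInput.polyBounded_stepBound.add
    DirLat.NiceInput.one_le_size DirLat.NiceInput.polyBounded_guessCount
  refine ⟨DirLat.mainProg, C, d, fun ε hε n I hI => ?_⟩
  -- Without clients the distance from `s` to `s'` would have to be positive and at most `0`, so no
  -- nice instance is empty.
  have hn : 0 < n := by
    rcases Nat.eq_zero_or_pos n with rfl | hn
    · have h1 := hI.2 .source .target (by simp)
      have h2 : (I.c .source .target : ℝ) ≤ 0 := by simpa using h1.2
      have h3 : (0 : ℝ) < I.c .source .target := by exact_mod_cast h1.1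
      linarith
    · exact hn
  obtain ⟨k, hk⟩ := hI.1
  have hbound := hCd ⟨n, k, ε, I, hε, hI, hk⟩
  simp only [DirLat.NiceInput.size, Nat.cast_add] at hbound
  obtain ⟨steps, σ, hexec, hsteps, hout⟩ := DirLat.runs_mainProg I hn hk
  have h1 : (0 : ℝ) ≤ I.stepBound k := Nat.cast_nonneg _
  have h2 : (0 : ℝ) ≤ I.guessCount k := Nat.cast_nonneg _
  have h3 : (steps : ℝ) ≤ I.stepBound k := Nat.cast_le.2 hsteps
  refine ⟨steps, σ, I.triples hn k, hexec, hout, by linarith, ?_, ?_, fun π _ =>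
    I.exists_cheap hn hk (fun u v huv => (hI.2 u v huv).1) π⟩
  · simp only [DirLat.Instance.triples, List.length_map, List.length_range]
    linarith
  · intro G hG
    obtain ⟨g, -, rfl⟩ := List.mem_map.1 hG
    exact I.isValid_decode hn hk g
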